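/- **Theorem (Morse maps are morphisms).** *Setting.* Let $R$ be a nonzero commutative ring and $S=R[x_1,\dots,x_n]$. Let $X$ be a finite regular CW complex (Hausdorff, with injective characteristic maps on closed balls) whose vertices $v$ carry monomial labels $\mathbf x^{\mathbf a_v}$; a cell $F$ gets the label $\mathbf x^{\mathbf a_F}=\mathrm{lcm}\{\mathbf x^{\mathbf a_v}: v\in \overline F\}$. Let $\operatorname{sign}(G,F)\in\{-1,0,1\}$ be an incidence function of $X$ (nonzero exactly when $G$ is a codimension-one face of $F$). The cellular complex $\mathcal F_X$ is free over $S$; in homological degree $i\ge 1$ it has one generator $e_F$ for each $(i-1)$-cell $F$, and in degree $0$ one generator for each connected component of $X$ (and one generator if $X$ is empty). Its differential is $\partial e_F=\sum_G\operatorname{sign}(G,F)\,\mathbf x^{\mathbf a_F-\mathbf a_G}e_G$ for $\dim F\geq 1$, and a vertex generator $e_v$ goes to $\mathbf x^{\mathbf a_v}$ times the generator of the component of $v$. $\mathcal F_X$ is a *cellular resolution* if $H_i(\mathcal F_X)=0$ for all $i>0$. *Morphisms.* A morphism $\mathcal F_X\to\mathcal F_Y$ of cellular resolutions is a pair $(\mathbf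 f,f)$ of a chain map $\mathbf f:\mathcal F_X\to\mathcal F_Y$ and a cellular map $f:X\to Y$ that are *compatible*: (i) for every cell $x$, the image $f(\overline x)$ is a union of closed cells $\overline{y_1},\dots,\overline{y_r}$ of $Y$, where $y_1,\dots,y_r$ are all the cells of $Y$ whose closure lies in $f(\overline x)$; (ii) $\mathbf f(e_x)$ is an $S$-linear combination of the generators $e_{y_j}$ with $\dim y_j=\dim x$; (iii) for every cell $x$ whose label is a minimal generator of the label ideal of its component (the ideal generated by the labels of the vertices of that component), $\mathbf f_0$ maps the label of $x$, in the summand of the component of $x$, to $\mathrm{lcm}(\mathbf x^{\mathbf a_{y_1}},\dots,\mathbf x^{\mathbf a_{y_r}})$, in the summand of the component of $f(\overline x)$. *Morse matchings.* A Morse matching $M$ on $X$ and $\mathcal F_X$ is a set of pairwise non-adjacent edges $\tau\to\sigma$ ($\sigma$ a codimension-one face of $\tau$; the generators in degree $0$ are not matched) of the face poset diagram such that reversing them creates no directed cycle, and such that for each of them the component $S e_\tau\to S e_\sigma$ of the differential is an isomorphism (equivalently, $\sigma$ and $\tau$ have the same label). Let $\varphi:\mathcal F_X\to\mathcal F_X$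 be the associated splitting homotopy of degree $1$: $\varphi(e_\sigma)=d_{\sigma\tau}^{-1}e_\tau-\sum_{\rho\ne\sigma}\varphi(d_{\rho\tau}d_{\sigma\tau}^{-1}e_\rho)$ if $\sigma$ is matched with $\tau$ of dimension $\dim\sigma+1$, and $\varphi=0$ on all other generators. Here $d_{\rho\tau}$ is the coefficient of $e_\rho$ in $\partial e_\tau$. The Morse complex $\tilde{\mathcal F}$ is spanned by the generators of degree $0$ and of the critical (unmatched) cells, with differential $\rho(\partial-\partial\varphi \partial)$, where $\rho$ is the projection, and the Morse chain map is $\mathbf f=\rho(\mathrm{id}-\partial\varphi-\varphi \partial):\mathcal F_X\to\tilde{\mathcal F}$. *Statement.* Let $\mathcal F_X$ be a cellular resolution and let $M$ be a Morse matching on $X$ and $\mathcal F_X$ whose critical cells form a subcomplex $\tilde X$ of $X$. A *Morse retraction* $X\to\tilde X$ is a composition of retractions of elementary collapses along the edges of $M$, one at a time: one step goes from a subcomplex $A$ to a subcomplex $B=A\setminus(\sigma\cup\tau)$ ($\sigma,\tau$ matched open cells of $A$) by a continuous map $A\to B$ that is the identity on $B$ and maps $\overline\tau$ into $\partial\tau$.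 Then: 1. Morse retractions $X\to\tilde X$ exist, and each of them is a strong deformation retraction. 2. $\mathcal F_{\tilde X}$, for the restricted labels and signs, is a cellular resolution, and $\tilde{\mathcal F}\cong\mathcal F_{\tilde X}$ by the isomorphism of complexes that sends the generator of each critical cell to the generator of that cell, and the generator of a component of $X$ to the generator of the component of $\tilde X$ that it contains. 3. For every Morse retraction $f:X\to\tilde X$, the pair $(\mathbf f,f)$ (with $\tilde{\mathcal F}$ identified with $\mathcal F_{\tilde X}$) is compatible, so it is a morphism of cellular resolutions from $\mathcal F_X$ to $\mathcal F_{\tilde X}$. 4. If whenever a vertex is matched with an edge both endpoints of that edge have the same label, then the equality in (iii) holds for all cells $x$ of $X$. If $M$ consists of a single edge, then the coefficient of $e_y$ in $\mathbf f(e_x)$ is nonzero if and only if $\overline y\subseteq f(\overline x)$, for all cells $x$ of $X$ and $y$ of $\tilde X$ of the same dimension. -/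

import Mathlib

namespace CellRes

open Topology Set
open Topology.RelCWComplex (cell map openCell closedCell cellFrontier skeleton)

universe u v w

/-! ### Regular cell complexes, faces and incidence functions

A finite CW complex is a Mathlib `CWComplex C` on a subset `C` of a Hausdorff space `E`, with
finitely many cells. -/

section Complex

variable {E : Type u} [TopologicalSpace E] (C : Set E) [CWComplex C]

/-- A CW complex is regular if its characteristic maps are injective on the closed ball
(hence homeomorphisms from the closed ball onto the closed cell). -/
def IsRegular : Prop :=
  ∀ (d : ℕ) (x : cell C d), InjOn (map d x) (Metric.closedBall 0 1)

noncomputable instance cellFintype [RelCWComplex.Finite C] (d : ℕ) : Fintype (cell C d) :=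
  haveI := RelCWComplex.FiniteType.finite_cell (C := C) (D := ∅) d
  Fintype.ofFinite _

theorem finite_sigma_cell [RelCWComplex.Finite C] : Finite (Σ d, cell C d) :=
  RelCWComplex.finite_cells_of_finite

variable {C}

/-- `σ` is a codimension one face of `τ`, that is, there is an edge from `τ` to `σ` in the
face poset diagram of `C`. -/
def IsFacet {d : ℕ} (σ : cell C d) (τ : cell C (d + 1)) : Prop :=
  closedCell d σ ⊆ closedCell (d + 1) τ

/-- An incidence (sign) function of a regular cell complex. The condition on edges is the
cancellation condition for the pairs consisting of an empty face and an edge, vertices having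
sign `1` over the empty face. -/
structure IsIncidence [RelCWComplex.Finite C]
    (sgn : ∀ d : ℕ, cell C d → cell C (d + 1) → ℤ) : Prop where
  values : ∀ d σ τ, sgn d σ τ = -1 ∨ sgn d σ τ = 0 ∨ sgn d σ τ = 1
  ne_zero_iff : ∀ d σ τ, sgn d σ τ ≠ 0 ↔ IsFacet σ τ
  edge : ∀ e : cell C 1, ∑ v : cell C 0, sgn 0 v e = 0
  diamond : ∀ (d : ℕ) (ρ : cell C d) (τ : cell C (d + 2)),
    ∑ σ : cell C (d + 1), sgn d ρ σ * sgn (d + 1) σ τ = 0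

variable (C) in
/-- The empty faces (faces of dimension `-1`). There is one for each connected component; the empty
complex also has one. For a connected complex this is a one-element type. -/
def EmptyFace : Type u :=
  {K : Set E // (C = ∅ ∧ K = ∅) ∨ ∃ p ∈ C, K = connectedComponentIn C p}

/-- The component belonging to an empty face. -/
def EmptyFace.carrier (K : EmptyFace C) : Set E := K.1

/-- The empty face of the component of the point `p`. -/
def emptyFaceAt (p : E) (hp : p ∈ C) : EmptyFace C :=
  ⟨connectedComponentIn C p, Or.inr ⟨p, hp, rfl⟩⟩

theorem center_mem {d : ℕ} (x : cell C d) : map d x 0 ∈ C :=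
  RelCWComplex.closedCell_subset_complex d x (RelCWComplex.map_zero_mem_closedCell d x)

/-- The empty face of the component containing the cell `x`. -/
def emptyFaceOf {d : ℕ} (x : cell C d) : EmptyFace C :=
  emptyFaceAt (map d x 0) (center_mem x)

variable (C) in
/-- The faces of dimension `i - 1`, which index the basis in homological degree `i`. -/
def Face : ℕ → Type u
  | 0 => EmptyFace C
  | d + 1 => cell C d

/-- A cell of dimension `d`, seen as a basis index in homological degree `d + 1`. -/
def toFace {d : ℕ} (x : cell C d) : Face C (d + 1) := x

end Complex

/-! ### Labels and cellular free complexes -/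

section Labels

variable {E : Type u} [TopologicalSpace E] {C : Set E} [CWComplex C] [RelCWComplex.Finite C]
variable {n : ℕ}

open Classical in
/-- The exponent of the label of a face: the least common multiple of the labels of its
vertices. Here `l v` is the exponent of the monomial label of the vertex `v`. -/
noncomputable def faceLabel (l : cell C 0 → (Fin n →₀ ℕ)) {d : ℕ} (x : cell C d) : Fin n →₀ ℕ :=
  (Finset.univ.filter fun v : cell C 0 => closedCell 0 v ⊆ closedCell d x).sup l

variable (R : Type v) [CommRing R]

/-- The entry `sign(σ, τ) x ^ (a_τ - a_σ)` of the differential. -/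
noncomputable def entry (l : cell C 0 → (Fin n →₀ ℕ))
    (sgn : ∀ d : ℕ, cell C d → cell C (d + 1) → ℤ) {d : ℕ}
    (σ : cell C d) (τ : cell C (d + 1)) : MvPolynomial (Fin n) R :=
  MvPolynomial.monomial (faceLabel l τ - faceLabel l σ) ((sgn d σ τ : ℤ) : R)

variable (C n) in
/-- The free module in homological degree `i` of the cellular complex. -/
abbrev FreeMod (i : ℕ) : Type (max u v) := Face C i →₀ MvPolynomial (Fin n) R

/-- The image of a generator under the differential of the cellular complex. A vertex is sent to
its label times the generator of the empty face of its component. -/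
noncomputable def boundary (l : cell C 0 → (Fin n →₀ ℕ))
    (sgn : ∀ d : ℕ, cell C d → cell C (d + 1) → ℤ) :
    ∀ i : ℕ, Face C (i + 1) → FreeMod C n R i
  | 0, v => Finsupp.single (emptyFaceOf (C := C) (d := 0) v)
      (MvPolynomial.monomial (faceLabel (C := C) (d := 0) l v) 1)
  | d + 1, τ => ∑ σ : cell C d, Finsupp.single (toFace σ) (entry R l sgn σ τ)

/-- The differential of the cellular complex, from homological degree `i + 1` to `i`. -/
noncomputable def diff (l : cell C 0 → (Fin n →₀ ℕ))
    (sgn : ∀ d : ℕ, cell C d → cell C (d + 1) → ℤ) (i : ℕ) :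
    FreeMod C n R (i + 1) →ₗ[MvPolynomial (Fin n) R] FreeMod C n R i :=
  Finsupp.linearCombination (MvPolynomial (Fin n) R) (boundary R l sgn i)

/-- The labelled cell complex `C` supports a cellular resolution: `C` is regular, and its cellular
complex has no homology in positive degrees. These are the objects of the category of
cellular resolutions over `R[x_1, …, x_n]`. -/
structure IsCellularResolution (l : cell C 0 → (Fin n →₀ ℕ))
    (sgn : ∀ d : ℕ, cell C d → cell C (d + 1) → ℤ) : Prop where
  regular : IsRegular C
  incidence : IsIncidence sgn
  exact : ∀ i : ℕ, Function.Exact (diff R l sgn (i + 1)) (diff R l sgn i)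

/-- The label of `x` is a minimal generator of the label ideal of the component of `x`, which is
the ideal generated by the labels of the vertices in that component. -/
def HasMinimalLabel (l : cell C 0 → (Fin n →₀ ℕ)) {d : ℕ} (x : cell C d) : Prop :=
  ∀ v : cell C 0, emptyFaceOf v = emptyFaceOf x → l v ≤ faceLabel l x → l v = faceLabel l x

end Labels

/-! ### Morphisms of cellular resolutions -/

section Morphisms

variable {E : Type u} [TopologicalSpace E] {C : Set E} [CWComplex C]
variable {E' : Type w} [TopologicalSpace E'] {D : Set E'} [CWComplex D]

/-- The image under `g` of the closed cell `x`. -/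
def cellImage (g : C(C, D)) {d : ℕ} (x : cell C d) : Set E' :=
  {q | ∃ p : C, (p : E) ∈ closedCell d x ∧ (g p : E') = q}

/-- The cells of `D` contained in the image under `g` of the closed cell `x`. -/
def imageCells (g : C(C, D)) {d : ℕ} (x : cell C d) : Set (Σ k, cell D k) :=
  {t | closedCell t.1 t.2 ⊆ cellImage g x}

/-- A map of CW complexes is cellular if it preserves the skeleta. -/
def IsCellularMap [T2Space E] [T2Space E'] (g : C(C, D)) : Prop :=
  ∀ (d : ℕ) (p : C), (p : E) ∈ skeleton C d → (g p : E') ∈ skeleton D d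

variable [RelCWComplex.Finite C] [RelCWComplex.Finite D] {n : ℕ}

/-- The least common multiple of the labels of the cells onto which `g` maps the cell `x`. -/
noncomputable def imageLabel (lD : cell D 0 → (Fin n →₀ ℕ)) (g : C(C, D)) {d : ℕ} (x : cell C d) :
    Fin n →₀ ℕ :=
  haveI := finite_sigma_cell D
  (Set.toFinite (imageCells g x)).toFinset.sup fun t => faceLabel lD t.2

variable (R : Type v) [CommRing R]

/-- The chain map in degree `0` and the cellular map act in the same way on the label of the
cell `x`: the element given by the label of `x` in the component of `x` is sent to the element
given by the label of the image of `x`, in the component of the image. -/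
def LabelAgrees (lC : cell C 0 → (Fin n →₀ ℕ)) (lD : cell D 0 → (Fin n →₀ ℕ))
    (f₀ : FreeMod C n R 0 →ₗ[MvPolynomial (Fin n) R] FreeMod D n R 0) (g : C(C, D))
    {d : ℕ} (x : cell C d) : Prop :=
  f₀ (Finsupp.single (emptyFaceOf x) (MvPolynomial.monomial (faceLabel lC x) 1)) =
    Finsupp.single (emptyFaceAt (g ⟨map d x 0, center_mem x⟩ : E') (Subtype.coe_prop _))
      (MvPolynomial.monomial (imageLabel lD g x) 1)

/-- Compatibility of a chain map with a cellular map: `g` maps every cell `x` onto a union of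
cells, the generator of `x` is sent to some linear combination of the generators of the cells (of
the same dimension) in that union, and `f₀` agrees with `g` on the generators of the label
ideals. -/
structure IsCompatible (lC : cell C 0 → (Fin n →₀ ℕ)) (lD : cell D 0 → (Fin n →₀ ℕ))
    (f : ∀ i, FreeMod C n R i →ₗ[MvPolynomial (Fin n) R] FreeMod D n R i) (g : C(C, D)) :
    Prop where
  image_eq : ∀ (d : ℕ) (x : cell C d), cellImage g x = ⋃ t ∈ imageCells g x, closedCell t.1 t.2
  generator : ∀ (d : ℕ) (x : cell C d) (y : cell D d),
    f (d + 1) (Finsupp.single (toFace x) 1) (toFace y) ≠ 0 → ⟨d, y⟩ ∈ imageCells g x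
  label : ∀ (d : ℕ) (x : cell C d), HasMinimalLabel lC x → LabelAgrees R lC lD (f 0) g x

/-- `(f, g)` is a morphism of cellular resolutions from `C` to `D`. -/
structure IsMorphism [T2Space E] [T2Space E']
    (lC : cell C 0 → (Fin n →₀ ℕ)) (sC : ∀ d : ℕ, cell C d → cell C (d + 1) → ℤ)
    (lD : cell D 0 → (Fin n →₀ ℕ)) (sD : ∀ d : ℕ, cell D d → cell D (d + 1) → ℤ)
    (f : ∀ i, FreeMod C n R i →ₗ[MvPolynomial (Fin n) R] FreeMod D n R i) (g : C(C, D)) :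
    Prop where
  source : IsCellularResolution R lC sC
  target : IsCellularResolution R lD sD
  chainMap : ∀ i, (f i).comp (diff R lC sC i) = (diff R lD sD i).comp (f (i + 1))
  cellular : IsCellularMap g
  compatible : IsCompatible R lC lD f g

end Morphisms

/-! ### Morse matchings -/

section Matching

variable {E : Type u} [TopologicalSpace E] {C : Set E} [CWComplex C]

/-- The directed graph obtained from the face poset diagram by reversing the edges in `pair`. -/
inductive MorseStep (pair : ∀ d : ℕ, cell C d → cell C (d + 1) → Prop) :
    (Σ d, cell C d) → (Σ d, cell C d) → Prop
  | down {d : ℕ} (σ : cell C d) (τ : cell C (d + 1)) (h : IsFacet σ τ) (hp : ¬ pair d σ τ) :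
      MorseStep pair ⟨d + 1, τ⟩ ⟨d, σ⟩
  | up {d : ℕ} (σ : cell C d) (τ : cell C (d + 1)) (hp : pair d σ τ) :
      MorseStep pair ⟨d, σ⟩ ⟨d + 1, τ⟩

variable (C) in
/-- A Morse matching on the face poset diagram of `C`: a set of pairwise non-adjacent edges
whose reversal creates no directed cycle. -/
structure MorseMatching where
  /-- `pair d σ τ` says that the edge from `τ` to `σ` is in the matching. -/
  pair : ∀ d : ℕ, cell C d → cell C (d + 1) → Prop
  facet : ∀ {d σ τ}, pair d σ τ → IsFacet σ τ
  upper_unique : ∀ {d σ τ τ'}, pair d σ τ → pair d σ τ' → τ = τ'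
  lower_unique : ∀ {d σ σ' τ}, pair d σ τ → pair d σ' τ → σ = σ'
  not_both : ∀ {d σ τ ρ}, pair d σ τ → ¬ pair (d + 1) τ ρ
  acyclic : ∀ a, ¬ Relation.TransGen (MorseStep pair) a a

namespace MorseMatching

variable (M : MorseMatching C)

/-- The cell `x` is matched with a cell of one dimension less. -/
def IsUpper : ∀ {d : ℕ}, cell C d → Prop
  | 0, _ => False
  | d + 1, x => ∃ σ : cell C d, M.pair d σ x

/-- The cell `x` is critical, that is, not in the matching. -/
def IsCritical {d : ℕ} (x : cell C d) : Prop :=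
  (¬ ∃ τ, M.pair d x τ) ∧ ¬ M.IsUpper x

/-- Critical basis elements of the cellular complex; the empty faces are not matched. -/
def IsCriticalFace : ∀ {i : ℕ}, Face C i → Prop
  | 0, _ => True
  | d + 1, x => M.IsCritical (C := C) (d := d) x

/-- `m` precedes `j` if there is a path from `j` up along a matched edge and down to `m ≠ j`. -/
def Prec {d : ℕ} (m j : cell C d) : Prop :=
  ∃ k : cell C (d + 1), M.pair d j k ∧ IsFacet m k ∧ m ≠ j

theorem prec_wellFounded [RelCWComplex.Finite C] (d : ℕ) :
    WellFounded (M.Prec (d := d)) := by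
  have := finite_sigma_cell C
  let r : (Σ d, cell C d) → (Σ d, cell C d) → Prop :=
    fun a b => Relation.TransGen (MorseStep M.pair) b a
  have : IsTrans _ r := ⟨fun _ _ _ h₁ h₂ => h₂.trans h₁⟩
  have : Std.Irrefl r := ⟨fun a h => M.acyclic a h⟩
  have hr : WellFounded r := Finite.wellFounded_of_trans_of_irrefl r
  refine Subrelation.wf (r := InvImage r fun x : cell C d => (⟨d, x⟩ : Σ d, cell C d)) ?_
    (InvImage.wf _ hr)
  rintro m j ⟨k, hjk, hmk, hne⟩
  exact (Relation.TransGen.single (MorseStep.up j k hjk)).tail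
    (MorseStep.down m k hmk fun h => hne (M.lower_unique h hjk))

end MorseMatching

end Matching

/-! ### The algebraic Morse complex -/

section Algebraic

variable {E : Type u} [TopologicalSpace E] {C : Set E} [CWComplex C] [RelCWComplex.Finite C]
variable {n : ℕ} (R : Type v) [CommRing R]
variable (l : cell C 0 → (Fin n →₀ ℕ)) (sgn : ∀ d : ℕ, cell C d → cell C (d + 1) → ℤ)
variable (M : MorseMatching C)

/-- `M` is also a Morse matching on the directed graph of the cellular complex: along its edges, the
components of the differential (multiplications by elements of the polynomial ring) are
isomorphisms. -/
def IsAlgebraicMatching : Prop :=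
  ∀ (d : ℕ) (σ : cell C d) (τ : cell C (d + 1)), M.pair d σ τ → IsUnit (entry R l sgn σ τ)

open Classical in
/-- The homotopy `φ` on the generator of a cell `j`: it is
`d_{j,k}⁻¹ e_k - ∑_{m ≠ j} φ (d_{m,k} d_{j,k}⁻¹ e_m)` if `j` is matched with `k` of one dimension
more, and `0` otherwise. -/
noncomputable def morsePhiGen (d : ℕ) : cell C d → FreeMod C n R (d + 2) :=
  (M.prec_wellFounded d).fix fun j φ =>
    if h : ∃ k, M.pair d j k then
      Finsupp.single (toFace h.choose) (Ring.inverse (entry R l sgn j h.choose)) -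
        ∑ m : cell C d, if hm : IsFacet m h.choose ∧ m ≠ j then
          (entry R l sgn m h.choose * Ring.inverse (entry R l sgn j h.choose)) •
            φ m ⟨h.choose, h.choose_spec, hm.1, hm.2⟩
        else 0
    else 0

/-- The splitting homotopy `φ` of algebraic Morse theory. -/
noncomputable def morsePhi : ∀ i : ℕ,
    FreeMod C n R i →ₗ[MvPolynomial (Fin n) R] FreeMod C n R (i + 1)
  | 0 => 0
  | d + 1 => Finsupp.linearCombination (MvPolynomial (Fin n) R) (morsePhiGen R l sgn M d)

/-- The chain map `π = id - (d φ + φ d)`. -/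
noncomputable def morsePi : ∀ i : ℕ,
    FreeMod C n R i →ₗ[MvPolynomial (Fin n) R] FreeMod C n R i
  | 0 => LinearMap.id - (diff R l sgn 0).comp (morsePhi R l sgn M 0)
  | i + 1 => LinearMap.id - ((diff R l sgn (i + 1)).comp (morsePhi R l sgn M (i + 1)) +
      (morsePhi R l sgn M i).comp (diff R l sgn i))

/-- The modules of the Morse complex, spanned by the critical faces. -/
abbrev MorseMod (n : ℕ) (i : ℕ) : Type (max u v) :=
  {a : Face C i // M.IsCriticalFace a} →₀ MvPolynomial (Fin n) R

/-- The projection onto the Morse complex along the matched summands. -/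
noncomputable def morseProj (i : ℕ) :
    FreeMod C n R i →ₗ[MvPolynomial (Fin n) R] MorseMod R M n i :=
  Finsupp.lsubtypeDomain {a : Face C i | M.IsCriticalFace a}

/-- The inclusion of the span of the critical faces. -/
noncomputable def morseIncl (i : ℕ) :
    MorseMod R M n i →ₗ[MvPolynomial (Fin n) R] FreeMod C n R i :=
  Finsupp.lmapDomain _ _ Subtype.val

/-- The differential `ρ (d - d φ d)` of the Morse complex. -/
noncomputable def morseDiff (i : ℕ) :
    MorseMod R M n (i + 1) →ₗ[MvPolynomial (Fin n) R] MorseMod R M n i :=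
  (morseProj R M i).comp
    ((diff R l sgn i - (diff R l sgn i).comp ((morsePhi R l sgn M i).comp (diff R l sgn i))).comp
      (morseIncl R M (i + 1)))

/-- The algebraic Morse chain map `ρ π`, from the cellular complex to the Morse complex. -/
noncomputable def morseMap (i : ℕ) :
    FreeMod C n R i →ₗ[MvPolynomial (Fin n) R] MorseMod R M n i :=
  (morseProj R M i).comp (morsePi R l sgn M i)

end Algebraic

/-! ### The deformation retractions of discrete Morse theory -/

section Retractions

variable {E : Type u} [TopologicalSpace E] {C : Set E} [CWComplex C]

/-- `r` is the retraction of an elementary collapse of `A` to `B` (subcomplexes of `C`), which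
removes the matched cells `σ` and `τ`: it is the identity on `B` and maps the closed cell `τ`
into its boundary. That `B` is closed, so that it is a subcomplex, means that `σ` is a free face. -/
structure IsElementaryCollapse (M : MorseMatching C) {A B : Set E} (r : C(A, B)) {d : ℕ}
    (σ : cell C d) (τ : cell C (d + 1)) : Prop where
  matched : M.pair d σ τ
  lower_subset : openCell d σ ⊆ A
  upper_subset : openCell (d + 1) τ ⊆ A
  eq_diff : B = A \ (openCell d σ ∪ openCell (d + 1) τ)
  closed : IsClosed B
  fixes : ∀ p : A, (p : E) ∈ B → (r p : E) = p
  collapses : ∀ p : A, (p : E) ∈ closedCell (d + 1) τ → (r p : E) ∈ cellFrontier (d + 1) τ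

/-- `r : A → B` is a retraction coming from the Morse matching: a composition of retractions of
elementary collapses along edges of the matching, which are done one by one. -/
inductive IsMorseRetraction (M : MorseMatching C) : ∀ {A B : Set E}, C(A, B) → Prop
  | refl (A : Set E) : IsMorseRetraction M (ContinuousMap.id A)
  | step {A A' B : Set E} {d : ℕ} (σ : cell C d) (τ : cell C (d + 1)) (r : C(A, A'))
      (s : C(A', B)) (hr : IsElementaryCollapse M r σ τ) (hs : IsMorseRetraction M s) :
      IsMorseRetraction M (s.comp r)

/-- `r` is a strong deformation retraction of `A` onto its subspace `B`. -/
def IsStrongDeformationRetraction {A B : Set E} (r : C(A, B)) : Prop :=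
  B ⊆ A ∧ ∃ H : C(unitInterval × A, A),
    (∀ p : A, H (0, p) = p) ∧ (∀ p : A, (H (1, p) : E) = r p) ∧
      ∀ (t : unitInterval) (p : A), (p : E) ∈ B → H (t, p) = p

end Retractions

/-! ### Restriction to a subcomplex -/

section Restriction

variable {E : Type u} [TopologicalSpace E] [T2Space E] {C : Set E} [CWComplex C]

instance subcomplexFinite [RelCWComplex.Finite C] (Y : RelCWComplex.Subcomplex C) :
    RelCWComplex.Finite (Y : Set E) :=
  RelCWComplex.Subcomplex.finite_subcomplex_of_finite Y

/-- The inclusion of the cells of a subcomplex. -/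
def cellIncl (Y : RelCWComplex.Subcomplex C) {d : ℕ} (x : cell (Y : Set E) d) : cell C d :=
  Subtype.val (p := fun c => c ∈ Y.I d) x

/-- The restriction of vertex labels to a subcomplex. -/
def restrictLabel {n : ℕ} (Y : RelCWComplex.Subcomplex C) (l : cell C 0 → (Fin n →₀ ℕ)) :
    cell (Y : Set E) 0 → (Fin n →₀ ℕ) :=
  fun v => l (cellIncl Y v)

/-- The restriction of a sign function to a subcomplex. -/
def restrictSign (Y : RelCWComplex.Subcomplex C)
    (sgn : ∀ d : ℕ, cell C d → cell C (d + 1) → ℤ) :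
    ∀ d : ℕ, cell (Y : Set E) d → cell (Y : Set E) (d + 1) → ℤ :=
  fun d σ τ => sgn d (cellIncl Y σ) (cellIncl Y τ)

/-- The face `b` of `C` is the face `a` of the subcomplex `Y`; for empty faces, the component `a`
lies in the component `b`. -/
def SameFace (Y : RelCWComplex.Subcomplex C) :
    ∀ {i : ℕ}, Face (Y : Set E) i → Face C i → Prop
  | 0, a, b => EmptyFace.carrier (C := (Y : Set E)) a ⊆ EmptyFace.carrier (C := C) b
  | d + 1, a, b => cellIncl Y (d := d) a = b

end Restriction

end CellRes

/-!
# Morse maps are morphisms of cellular resolutions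

The theorem has a topological and an algebraic half, and both are governed by one recursion along
the matching.

*Topology of one collapse.* Let `σ` and `τ` be matched, with `σ` a free facet of `τ`. The boundary
of `τ` is a sphere, so it becomes a copy `ℝ ^ d` when a point is removed. Retractions exist because
`ℝ ^ d` is an absolute extensor (Tietze), followed by the radial retraction of the punctured cell
`σ`. Any retraction `r` is homotopic to the identity by a straight line in the ball coordinates of
`τ`. Compatibility needs the sharp statement `IsElementaryCollapse.setImage_lower`: the free face
`σ` is mapped *onto* the rest of the boundary of `τ`. If a point `p` were missed, then `r` would be a
self-map of the boundary of `τ` minus `p`, that is, of `ℝ ^ d`, which is the identity outside a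
compact set and misses a value. This is impossible, as `exists_eq_zero_of_eq_self_of_le_norm` shows
by an analytic argument: the integral of a Jacobian determinant along a linear homotopy is a
polynomial in the parameter.

*Combinatorics of the complex.* In a regular complex the boundary of a cell is the union of its
facets (`IsRegular.cellFrontier_eq`), by invariance of domain, which follows from the same zero
theorem. So subsets can be handled as sets of cells (`IsCellular`). A lower cell that no other lower
cell reaches in the Morse digraph is free, and the diamond condition on the signs shows that its
partner is maximal; so the complex can be collapsed one pair at a time onto the critical subcomplex
(`exists_isMorseRetraction`).

*Algebra.* The map `π = id - (d φ + φ d)` is a chain map that kills the upper generators, and on a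
lower generator its value is determined by those on the other facets of the partner
(`entry_smul_morsePi_single`). It factors through the critical generators, so the Morse chain map is
a chain map with a section (`morseMap_diff`, `morseMap_morseIncl`). As the critical cells form a
subcomplex, the Morse differential is the restricted one, and exactness passes to this retract
(`exact_morseDiff`).

*Comparison.* A Morse retraction sends both cells of a pair `σ`, `τ` onto the image of the rest of
the boundary of `τ` (`IsMorseRetraction.setImage_eq_of_pair`). This is the same recursion as that of
the chain map, so induction along the matching gives the compatibility of generators; for a single
pair no cancellation can occur. Labels can only decrease under a collapse, because matched cells have
the same label, and a minimal label cannot decrease since the image contains a vertex of the same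
component.
-/

/-! ### A continuous compactly supported perturbation of the identity has a zero -/

section Degree

open Topology Set Metric MeasureTheory

variable {V : Type*} [NormedAddCommGroup V] [InnerProductSpace ℝ V]

/-- A Lipschitz map on a closed ball that vanishes on the bounding sphere stays Lipschitz when
extended by zero: the segment from an inner to an outer point crosses the sphere. -/
theorem LipschitzOnWith.indicator_closedBall {g : V → V} {K : NNReal} {r : ℝ}
    (hg : LipschitzOnWith K g (closedBall 0 r)) (h0 : ∀ x ∈ sphere (0 : V) r, g x = 0) :
    LipschitzWith K ((closedBall (0 : V) r).indicator g) := by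
  classical
  have key : ∀ x y : V, x ∈ closedBall (0 : V) r → y ∉ closedBall (0 : V) r →
      dist (g x) 0 ≤ K * dist x y := by
    intro x y hx hy
    have hx' : ‖x‖ ≤ r := by simpa using hx
    have hy' : r < ‖y‖ := by simpa using hy
    have hc : ContinuousOn (fun t : ℝ => ‖AffineMap.lineMap x y t‖) (Icc 0 1) := by
      apply Continuous.continuousOn
      exact (AffineMap.lineMap_continuous).norm
    obtain ⟨t, ht, hz⟩ := intermediate_value_Icc zero_le_one hc
      (show r ∈ Icc _ _ by simpa using ⟨hx', hy'.le⟩)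
    have hz' : AffineMap.lineMap x y t ∈ sphere (0 : V) r := by simpa using hz
    rw [← h0 _ hz']
    refine (hg.dist_le_mul _ hx _ (sphere_subset_closedBall hz')).trans ?_
    gcongr
    rw [dist_left_lineMap, Real.norm_of_nonneg ht.1]
    exact mul_le_of_le_one_left dist_nonneg ht.2
  refine LipschitzWith.of_dist_le_mul fun x y => ?_
  by_cases hx : x ∈ closedBall (0 : V) r <;> by_cases hy : y ∈ closedBall (0 : V) r
  · simpa [indicator_of_mem hx, indicator_of_mem hy] using hg.dist_le_mul _ hx _ hy
  · simpa only [indicator_of_mem hx, indicator_of_notMem hy] using key x y hx hy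
  · rw [indicator_of_notMem hx, indicator_of_mem hy, dist_comm, dist_comm x y]
    exact key y x hy hx
  · simp only [indicator_of_notMem hx, indicator_of_notMem hy, dist_self]
    positivity

variable [FiniteDimensional ℝ V]

/-- For a fixed endomorphism `A`, the function `t ↦ det (1 + t A)` is a polynomial of degree at
most the dimension. -/
theorem LinearMap.exists_polynomial_det_one_add_smul (A : V →ₗ[ℝ] V) :
    ∃ P : Polynomial ℝ, P.natDegree ≤ Module.finrank ℝ V ∧
      ∀ t : ℝ, P.eval t = LinearMap.det (LinearMap.id + t • A) := by
  classical
  let b := Module.finBasis ℝ V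
  let N := LinearMap.toMatrix b b A
  refine ⟨Matrix.det ((Polynomial.X : Polynomial ℝ) • N.map Polynomial.C +
    (1 : Matrix _ _ ℝ).map Polynomial.C), ?_, fun t => ?_⟩
  · simpa using Polynomial.natDegree_det_X_add_C_le N 1
  · rw [← LinearMap.det_toMatrix b, ← Polynomial.coe_evalRingHom,
      RingHom.map_det]
    congr 1
    ext i j
    by_cases hij : i = j
    · subst hij; simp [N]; ring
    · simp [N, hij]; ring

variable [MeasurableSpace V]

open Polynomial in
/-- If, for all small `t ≥ 0`, the map `id + t g` has total Jacobian on a set `s` equal to a fixed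
constant, the same holds for `t = 1`, because the total Jacobian is a polynomial in `t`. -/
theorem integral_det_one_add_eq {μ : Measure V} {s : Set V} {A : V → V →L[ℝ] V} {c ε : ℝ}
    (hε : 0 < ε)
    (hint : ∀ t : ℝ, IntegrableOn (fun x => (ContinuousLinearMap.id ℝ V + t • A x).det) s μ)
    (h : ∀ t ∈ Ioc 0 ε, ∫ x in s, (ContinuousLinearMap.id ℝ V + t • A x).det ∂μ = c) :
    ∫ x in s, (ContinuousLinearMap.id ℝ V + (1 : ℝ) • A x).det ∂μ = c := by
  classical
  let n := Module.finrank ℝ V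
  -- Lagrange interpolation at `n + 1` nodes in `(0, ε]` gives the value at `1`
  let v : ℕ → ℝ := fun i => ε / (i + 1)
  have hv : ∀ i, v i ∈ Ioc 0 ε := fun i => ⟨by positivity, div_le_self hε.le (by simp)⟩
  have hinj : Set.InjOn v (Finset.range (n + 1)) := by
    intro i _ j _ hij
    have h1 : (0 : ℝ) < i + 1 := by positivity
    have h2 : (0 : ℝ) < j + 1 := by positivity
    have := hij
    simp only [v] at this
    rw [div_eq_div_iff h1.ne' h2.ne'] at this
    have := mul_left_cancel₀ hε.ne' this
    exact_mod_cast (by linarith : (i : ℝ) = j)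
  have hL : ∀ x, (ContinuousLinearMap.id ℝ V + (1 : ℝ) • A x).det =
      ∑ i ∈ Finset.range (n + 1), (Lagrange.basis (Finset.range (n + 1)) v i).eval 1 *
        (ContinuousLinearMap.id ℝ V + v i • A x).det := by
    intro x
    obtain ⟨P, hP, hPt⟩ := LinearMap.exists_polynomial_det_one_add_smul (A x : V →ₗ[ℝ] V)
    have hdeg : P.degree < (Finset.range (n + 1)).card := by
      rw [Finset.card_range]
      exact lt_of_le_of_lt degree_le_natDegree (by exact_mod_cast Nat.lt_succ_of_le hP)
    have e := congrArg (Polynomial.eval (1 : ℝ)) (Lagrange.eq_interpolate hinj hdeg)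
    have hd : ∀ t : ℝ, (ContinuousLinearMap.id ℝ V + t • A x).det = P.eval t := fun t => by
      rw [hPt]; rfl
    simp only [hd]
    rw [e, Lagrange.interpolate_apply, eval_finsetSum]
    refine Finset.sum_congr rfl fun i _ => ?_
    rw [eval_mul, eval_C, mul_comm]
  have hsum : ∑ i ∈ Finset.range (n + 1),
      (Lagrange.basis (Finset.range (n + 1)) v i).eval (1 : ℝ) = 1 := by
    rw [← eval_finsetSum, Lagrange.sum_basis hinj ⟨0, by simp⟩, eval_one]
  simp_rw [hL]
  rw [integral_finsetSum _ fun i _ => (hint (v i)).const_mul _]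
  simp_rw [integral_const_mul, h _ (hv _), ← Finset.sum_mul, hsum, one_mul]

variable [BorelSpace V]

/-- A continuous self-map of a finite-dimensional space that is the identity outside a ball has a
zero. If not, a smooth approximation normalised to a sphere of radius `r` is a smooth map `f` into
that sphere fixing it pointwise. The maps `(1 - t) id + t f` are bijections of the ball for small
`t`, so their total Jacobian is the volume of the ball; it is polynomial in `t`, but it vanishes
at `t = 1`. -/
theorem exists_eq_zero_of_eq_self_of_le_norm {F : V → V} (hF : Continuous F) {R : ℝ}
    (h : ∀ x, R ≤ ‖x‖ → F x = x) : ∃ x, F x = 0 := by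
  by_contra! hne
  set r : ℝ := max R 0 + 1 with hr
  have hrpos : 0 < r := by positivity
  have hRr : R < r := lt_of_le_of_lt (le_max_left R 0) (lt_add_one _)
  obtain ⟨k, hk, hkF, hkS, -⟩ := hF.exists_contDiff_approx_and_eqOn 1 hF.norm
    (fun x => norm_pos_iff.2 (hne x)) (S := {x | r ≤ ‖x‖}) (U := {x | R < ‖x‖})
    (isClosed_le continuous_const continuous_norm)
    ((isOpen_lt continuous_const continuous_norm).mem_nhdsSet.2 fun x hx => hRr.trans_le hx)
    (contDiffOn_id.congr fun x hx => h x (le_of_lt hx))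
  have hk0 : ∀ x, k x ≠ 0 := by
    intro x hx
    have := hkF x
    rw [hx, dist_zero_left] at this
    exact lt_irrefl _ this
  let f : V → V := fun x => (r / ‖k x‖) • k x
  have hf : ContDiff ℝ 1 f :=
    (contDiff_const.div (hk.norm ℝ hk0) fun x => norm_ne_zero_iff.2 (hk0 x)).smul hk
  have hfn : ∀ x, ‖f x‖ = r := fun x => by
    simp only [f]
    rw [norm_smul, norm_div, norm_norm, Real.norm_of_nonneg hrpos.le,
      div_mul_cancel₀ _ (norm_ne_zero_iff.2 (hk0 x))]
  have hfid : ∀ x ∈ sphere (0 : V) r, f x = x := by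
    intro x hx
    have hx' : ‖x‖ = r := by simpa using hx
    have hkx : k x = x := by rw [hkS (show r ≤ ‖x‖ from hx'.ge), h x (hx' ▸ hRr.le)]
    simp [f, hkx, hx', div_self hrpos.ne']
  let g : V → V := fun x => f x - x
  have hg : ContDiff ℝ 1 g := hf.sub contDiff_id
  have hg' : ∀ x, HasFDerivAt g (fderiv ℝ g x) x := fun x =>
    (hg.differentiable one_ne_zero x).hasFDerivAt
  have hdg : Continuous (fderiv ℝ g) := hg.continuous_fderiv one_ne_zero
  obtain ⟨K, hK⟩ := (isCompact_closedBall (0 : V) r).exists_bound_of_continuousOn hdg.continuousOn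
  have hK0 : 0 ≤ K := (norm_nonneg _).trans (hK 0 (by simp [hrpos.le]))
  lift K to NNReal using hK0
  have hLip : LipschitzWith K ((closedBall (0 : V) r).indicator g) := by
    refine LipschitzOnWith.indicator_closedBall ?_ fun x hx => by simp [g, hfid x hx]
    exact (convex_closedBall _ _).lipschitzOnWith_of_nnnorm_fderiv_le
      (fun x _ => hg.differentiable one_ne_zero x) fun x hx => hK x hx
  set ε : ℝ := 1 / (2 * (K + 1)) with hε
  have hεpos : 0 < ε := by positivity
  have hε1 : ε ≤ 1 := by
    rw [hε, div_le_one (by positivity)]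
    linarith [show (0 : ℝ) ≤ K from K.2]
  have hεK : ε * K < 1 := by
    rw [hε, div_mul_eq_mul_div, one_mul, div_lt_one (by positivity)]
    linarith [show (0 : ℝ) ≤ K from K.2]
  have hvol : ∀ t ∈ Ioc 0 ε, ∫ x in closedBall (0 : V) r,
      (ContinuousLinearMap.id ℝ V + t • fderiv ℝ g x).det = volume.real (closedBall (0 : V) r) := by
    intro t ht
    let Φ : V → V := fun x => x + t • (closedBall (0 : V) r).indicator g x
    have htK : t * K < 1 := (mul_le_mul_of_nonneg_right ht.2 K.2).trans_lt hεK
    have ht0 : 0 ≤ t := ht.1.le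
    have happ : ApproximatesLinearOn Φ (ContinuousLinearEquiv.refl ℝ V : V →L[ℝ] V) univ
        (⟨t, ht0⟩ * K) := by
      intro x _ y _
      have := hLip.norm_sub_le x y
      have e : Φ x - Φ y - (ContinuousLinearEquiv.refl ℝ V : V →L[ℝ] V) (x - y) =
          t • ((closedBall (0 : V) r).indicator g x - (closedBall (0 : V) r).indicator g y) := by
        simp only [Φ, ContinuousLinearEquiv.coe_refl, ContinuousLinearMap.coe_id', id, smul_sub]
        abel
      rw [e, norm_smul, Real.norm_of_nonneg ht0]
      exact (mul_le_mul_of_nonneg_left this ht0).trans_eq (mul_assoc t K _).symm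
    have hbij : Subsingleton V ∨ (⟨t, ht0⟩ * K : NNReal) <
        ‖((ContinuousLinearEquiv.refl ℝ V).symm : V →L[ℝ] V)‖₊⁻¹ := by
      rcases subsingleton_or_nontrivial V with hV | hV
      · exact Or.inl hV
      · right
        have : ‖((ContinuousLinearEquiv.refl ℝ V).symm : V →L[ℝ] V)‖₊ = 1 := by
          ext; exact ContinuousLinearMap.norm_id
        rw [this, inv_one]
        exact_mod_cast htK
    have hinj : Function.Injective Φ := injOn_univ.1 (happ.injOn hbij)
    have hsurj : Function.Surjective Φ := happ.surjective hbij
    have himg : Φ '' closedBall 0 r = closedBall 0 r := by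
      apply Subset.antisymm
      · rintro _ ⟨x, hx, rfl⟩
        have hx' : ‖x‖ ≤ r := by simpa using hx
        have e : Φ x = (1 - t) • x + t • f x := by
          simp only [Φ, g, indicator_of_mem hx, smul_sub, sub_smul, one_smul]
          abel
        rw [mem_closedBall_zero_iff, e]
        refine (norm_add_le _ _).trans ?_
        have h1t : 0 ≤ 1 - t := by linarith [ht.2]
        rw [norm_smul, norm_smul, hfn, Real.norm_of_nonneg ht.1.le, Real.norm_of_nonneg h1t]
        nlinarith
      · intro y hy
        obtain ⟨x, rfl⟩ := hsurj y
        refine ⟨x, ?_, rfl⟩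
        by_contra hx
        apply hx
        simpa [Φ, indicator_of_notMem hx] using hy
    have hder : ∀ x ∈ closedBall (0 : V) r, HasFDerivWithinAt Φ
        (ContinuousLinearMap.id ℝ V + t • fderiv ℝ g x) (closedBall 0 r) x := by
      intro x hx
      refine (((hasFDerivAt_id x).add ((hg' x).const_smul t)).hasFDerivWithinAt).congr ?_ ?_
      · intro y hy
        simp [Φ, indicator_of_mem hy]
      · simp [Φ, indicator_of_mem hx]
    have hpos : ∀ x ∈ closedBall (0 : V) r,
        0 < (ContinuousLinearMap.id ℝ V + t • fderiv ℝ g x).det := by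
      intro x hx
      by_contra! hneg
      have hc : ContinuousOn
          (fun s : ℝ => (ContinuousLinearMap.id ℝ V + s • fderiv ℝ g x).det) (Icc 0 t) :=
        (ContinuousLinearMap.continuous_det.comp (by fun_prop)).continuousOn
      obtain ⟨s, hs, hs0⟩ := intermediate_value_Icc' ht.1.le hc
        (show (0 : ℝ) ∈ Icc _ _ from ⟨hneg, by simp [ContinuousLinearMap.det]⟩)
      obtain ⟨v, hv, hv0⟩ := (Submodule.ne_bot_iff _).1
        (LinearMap.bot_lt_ker_of_det_eq_zero
          (f := ((ContinuousLinearMap.id ℝ V + s • fderiv ℝ g x : V →L[ℝ] V) : V →ₗ[ℝ] V)) hs0).ne'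
      have hv' : v = - (s • fderiv ℝ g x v) := by
        rw [LinearMap.mem_ker] at hv
        exact eq_neg_of_add_eq_zero_left hv
      have h1 : ‖v‖ ≤ s * (K * ‖v‖) := by
        conv_lhs => rw [hv']
        rw [norm_neg, norm_smul, Real.norm_of_nonneg hs.1]
        exact mul_le_mul_of_nonneg_left
          (((fderiv ℝ g x).le_opNorm v).trans (mul_le_mul_of_nonneg_right (hK x hx)
            (norm_nonneg _))) hs.1
      have h2 : s * K < 1 := (mul_le_mul_of_nonneg_right hs.2 K.2).trans_lt htK
      have h3 : 0 < ‖v‖ := norm_pos_iff.2 hv0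
      nlinarith
    have := integral_image_eq_integral_abs_det_fderiv_smul volume
      (isClosed_closedBall.measurableSet) hder hinj.injOn (fun _ => (1 : ℝ))
    rw [himg] at this
    rw [setIntegral_congr_fun isClosed_closedBall.measurableSet
      (g := fun x => |(ContinuousLinearMap.id ℝ V + t • fderiv ℝ g x).det| • (1 : ℝ))
      fun x hx => by simp [abs_of_pos (hpos x hx)], ← this]
    simp
  have hint : ∀ t : ℝ, IntegrableOn
      (fun x => (ContinuousLinearMap.id ℝ V + t • fderiv ℝ g x).det) (closedBall (0 : V) r) := by
    intro t
    refine ContinuousOn.integrableOn_compact (isCompact_closedBall _ _) (Continuous.continuousOn ?_)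
    exact ContinuousLinearMap.continuous_det.comp (continuous_const.add (hdg.const_smul t))
  have hone := integral_det_one_add_eq hεpos hint hvol
  have hdet : ∀ x, (ContinuousLinearMap.id ℝ V + (1 : ℝ) • fderiv ℝ g x).det = 0 := by
    intro x
    have hdf : HasFDerivAt f (ContinuousLinearMap.id ℝ V + (1 : ℝ) • fderiv ℝ g x) x := by
      have := (hasFDerivAt_id x).add (hg' x)
      rw [one_smul]
      refine this.congr_of_eventuallyEq (Filter.Eventually.of_forall fun y => ?_)
      simp [g]
    by_contra hd
    obtain ⟨v, hv⟩ := (LinearMap.equivOfDetNeZero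
      ((ContinuousLinearMap.id ℝ V + (1 : ℝ) • fderiv ℝ g x : V →L[ℝ] V) : V →ₗ[ℝ] V)
        hd).surjective (f x)
    have h1 := hdf.norm_sq
    have h2 : HasFDerivAt (fun y => ‖f y‖ ^ 2) (0 : V →L[ℝ] ℝ) x := by
      simp only [hfn]; exact hasFDerivAt_const _ _
    have h3 := congrArg (fun L : V →L[ℝ] ℝ => L v) (h1.unique h2)
    have hv2 : (ContinuousLinearMap.id ℝ V + (1 : ℝ) • fderiv ℝ g x) v = f x := hv
    have h4 : (2 : ℝ) * inner ℝ (f x) (f x) = 0 := by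
      nth_rewrite 2 [← hv2]
      simpa [inner_add_right, mul_add] using h3
    rw [real_inner_self_eq_norm_sq, hfn] at h4
    nlinarith
  simp_rw [hdet] at hone
  rw [integral_zero] at hone
  have : 0 < volume.real (closedBall (0 : V) r) :=
    ENNReal.toReal_pos (measure_closedBall_pos _ _ hrpos).ne' measure_closedBall_lt_top.ne
  linarith

end Degree

/-! ### Invariance of domain -/

section InvarianceOfDomain

open Topology Set Metric MeasureTheory

variable {V : Type*} [NormedAddCommGroup V] [InnerProductSpace ℝ V] [FiniteDimensional ℝ V]

/-- A map on the ball of radius `2` that moves no point by `1` or more has a zero. -/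
theorem exists_eq_zero_of_norm_sub_lt_one {h : V → V} (hc : ContinuousOn h (closedBall 0 2))
    (hd : ∀ x ∈ closedBall (0 : V) 2, ‖h x - x‖ < 1) : ∃ x ∈ closedBall (0 : V) 2, h x = 0 := by
  borelize V
  -- `p` is the radial projection to the ball of radius `2`, and `a` cuts off outside this ball
  let p : V → V := fun x => (2 / max 2 ‖x‖) • x
  have hp : Continuous p := by
    refine (continuous_const.div (by fun_prop) fun x => ?_).smul continuous_id
    exact ne_of_gt (lt_of_lt_of_le two_pos (le_max_left _ _))
  have hp2 : ∀ x, p x ∈ closedBall (0 : V) 2 := by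
    intro x
    have h0 : (0 : ℝ) < max 2 ‖x‖ := lt_of_lt_of_le two_pos (le_max_left _ _)
    rw [mem_closedBall_zero_iff, norm_smul, norm_div, Real.norm_of_nonneg h0.le,
      Real.norm_of_nonneg zero_le_two, div_mul_eq_mul_div, div_le_iff₀ h0]
    exact mul_le_mul_of_nonneg_left (le_max_right _ _) zero_le_two
  have hpx : ∀ x, ‖x‖ ≤ 2 → p x = x := fun x hx => by simp [p, max_eq_left hx]
  let a : ℝ → ℝ := fun s => max 0 (min 1 (2 - s))
  have ha : Continuous a := by fun_prop
  have ha1 : ∀ s, a s ≤ 1 := fun s => max_le zero_le_one (min_le_left _ _)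
  have ha0 : ∀ s, 0 ≤ a s := fun s => le_max_left _ _
  have hcont : Continuous fun x => x + a ‖x‖ • (h (p x) - p x) :=
    continuous_id.add ((ha.comp continuous_norm).smul ((hc.comp_continuous hp hp2).sub hp))
  obtain ⟨x, hx⟩ := exists_eq_zero_of_eq_self_of_le_norm hcont (R := 2) fun x hx => by
    have : a ‖x‖ = 0 := max_eq_left ((min_le_right _ _).trans (by linarith))
    simp [this]
  have hb : ‖a ‖x‖ • (h (p x) - p x)‖ < 1 := by
    rw [norm_smul, Real.norm_of_nonneg (ha0 _)]
    exact (mul_le_of_le_one_left (norm_nonneg _) (ha1 _)).trans_lt (hd _ (hp2 x))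
  have hx1 : ‖x‖ < 1 := by
    rw [eq_neg_of_add_eq_zero_left hx, norm_neg]
    exact hb
  have hxa : a ‖x‖ = 1 := by
    simp only [a]
    rw [min_eq_left (by linarith), max_eq_right zero_le_one]
  refine ⟨x, by simpa using (by linarith : ‖x‖ ≤ 2), ?_⟩
  rw [hxa, hpx x (by linarith), one_smul, add_sub_cancel] at hx
  exact hx

/-- The image of the centre of a ball under a continuous injection is an interior point of the
image. Otherwise the inverse `G`, extended to the whole space, can be changed a little, on the
image of the ball, to a map without zeros: push the image off a nearby missed point `c` to radius
at least `δ` and approximate `G` by a smooth map, which misses arbitrarily small values on the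
sphere of radius `δ`. This contradicts the stability of the zero of `G`. -/
theorem mem_interior_image_closedBall {f : V → V} (hf : ContinuousOn f (closedBall 0 2))
    (hinj : InjOn f (closedBall 0 2)) : f 0 ∈ interior (f '' closedBall 0 2) := by
  by_contra hint
  borelize V
  have : CompactSpace (closedBall (0 : V) 2) := isCompact_iff_compactSpace.1 (isCompact_closedBall _ _)
  have : TietzeExtension V := TietzeExtension.of_tvs ℝ
  have hemb : IsClosedEmbedding ((closedBall (0 : V) 2).domRestrict f) :=
    (continuousOn_iff_continuous_domRestrict.1 hf).isClosedEmbedding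
      (injOn_iff_injective.1 hinj)
  obtain ⟨G, hG⟩ := ContinuousMap.exists_extension hemb ⟨Subtype.val, continuous_subtype_val⟩
  have hGf : ∀ x ∈ closedBall (0 : V) 2, G (f x) = x := fun x hx =>
    DFunLike.congr_fun hG ⟨x, hx⟩
  have h00 : (0 : V) ∈ closedBall (0 : V) 2 := by simp
  obtain ⟨δ', hδ', hGδ'⟩ := Metric.continuousAt_iff.1 (G.continuous.continuousAt (x := f 0))
    (1 / 10) (by norm_num)
  rw [hGf 0 h00] at hGδ'
  obtain ⟨δ, hδ, rfl⟩ : ∃ δ : ℝ, 0 < δ ∧ 2 * δ = δ' := ⟨δ' / 2, by linarith, by ring⟩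
  have hGδ : ∀ y, dist y (f 0) < 2 * δ → ‖G y‖ < 1 / 10 := fun y hy => by
    simpa using hGδ' hy
  obtain ⟨c, hc, hcK⟩ : ∃ c ∈ ball (f 0) δ, c ∉ f '' closedBall 0 2 := by
    by_contra! hsub
    exact hint (mem_interior.2 ⟨_, hsub, isOpen_ball, mem_ball_self hδ⟩)
  have hKc : IsCompact (f '' closedBall (0 : V) 2) := (isCompact_closedBall _ _).image_of_continuousOn hf
  have hne : ∀ y ∈ f '' closedBall (0 : V) 2, y - c ≠ 0 := fun y hy h0 =>
    hcK (sub_eq_zero.1 h0 ▸ hy)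
  obtain ⟨ε, hε, hGε⟩ : ∃ ε : ℝ, 0 < ε ∧
      ∀ y ∈ f '' closedBall (0 : V) 2 ∩ {y | δ ≤ ‖y - c‖}, ε ≤ ‖G y‖ := by
    refine (hKc.inter_right (isClosed_le continuous_const (by fun_prop))).exists_forall_le'
      (G.continuous.norm.continuousOn) ?_
    rintro _ ⟨⟨x, hx, rfl⟩, hxc⟩
    rw [hGf x hx, norm_pos_iff]
    rintro rfl
    rw [mem_ball, dist_comm, dist_eq_norm] at hc
    exact absurd (show δ ≤ ‖f 0 - c‖ from hxc) (not_le.2 hc)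
  obtain ⟨η, hη, hηε, hη1⟩ : ∃ η : ℝ, 0 < η ∧ 2 * η ≤ ε ∧ η ≤ 1 / 10 :=
    ⟨min (ε / 2) (1 / 10), by positivity, by linarith [min_le_left (ε / 2) (1 / 10 : ℝ)],
      min_le_right _ _⟩
  obtain ⟨P, hP, hPG, -⟩ := G.continuous.exists_contDiff_approx 1 (ε := fun _ => η)
    continuous_const fun _ => hη
  have hnull : volume (P '' sphere c δ) = 0 :=
    addHaar_image_eq_zero_of_differentiableOn_of_addHaar_eq_zero _
      (hP.differentiable one_ne_zero).differentiableOn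
      (Measure.addHaar_sphere_of_ne_zero _ _ hδ.ne')
  obtain ⟨w, hw, hwP⟩ : ∃ w ∈ ball (0 : V) η, w ∉ P '' sphere c δ := by
    by_contra! hsub
    exact (measure_ball_pos volume (0 : V) hη).ne' (measure_mono_null hsub hnull)
  have hw' : ‖w‖ < η := by simpa using hw
  have hPw : ∀ y, ‖P y - w - G y‖ < 2 * η := fun y => by
    have h1 := hPG y
    rw [dist_eq_norm] at h1
    calc ‖P y - w - G y‖ = ‖(P y - G y) - w‖ := by congr 1; abel
      _ ≤ ‖P y - G y‖ + ‖w‖ := norm_sub_le _ _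
      _ < 2 * η := by linarith
  let Φ : V → V := fun y => c + max 1 (δ / ‖y - c‖) • (y - c)
  have hΦ : ContinuousOn Φ (f '' closedBall (0 : V) 2) := by
    refine continuousOn_const.add (ContinuousOn.smul ?_ (by fun_prop))
    exact continuousOn_const.sup (continuousOn_const.div (by fun_prop)
      fun y hy => norm_ne_zero_iff.2 (hne y hy))
  have hΦ1 : ∀ y, y - c ≠ 0 → δ ≤ ‖y - c‖ → Φ y = y := by
    intro y hy hyδ
    have : max 1 (δ / ‖y - c‖) = 1 := max_eq_left ((div_le_one (norm_pos_iff.2 hy)).2 hyδ)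
    simp [Φ, this]
  have hΦ2 : ∀ y, y - c ≠ 0 → ‖y - c‖ < δ → Φ y ∈ sphere c δ := by
    intro y hy hyδ
    have h0 : 0 < ‖y - c‖ := norm_pos_iff.2 hy
    have : max 1 (δ / ‖y - c‖) = δ / ‖y - c‖ := max_eq_right ((one_le_div h0).2 hyδ.le)
    simp only [Φ, this, mem_sphere, dist_eq_norm, add_sub_cancel_left]
    rw [norm_smul, norm_div, norm_norm, Real.norm_of_nonneg hδ.le, div_mul_cancel₀ _ h0.ne']
  obtain ⟨x, hx, hx0⟩ := exists_eq_zero_of_norm_sub_lt_one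
    (h := fun x => P (Φ (f x)) - w)
    (((hP.continuous.comp_continuousOn hΦ).comp hf (mapsTo_image _ _)).sub continuousOn_const) <| by
      intro x hx
      have hy := hne (f x) (mem_image_of_mem _ hx)
      have h1 := hPw (Φ (f x))
      rcases le_or_gt δ ‖f x - c‖ with hxδ | hxδ
      · rw [hΦ1 _ hy hxδ] at h1 ⊢
        rw [hGf x hx] at h1
        linarith
      · have h2 := hΦ2 _ hy hxδ
        rw [mem_ball] at hc
        rw [mem_sphere] at h2
        have h3 := hGδ (Φ (f x)) ((dist_triangle _ c _).trans_lt (by linarith))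
        have h4 := hGδ (f x) ((dist_triangle _ c _).trans_lt (by
          rw [dist_eq_norm]; linarith))
        rw [hGf x hx] at h4
        have h5 : P (Φ (f x)) - w - x = (P (Φ (f x)) - w - G (Φ (f x))) + G (Φ (f x)) - x := by
          abel
        rw [h5]
        have h6 := norm_sub_le ((P (Φ (f x)) - w - G (Φ (f x))) + G (Φ (f x))) x
        have h7 := norm_add_le (P (Φ (f x)) - w - G (Φ (f x))) (G (Φ (f x)))
        linarith
  have hy := hne (f x) (mem_image_of_mem _ hx)
  rcases le_or_gt δ ‖f x - c‖ with hxδ | hxδ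
  · have h1 := hPw (f x)
    have h2 := hGε (f x) ⟨mem_image_of_mem _ hx, hxδ⟩
    simp only [hΦ1 _ hy hxδ] at hx0
    rw [hx0, zero_sub, norm_neg] at h1
    linarith
  · exact hwP ⟨_, hΦ2 _ hy hxδ, sub_eq_zero.1 hx0⟩

/-- **Invariance of domain** for self-maps. -/
theorem IsOpen.image_of_injOn {U : Set V} (hU : IsOpen U) {f : V → V} (hf : ContinuousOn f U)
    (hinj : InjOn f U) : IsOpen (f '' U) := by
  rw [isOpen_iff_mem_nhds]
  rintro _ ⟨x, hx, rfl⟩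
  obtain ⟨ε, hε, hεU⟩ := Metric.nhds_basis_closedBall.mem_iff.1 (hU.mem_nhds hx)
  let s : V → V := fun z => x + (ε / 2) • z
  have hs : MapsTo s (closedBall 0 2) U := by
    intro z hz
    apply hεU
    have hz' : ‖z‖ ≤ 2 := by simpa using hz
    simp only [s, mem_closedBall, dist_eq_norm, add_sub_cancel_left]
    rw [norm_smul, Real.norm_of_nonneg (by positivity)]
    nlinarith
  have hsi : Function.Injective s := fun z w hzw =>
    smul_right_injective V (half_pos hε).ne' (add_left_cancel hzw)
  have := mem_interior_image_closedBall (f := f ∘ s)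
    (hf.comp (by fun_prop) hs) (hinj.comp hsi.injOn hs)
  rw [mem_interior_iff_mem_nhds] at this
  have h0 : (f ∘ s) 0 = f x := by simp [s]
  rw [h0] at this
  refine Filter.mem_of_superset this ?_
  rintro _ ⟨z, hz, rfl⟩
  exact ⟨_, hs hz, rfl⟩

variable {W : Type*} [NormedAddCommGroup W] [NormedSpace ℝ W] [FiniteDimensional ℝ W]

/-- **Invariance of domain** for maps between spaces of the same dimension. -/
theorem IsOpen.image_of_injOn_of_finrank_eq (h : Module.finrank ℝ V = Module.finrank ℝ W)
    {U : Set V} (hU : IsOpen U) {f : V → W} (hf : ContinuousOn f U)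
    (hinj : InjOn f U) : IsOpen (f '' U) := by
  let e : V ≃L[ℝ] W := ContinuousLinearEquiv.ofFinrankEq h
  have := hU.image_of_injOn (f := e.symm ∘ f) (e.symm.continuous.comp_continuousOn hf)
    (e.symm.injective.comp_injOn hinj)
  rw [image_comp] at this
  simpa [image_image] using e.toHomeomorph.isOpenMap _ this

/-- **Invariance of dimension**: a nonempty open set does not embed in a space of lower
dimension. -/
theorem IsOpen.finrank_le_of_injOn {U : Set V} (hU : IsOpen U) (hne : U.Nonempty) {f : V → W}
    (hf : ContinuousOn f U) (hinj : InjOn f U) : Module.finrank ℝ V ≤ Module.finrank ℝ W := by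
  by_contra! hlt
  obtain ⟨L, hL⟩ := Module.Free.exists_linearMap_injective_of_lift_rank_lt (R := ℝ) (M := W) (N' := V)
    (by
      rw [← Module.finrank_eq_rank ℝ W, ← Module.finrank_eq_rank ℝ V,
        Cardinal.lift_natCast, Cardinal.lift_natCast]
      exact_mod_cast hlt)
  have hopen := hU.image_of_injOn (f := L ∘ f)
    (L.continuous_of_finiteDimensional.comp_continuousOn hf) (hL.comp_injOn hinj)
  have htop : LinearMap.range L = ⊤ := by
    apply Submodule.eq_top_of_nonempty_interior'
    refine (hne.image _).mono ((interior_maximal ?_ hopen))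
    rintro _ ⟨x, _, rfl⟩
    exact ⟨f x, rfl⟩
  have := LinearMap.finrank_range_of_inj hL
  rw [htop, finrank_top] at this
  omega

end InvarianceOfDomain

/-! ### Spheres, balls and the closed cells of regular complexes -/

section Spheres

open Topology Set Metric

/-- A continuous injection on a compact set, as a homeomorphism onto its image. -/
noncomputable def homeomorphImageOfInjOn {X Y : Type*} [TopologicalSpace X] [TopologicalSpace Y]
    [T2Space Y] {f : X → Y} {s : Set X} (hs : IsCompact s) (hf : ContinuousOn f s)
    (hinj : InjOn f s) : s ≃ₜ f '' s :=
  haveI : CompactSpace s := isCompact_iff_compactSpace.1 hs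
  Continuous.homeoOfEquivCompactToT2 (f := Equiv.Set.imageOfInjOn f s hinj)
    (Continuous.subtype_mk (continuousOn_iff_continuous_domRestrict.1 hf) _)

variable {V W : Type*} [NormedAddCommGroup V] [NormedSpace ℝ V] [NormedAddCommGroup W]
  [NormedSpace ℝ W]

theorem norm_inv_norm_smul {y : W} (h : y ≠ 0) : ‖‖y‖⁻¹ • y‖ = 1 := by
  rw [norm_smul, norm_inv, norm_norm, inv_mul_cancel₀ (norm_ne_zero_iff.2 h)]

theorem ContinuousLinearEquiv.map_sphere_ne_zero (L : V ≃L[ℝ] W) (x : sphere (0 : V) 1) :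
    L x ≠ 0 := by
  rw [Ne, L.map_eq_zero_iff]
  exact ne_zero_of_mem_unit_sphere x

theorem ContinuousLinearEquiv.normalize_normalize (L : V ≃L[ℝ] W) (x : sphere (0 : V) 1) :
    ‖L.symm (‖L x‖⁻¹ • L x)‖⁻¹ • L.symm (‖L x‖⁻¹ • L x) = (x : V) := by
  have h0 : ‖L x‖ ≠ 0 := norm_ne_zero_iff.2 (L.map_sphere_ne_zero x)
  have hx : ‖(x : V)‖ = 1 := by simp
  rw [map_smul, L.symm_apply_apply, norm_smul, hx, norm_inv, norm_norm, mul_one, inv_inv, smul_smul,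
    mul_inv_cancel₀ h0, one_smul]

/-- The unit spheres of linearly homeomorphic normed spaces are homeomorphic. -/
noncomputable def ContinuousLinearEquiv.unitSphereHomeomorph (L : V ≃L[ℝ] W) :
    sphere (0 : V) 1 ≃ₜ sphere (0 : W) 1 where
  toFun x := ⟨‖L x‖⁻¹ • L x, by
    rw [mem_sphere_zero_iff_norm, norm_inv_norm_smul (L.map_sphere_ne_zero x)]⟩
  invFun y := ⟨‖L.symm y‖⁻¹ • L.symm y, by
    rw [mem_sphere_zero_iff_norm, norm_inv_norm_smul (L.symm.map_sphere_ne_zero y)]⟩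
  left_inv x := Subtype.ext (L.normalize_normalize x)
  right_inv y := Subtype.ext (L.symm.normalize_normalize y)
  continuous_toFun := by
    have h : Continuous fun x : sphere (0 : V) 1 => L x := by fun_prop
    exact ((h.norm.inv₀ fun x => norm_ne_zero_iff.2 (L.map_sphere_ne_zero x)).smul h).subtype_mk _
  continuous_invFun := by
    have h : Continuous fun y : sphere (0 : W) 1 => L.symm y := by fun_prop
    exact ((h.norm.inv₀ fun y =>
      norm_ne_zero_iff.2 (L.symm.map_sphere_ne_zero y)).smul h).subtype_mk _

/-- A space homeomorphic to the unit sphere of `Fin (d + 1) → ℝ` becomes homeomorphic to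
`d`-dimensional Euclidean space when a point is removed. -/
theorem nonempty_homeomorph_diff_singleton {X : Type*} [TopologicalSpace X] {S : Set X} {d : ℕ}
    (e : sphere (0 : Fin (d + 1) → ℝ) 1 ≃ₜ S) {p : X} (hp : p ∈ S) :
    Nonempty ((S \ {p} : Set X) ≃ₜ EuclideanSpace ℝ (Fin d)) := by
  let e' : S ≃ₜ sphere (0 : EuclideanSpace ℝ (Fin (d + 1))) 1 :=
    e.symm.trans (EuclideanSpace.equiv (Fin (d + 1)) ℝ).symm.unitSphereHomeomorph
  have : Fact (Module.finrank ℝ (EuclideanSpace ℝ (Fin (d + 1))) = d + 1) := ⟨by simp⟩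
  let st := stereographic' d (e' ⟨p, hp⟩)
  let e₁ : (S \ {p} : Set X) ≃ₜ {x : S // x ≠ ⟨p, hp⟩} :=
    { toFun := fun x => ⟨⟨x, x.2.1⟩, fun h => x.2.2 (congrArg Subtype.val h)⟩
      invFun := fun x => ⟨x.1.1, x.1.2, fun h => x.2 (Subtype.ext h)⟩
      left_inv := fun _ => rfl
      right_inv := fun _ => rfl
      continuous_toFun := by fun_prop
      continuous_invFun := by fun_prop }
  let e₂ : {x : S // x ≠ ⟨p, hp⟩} ≃ₜ st.source :=
    e'.subtype fun x => by
      simp only [st, stereographic'_source, mem_compl_iff, mem_singleton_iff]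
      exact (e'.injective.ne_iff).symm
  refine ⟨(e₁.trans e₂).trans (st.toHomeomorphSourceTarget.trans
    ((Homeomorph.setCongr (stereographic'_target _)).trans (Homeomorph.Set.univ _)))⟩

end Spheres

namespace CellRes
open Topology Set Metric
open RelCWComplex (cell map openCell closedCell cellFrontier skeleton skeletonLT)

section Boundary

universe u
variable {E : Type u} [TopologicalSpace E] {C : Set E} [CWComplex C]

theorem exists_mem_openCell {p : E} (hp : p ∈ C) : ∃ (d : ℕ) (x : cell C d), p ∈ openCell d x := by
  rw [← CWComplex.iUnion_openCell_eq_complex (C := C)] at hp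
  simpa using hp

theorem sigma_eq_of_mem_openCell {d k : ℕ} {x : cell C d} {y : cell C k} {p : E}
    (hx : p ∈ openCell d x) (hy : p ∈ openCell k y) : (⟨d, x⟩ : Σ d, cell C d) = ⟨k, y⟩ :=
  RelCWComplex.eq_of_not_disjoint_openCell (not_disjoint_iff.2 ⟨p, hx, hy⟩)

variable [T2Space E]

/-- The characteristic map of a cell of a regular complex, as a homeomorphism onto the closed
cell. -/
noncomputable def IsRegular.closedCellHomeomorph (h : IsRegular C) {d : ℕ} (x : cell C d) :
    closedBall (0 : Fin d → ℝ) 1 ≃ₜ closedCell d x :=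
  homeomorphImageOfInjOn (isCompact_closedBall _ _) (RelCWComplex.continuousOn d x) (h d x)

/-- The attaching map of a cell of a regular complex, as a homeomorphism onto the boundary of the
cell. -/
noncomputable def IsRegular.cellFrontierHomeomorph (h : IsRegular C) {d : ℕ} (x : cell C d) :
    sphere (0 : Fin d → ℝ) 1 ≃ₜ cellFrontier d x :=
  homeomorphImageOfInjOn (isCompact_sphere _ _)
    ((RelCWComplex.continuousOn d x).mono sphere_subset_closedBall)
    ((h d x).mono sphere_subset_closedBall)

theorem IsRegular.exists_homeomorph_cellFrontier_diff (h : IsRegular C) {d : ℕ}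
    (τ : cell C (d + 1)) {p : E} (hp : p ∈ cellFrontier (d + 1) τ) :
    Nonempty ((cellFrontier (d + 1) τ \ {p} : Set E) ≃ₜ EuclideanSpace ℝ (Fin d)) :=
  nonempty_homeomorph_diff_singleton (h.cellFrontierHomeomorph τ) hp

/-- Every point of the boundary of a `(d + 1)`-cell lies in a copy of `ℝ ^ d` in that boundary. -/
theorem IsRegular.exists_chart (h : IsRegular C) {d : ℕ} (τ : cell C (d + 1)) {p : E}
    (hp : p ∈ cellFrontier (d + 1) τ) :
    ∃ ψ : EuclideanSpace ℝ (Fin d) → E, Continuous ψ ∧ Function.Injective ψ ∧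
      (∀ v, ψ v ∈ cellFrontier (d + 1) τ) ∧ p ∈ range ψ := by
  obtain ⟨z, hz, rfl⟩ := hp
  have hz' : -z ∈ sphere (0 : Fin (d + 1) → ℝ) 1 := by simpa using hz
  have hne : map (d + 1) τ z ≠ map (d + 1) τ (-z) := by
    intro heq
    have := h _ τ (sphere_subset_closedBall hz) (sphere_subset_closedBall hz') heq
    have h0 : z = 0 := by
      rw [eq_neg_iff_add_eq_zero, ← two_smul ℝ z, smul_eq_zero] at this
      exact this.resolve_left two_ne_zero
    simp [h0] at hz
  obtain ⟨e⟩ := h.exists_homeomorph_cellFrontier_diff τ (mem_image_of_mem _ hz')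
  refine ⟨fun v => e.symm v, by fun_prop, Subtype.val_injective.comp e.symm.injective,
    fun v => (e.symm v).2.1, e ⟨_, mem_image_of_mem _ hz, hne⟩, by simp⟩

/-! ### The boundary of a cell of a regular complex is a union of closed cells -/

theorem openCell_subset_closed {d : ℕ} {x : cell C d} {K : Set E} (hK : IsClosed K)
    (h : openCell d x ⊆ K) : closedCell d x ⊆ K := by
  rw [← RelCWComplex.closure_openCell_eq_closedCell]
  exact hK.closure_subset_iff.2 h

theorem disjoint_openCell_cellFrontier {d k : ℕ} (x : cell C d) (y : cell C k) (h : k ≤ d) :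
    Disjoint (openCell d x) (cellFrontier k y) :=
  ((RelCWComplex.disjoint_skeletonLT_openCell (by exact_mod_cast h)).mono_left
    (RelCWComplex.cellFrontier_subset_skeletonLT k y)).symm

theorem disjoint_openCell_closedCell {d : ℕ} {x y : cell C d} (h : x ≠ y) :
    Disjoint (openCell d x) (closedCell d y) := by
  rw [← RelCWComplex.cellFrontier_union_openCell_eq_closedCell, disjoint_union_right]
  exact ⟨disjoint_openCell_cellFrontier x y le_rfl,
    RelCWComplex.disjoint_openCell_of_ne fun h' => h (by simpa using h')⟩

theorem disjoint_openCell_closedCell_of_lt {d k : ℕ} (x : cell C d) (y : cell C k) (h : k < d) :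
    Disjoint (openCell d x) (closedCell k y) := by
  rw [← RelCWComplex.cellFrontier_union_openCell_eq_closedCell, disjoint_union_right]
  exact ⟨disjoint_openCell_cellFrontier x y h.le,
    RelCWComplex.disjoint_openCell_of_ne fun h' => by
      have := congrArg Sigma.fst h'
      simp only at this
      omega⟩

theorem IsFacet.subset_cellFrontier {d : ℕ} {σ : cell C d} {τ : cell C (d + 1)}
    (h : IsFacet σ τ) : closedCell d σ ⊆ cellFrontier (d + 1) τ := by
  intro p hp
  have := h hp
  rw [← RelCWComplex.cellFrontier_union_openCell_eq_closedCell] at this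
  exact this.resolve_right fun h' =>
    (disjoint_openCell_closedCell_of_lt τ σ (Nat.lt_succ_self d)).notMem_of_mem_left h' hp

variable [RelCWComplex.Finite C]

/-- An open `k`-cell is relatively open in the `k`-skeleton. -/
theorem exists_isClosed_skeleton_subset {k : ℕ} (e : cell C k) :
    ∃ Z : Set E, IsClosed Z ∧ Disjoint Z (openCell k e) ∧
      (skeleton C k : Set E) ⊆ Z ∪ openCell k e := by
  have := finite_sigma_cell C
  refine ⟨(skeletonLT C k : Set E) ∪ ⋃ j ∈ {j : cell C k | j ≠ e}, closedCell k j, ?_, ?_, ?_⟩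
  · exact (RelCWComplex.Subcomplex.closed _).union
      ((toFinite _).isClosed_biUnion fun _ _ => RelCWComplex.isClosed_closedCell)
  · rw [disjoint_union_left]
    refine ⟨RelCWComplex.disjoint_skeletonLT_openCell le_rfl, ?_⟩
    simp only [disjoint_iUnion_left]
    exact fun j hj => (disjoint_openCell_closedCell (Ne.symm hj)).symm
  · have := RelCWComplex.skeletonLT_union_iUnion_closedCell_eq_skeletonLT_succ (C := C) k
    rw [skeleton, ← this]
    refine union_subset (subset_union_left.trans subset_union_left) (iUnion_subset fun j => ?_)
    by_cases hj : j = e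
    · subst hj
      rw [← RelCWComplex.cellFrontier_union_openCell_eq_closedCell]
      exact union_subset_union_left _
        ((RelCWComplex.cellFrontier_subset_skeletonLT k j).trans subset_union_left)
    · exact (subset_biUnion_of_mem (u := fun j => closedCell k j)
        (show j ∈ {j : cell C k | j ≠ e} from hj)).trans
          (subset_union_right.trans subset_union_left)

/-- Near a point where the boundary of a `(d + 1)`-cell lies in the `k`-skeleton and meets the open
`k`-cell `e`, this boundary is a `d`-manifold in `e`; hence `d ≤ k`, and for `d = k` it is a
neighbourhood in `e`. -/
theorem IsRegular.le_and_mem_interior (h : IsRegular C) {d k : ℕ} (τ : cell C (d + 1))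
    (e : cell C k) {O : Set E} (hO : IsOpen O)
    (hS : cellFrontier (d + 1) τ ∩ O ⊆ (skeleton C k : Set E)) {p : E}
    (hp : p ∈ cellFrontier (d + 1) τ) (hpO : p ∈ O) (hpe : p ∈ openCell k e) :
    d ≤ k ∧ (d = k → (map k e).symm p ∈
      interior ((map k e).symm '' (cellFrontier (d + 1) τ ∩ openCell k e))) := by
  obtain ⟨ψ, hψ, hψi, hψS, v, rfl⟩ := h.exists_chart τ hp
  obtain ⟨Z, hZ, hZe, hZk⟩ := exists_isClosed_skeleton_subset e
  have htarget : (map k e).target = openCell k e := by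
    rw [← (map k e).image_source_eq_target, RelCWComplex.source_eq]
    rfl
  have hU : IsOpen (ψ ⁻¹' (O ∩ Zᶜ)) := (hO.inter hZ.isOpen_compl).preimage hψ
  have hUe : MapsTo ψ (ψ ⁻¹' (O ∩ Zᶜ)) (openCell k e) := fun w hw =>
    (hZk (hS ⟨hψS w, hw.1⟩)).resolve_left hw.2
  have hv : v ∈ ψ ⁻¹' (O ∩ Zᶜ) := ⟨hpO, fun hz => hZe.notMem_of_mem_left hz hpe⟩
  have hc : ContinuousOn ((map k e).symm ∘ ψ) (ψ ⁻¹' (O ∩ Zᶜ)) :=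
    (RelCWComplex.continuousOn_symm k e).comp hψ.continuousOn (htarget ▸ hUe)
  have hi : InjOn ((map k e).symm ∘ ψ) (ψ ⁻¹' (O ∩ Zᶜ)) :=
    ((map k e).symm.injOn.comp hψi.injOn (by simpa [htarget] using hUe))
  refine ⟨by simpa using hU.finrank_le_of_injOn ⟨v, hv⟩ hc hi, fun hdk => ?_⟩
  have hopen := hU.image_of_injOn_of_finrank_eq (by simpa using hdk) hc hi
  refine interior_maximal ?_ hopen ⟨v, hv, rfl⟩
  rintro _ ⟨w, hw, rfl⟩
  exact ⟨ψ w, ⟨hψS w, hUe hw⟩, rfl⟩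

/-- A `d`-cell that meets the boundary of a `(d + 1)`-cell lies in it: the intersection is open in
the cell by invariance of domain, it is closed, and the cell is connected. -/
theorem IsRegular.openCell_subset_cellFrontier (h : IsRegular C) {d : ℕ} (τ : cell C (d + 1))
    (e : cell C d) (hne : (cellFrontier (d + 1) τ ∩ openCell d e).Nonempty) :
    openCell d e ⊆ cellFrontier (d + 1) τ := by
  have hsymm : ∀ z ∈ ball (0 : Fin d → ℝ) 1, (map d e).symm (map d e z) = z := fun z hz =>
    (map d e).left_inv (by rwa [RelCWComplex.source_eq])
  have hcont := (RelCWComplex.continuousOn (C := C) d e).mono ball_subset_closedBall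
  have hopen : IsOpen (ball (0 : Fin d → ℝ) 1 ∩ map d e ⁻¹' cellFrontier (d + 1) τ) := by
    rw [isOpen_iff_mem_nhds]
    rintro z ⟨hz, hzS⟩
    have := (h.le_and_mem_interior τ e isOpen_univ (by
      rw [inter_univ]; exact RelCWComplex.cellFrontier_subset_skeleton d τ) hzS (mem_univ _)
      (mem_image_of_mem _ hz)).2 rfl
    rw [hsymm z hz, mem_interior_iff_mem_nhds] at this
    refine Filter.mem_of_superset this ?_
    rintro _ ⟨_, ⟨hS, w, hw, rfl⟩, rfl⟩
    rw [hsymm w hw]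
    exact ⟨hw, hS⟩
  have hopen' : IsOpen (ball (0 : Fin d → ℝ) 1 ∩ map d e ⁻¹' (cellFrontier (d + 1) τ)ᶜ) :=
    hcont.isOpen_inter_preimage isOpen_ball RelCWComplex.isClosed_cellFrontier.isOpen_compl
  have hconn : IsPreconnected (ball (0 : Fin d → ℝ) 1) := (convex_ball _ _).isPreconnected
  have := hconn.subset_left_of_subset_union hopen hopen'
    (disjoint_left.2 fun z hz hz' => hz'.2 hz.2)
    (fun z hz => (em (map d e z ∈ cellFrontier (d + 1) τ)).imp (fun h => ⟨hz, h⟩) fun h => ⟨hz, h⟩)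
    (by
      obtain ⟨_, hS, z, hz, rfl⟩ := hne
      exact ⟨z, hz, hz, hS⟩)
  rintro _ ⟨z, hz, rfl⟩
  exact (this hz).2

/-- The boundary of a cell of a regular complex is the union of its facets. -/
theorem IsRegular.cellFrontier_eq (h : IsRegular C) {d : ℕ} (τ : cell C (d + 1)) :
    cellFrontier (d + 1) τ = ⋃ σ ∈ {σ : cell C d | IsFacet σ τ}, closedCell d σ := by
  have := finite_sigma_cell C
  refine Subset.antisymm ?_ (iUnion₂_subset fun σ hσ => IsFacet.subset_cellFrontier hσ)
  by_contra hsub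
  obtain ⟨p, hp, hpT⟩ := not_subset.1 hsub
  set T := ⋃ σ ∈ {σ : cell C d | IsFacet σ τ}, closedCell d σ with hT
  have hTc : IsClosed T :=
    (toFinite _).isClosed_biUnion fun _ _ => RelCWComplex.isClosed_closedCell
  -- a cell of maximal dimension among those that meet the boundary outside the union `T` of facets
  let A : Set (Σ k, cell C k) := {e | (cellFrontier (d + 1) τ ∩ Tᶜ ∩ openCell e.1 e.2).Nonempty}
  have hA : A.Nonempty := by
    obtain ⟨k, e, he⟩ := exists_mem_openCell (RelCWComplex.cellFrontier_subset_complex _ τ hp)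
    exact ⟨⟨k, e⟩, p, ⟨hp, hpT⟩, he⟩
  obtain ⟨⟨k, e⟩, he, hmax⟩ := (toFinite A).exists_maximalFor (fun e => e.1) A hA
  obtain ⟨q, ⟨hq, hqT⟩, hqe⟩ := he
  have hle := (h.le_and_mem_interior τ e hTc.isOpen_compl (by
    rintro x ⟨hx, hxT⟩
    obtain ⟨j, f, hf⟩ := exists_mem_openCell (RelCWComplex.cellFrontier_subset_complex _ τ hx)
    have hjk : j ≤ k := by
      by_contra! hlt
      exact absurd (hmax (j := ⟨j, f⟩) ⟨x, ⟨hx, hxT⟩, hf⟩ hlt.le) (not_le.2 hlt)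
    exact RelCWComplex.skeleton_mono (by exact_mod_cast hjk)
      (RelCWComplex.openCell_subset_skeleton j f hf)) hq hqT hqe).1
  have hkd : k ≤ d := by
    by_contra! hlt
    exact (disjoint_openCell_cellFrontier e τ hlt).notMem_of_mem_left hqe hq
  obtain rfl := le_antisymm hle hkd
  refine hqT (mem_biUnion (x := e) ?_ (RelCWComplex.openCell_subset_closedCell _ e hqe))
  exact openCell_subset_closed RelCWComplex.isClosed_closedCell
    ((h.openCell_subset_cellFrontier τ e ⟨q, hq, hqe⟩).trans
      (RelCWComplex.cellFrontier_subset_closedCell _ τ))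

end Boundary

/-! ### Cellular sets -/

section Cellular

universe u
variable {E : Type u} [TopologicalSpace E] {C : Set E} [CWComplex C]

variable (C) in
/-- A subset of a CW complex is cellular if it is the underlying set of a subcomplex: it is closed
and contains every open cell that it meets. -/
structure IsCellular (K : Set E) : Prop where
  isClosed : IsClosed K
  subset : K ⊆ C
  openCell_subset : ∀ {d : ℕ} (x : cell C d) {p : E}, p ∈ openCell d x → p ∈ K → openCell d x ⊆ K

theorem IsCellular.inter {K L : Set E} (hK : IsCellular C K) (hL : IsCellular C L) :
    IsCellular C (K ∩ L) where
  isClosed := hK.isClosed.inter hL.isClosed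
  subset := inter_subset_left.trans hK.subset
  openCell_subset x _ hp hpK :=
    subset_inter (hK.openCell_subset x hp hpK.1) (hL.openCell_subset x hp hpK.2)

theorem IsCellular.union {K L : Set E} (hK : IsCellular C K) (hL : IsCellular C L) :
    IsCellular C (K ∪ L) where
  isClosed := hK.isClosed.union hL.isClosed
  subset := union_subset hK.subset hL.subset
  openCell_subset x _ hp hpK := hpK.elim
    (fun h => (hK.openCell_subset x hp h).trans subset_union_left)
    fun h => (hL.openCell_subset x hp h).trans subset_union_right

theorem isCellular_of_forall_exists {K : Set E} (hK : IsClosed K)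
    (h : ∀ p ∈ K, ∃ L, IsCellular C L ∧ L ⊆ K ∧ p ∈ L) : IsCellular C K where
  isClosed := hK
  subset p hp := by
    obtain ⟨L, hL, -, hpL⟩ := h p hp
    exact hL.subset hpL
  openCell_subset x p hp hpK := by
    obtain ⟨L, hL, hLK, hpL⟩ := h p hpK
    exact (hL.openCell_subset x hp hpL).trans hLK

variable [T2Space E]

theorem IsCellular.closedCell_subset {K : Set E} (hK : IsCellular C K) {d : ℕ} {x : cell C d}
    {p : E} (hp : p ∈ openCell d x) (hpK : p ∈ K) : closedCell d x ⊆ K :=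
  openCell_subset_closed hK.isClosed (hK.openCell_subset x hp hpK)

variable (C) in
theorem isCellular_complex : IsCellular C C where
  isClosed := RelCWComplex.isClosed
  subset := Subset.rfl
  openCell_subset x _ _ _ := RelCWComplex.openCell_subset_complex _ x

theorem isCellular_subcomplex (Y : RelCWComplex.Subcomplex C) : IsCellular C (Y : Set E) where
  isClosed := Y.closed
  subset := Y.subset_complex
  openCell_subset {d} x p hp hpY := by
    by_cases hx : x ∈ Y.I d
    · exact RelCWComplex.Subcomplex.openCell_subset_of_mem Y hx
    · exact absurd hpY
        ((RelCWComplex.Subcomplex.disjoint_openCell_subcomplex_of_not_mem Y hx).notMem_of_mem_left hp)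

theorem mem_subcomplex_iff (Y : RelCWComplex.Subcomplex C) {d : ℕ} (x : cell C d) :
    x ∈ Y.I d ↔ openCell d x ⊆ Y := by
  refine ⟨fun h => RelCWComplex.Subcomplex.openCell_subset_of_mem Y h, fun h => ?_⟩
  by_contra hx
  have := RelCWComplex.Subcomplex.disjoint_openCell_subcomplex_of_not_mem Y hx
  exact this.notMem_of_mem_left (RelCWComplex.map_zero_mem_openCell d x)
    (h (RelCWComplex.map_zero_mem_openCell d x))

theorem openCell_subset_iff_isCritical {Y : RelCWComplex.Subcomplex C} {M : MorseMatching C}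
    (hY : ∀ (d : ℕ) (x : cell C d), x ∈ Y.I d ↔ M.IsCritical x) {d : ℕ} (x : cell C d) :
    openCell d x ⊆ Y ↔ M.IsCritical x := by
  rw [← mem_subcomplex_iff, hY]

theorem isCritical_of_isFacet {Y : RelCWComplex.Subcomplex C} {M : MorseMatching C}
    (hY : ∀ (d : ℕ) (x : cell C d), x ∈ Y.I d ↔ M.IsCritical x)
    {d : ℕ} {σ : cell C d} {y : cell C (d + 1)} (hy : M.IsCritical y) (hσy : IsFacet σ y) :
    M.IsCritical σ := by
  rw [← hY, mem_subcomplex_iff] at hy ⊢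
  exact (RelCWComplex.openCell_subset_closedCell _ _).trans
    (hσy.trans (openCell_subset_closed Y.closed hy))

variable [RelCWComplex.Finite C]

/-- Closed cells of a regular complex are subcomplexes, since their boundaries are unions of closed
cells. -/
theorem IsRegular.isCellular_closedCell (h : IsRegular C) {d : ℕ} (x : cell C d) :
    IsCellular C (closedCell d x) := by
  induction d with
  | zero =>
    refine ⟨RelCWComplex.isClosed_closedCell, RelCWComplex.closedCell_subset_complex _ x, ?_⟩
    intro k y p hpy hp
    have hp' : p ∈ openCell 0 x := by
      rw [RelCWComplex.closedCell_zero_eq_singleton] at hp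
      rwa [RelCWComplex.openCell_zero_eq_singleton]
    obtain ⟨⟩ := sigma_eq_of_mem_openCell hpy hp'
    exact RelCWComplex.openCell_subset_closedCell _ _
  | succ d ih =>
    have hf : IsCellular C (cellFrontier (d + 1) x) := by
      refine isCellular_of_forall_exists RelCWComplex.isClosed_cellFrontier fun p hp => ?_
      rw [h.cellFrontier_eq] at hp ⊢
      simp only [mem_iUnion] at hp
      obtain ⟨σ, hσ, hpσ⟩ := hp
      exact ⟨_, ih σ, subset_biUnion_of_mem (u := fun σ => closedCell d σ) hσ, hpσ⟩
    refine ⟨RelCWComplex.isClosed_closedCell, RelCWComplex.closedCell_subset_complex _ x, ?_⟩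
    intro k y p hpy hp
    rw [← RelCWComplex.cellFrontier_union_openCell_eq_closedCell] at hp ⊢
    rcases hp with hp | hp
    · exact (hf.openCell_subset y hpy hp).trans subset_union_left
    · obtain ⟨⟩ := sigma_eq_of_mem_openCell hpy hp
      exact subset_union_right

theorem IsRegular.exists_isFacet (h : IsRegular C) {d : ℕ} {τ : cell C (d + 1)} {p : E}
    (hp : p ∈ cellFrontier (d + 1) τ) : ∃ σ : cell C d, IsFacet σ τ ∧ p ∈ closedCell d σ := by
  rw [h.cellFrontier_eq] at hp
  simpa using hp

theorem IsRegular.exists_vertex_subset_closedCell (h : IsRegular C) (d : ℕ) (x : cell C d) :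
    ∃ v : cell C 0, closedCell 0 v ⊆ closedCell d x := by
  induction d with
  | zero => exact ⟨x, Subset.rfl⟩
  | succ d ih =>
    obtain ⟨p, hp⟩ := RelCWComplex.nonempty_cellFrontier (C := C) (Nat.succ_ne_zero d) x
    obtain ⟨σ, hσ, -⟩ := h.exists_isFacet hp
    obtain ⟨v, hv⟩ := ih σ
    exact ⟨v, hv.trans hσ⟩

theorem IsRegular.exists_vertex_subset (h : IsRegular C) {K : Set E} (hK : IsCellular C K)
    (hne : K.Nonempty) : ∃ v : cell C 0, closedCell 0 v ⊆ K := by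
  obtain ⟨p, hp⟩ := hne
  obtain ⟨d, x, hx⟩ := exists_mem_openCell (hK.subset hp)
  obtain ⟨v, hv⟩ := h.exists_vertex_subset_closedCell d x
  exact ⟨v, hv.trans (hK.closedCell_subset hx hp)⟩

/-- If the closed cell `c` meets the open cell `x ≠ c`, it contains a cell of which `x` is a
facet. -/
theorem IsRegular.exists_cofacet_subset (h : IsRegular C) {k d : ℕ} {x : cell C k} {c : cell C d}
    {p : E} (hpx : p ∈ openCell k x) (hpc : p ∈ closedCell d c)
    (hne : (⟨d, c⟩ : Σ d, cell C d) ≠ ⟨k, x⟩) :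
    ∃ y : cell C (k + 1), IsFacet x y ∧ closedCell (k + 1) y ⊆ closedCell d c := by
  induction d with
  | zero =>
    have hp' : p ∈ openCell 0 c := by
      rw [RelCWComplex.closedCell_zero_eq_singleton] at hpc
      rwa [RelCWComplex.openCell_zero_eq_singleton]
    exact absurd (sigma_eq_of_mem_openCell hp' hpx) hne
  | succ d ih =>
    have hpf : p ∈ cellFrontier (d + 1) c := by
      rw [← RelCWComplex.cellFrontier_union_openCell_eq_closedCell] at hpc
      exact hpc.resolve_right fun h' => hne (sigma_eq_of_mem_openCell h' hpx)
    obtain ⟨σ, hσ, hpσ⟩ := h.exists_isFacet hpf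
    by_cases hσx : (⟨d, σ⟩ : Σ d, cell C d) = ⟨k, x⟩
    · obtain ⟨⟩ := hσx
      exact ⟨c, hσ, Subset.rfl⟩
    · obtain ⟨y, hxy, hy⟩ := ih hpσ hσx
      exact ⟨y, hxy, hy.trans hσ⟩

end Cellular

/-! ### Retractions of elementary collapses -/

section Collapse

universe u
variable {E : Type u} [TopologicalSpace E] {C : Set E}

/-- The image of a set under a map between subspaces. -/
def setImage {A B : Set E} (r : C(A, B)) (K : Set E) : Set E :=
  {q | ∃ p : A, (p : E) ∈ K ∧ (r p : E) = q}

theorem setImage_subset {A B : Set E} (r : C(A, B)) (K : Set E) : setImage r K ⊆ B := by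
  rintro _ ⟨p, -, rfl⟩
  exact (r p).2

theorem setImage_mono {A B : Set E} (r : C(A, B)) {K L : Set E} (h : K ⊆ L) :
    setImage r K ⊆ setImage r L := by
  rintro _ ⟨p, hp, rfl⟩
  exact ⟨p, h hp, rfl⟩

theorem setImage_comp {A A' B : Set E} (s : C(A', B)) (r : C(A, A')) (K : Set E) :
    setImage (s.comp r) K = setImage s (setImage r K) := by
  ext q
  constructor
  · rintro ⟨p, hp, rfl⟩
    exact ⟨r p, ⟨p, hp, rfl⟩, rfl⟩
  · rintro ⟨p', ⟨p, hp, hp'⟩, rfl⟩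
    refine ⟨p, hp, ?_⟩
    rw [ContinuousMap.comp_apply, Subtype.ext hp']

theorem setImage_of_fixes {A B : Set E} (r : C(A, B)) (hBA : B ⊆ A)
    (hfix : ∀ p : A, (p : E) ∈ B → (r p : E) = p) {K : Set E} (hK : K ⊆ B) : setImage r K = K := by
  ext q
  constructor
  · rintro ⟨p, hp, rfl⟩
    rwa [hfix p (hK hp)]
  · intro hq
    exact ⟨⟨q, hBA (hK hq)⟩, hq, hfix _ (hK hq)⟩

/-- Two maps on closed sets that agree on the intersection can be glued. -/
theorem continuousOn_piecewise_of_isClosed {X Z : Type*} [TopologicalSpace X] [TopologicalSpace Z]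
    {f g : X → Z} {s t : Set X} [∀ x, Decidable (x ∈ s)] (hs : IsClosed s) (ht : IsClosed t)
    (hf : ContinuousOn f s) (hg : ContinuousOn g t) (hfg : ∀ x ∈ s ∩ t, f x = g x) :
    ContinuousOn (s.piecewise f g) (s ∪ t) := by
  refine ContinuousOn.union_of_isClosed (hf.congr fun x hx => piecewise_eq_of_mem _ _ _ hx)
    (hg.congr fun x hx => ?_) hs ht
  by_cases hxs : x ∈ s
  · rw [piecewise_eq_of_mem _ _ _ hxs, hfg x ⟨hxs, hx⟩]
  · exact piecewise_eq_of_notMem _ _ _ hxs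

variable [CWComplex C] {M : MorseMatching C} {A B : Set E} {r : C(A, B)} {d : ℕ} {σ : cell C d}
  {τ : cell C (d + 1)}

theorem diff_isCellular {A : Set E} (hA : IsCellular C A) {d : ℕ} {σ : cell C d}
    {τ : cell C (d + 1)} (h : IsClosed (A \ (openCell d σ ∪ openCell (d + 1) τ))) :
    IsCellular C (A \ (openCell d σ ∪ openCell (d + 1) τ)) where
  isClosed := h
  subset := sdiff_subset.trans hA.subset
  openCell_subset x p hp hpB := by
    refine fun q hq => ⟨hA.openCell_subset x hp hpB.1 hq, ?_⟩
    rintro (hqσ | hqτ)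
    · obtain ⟨⟩ := sigma_eq_of_mem_openCell hq hqσ
      exact hpB.2 (Or.inl hp)
    · obtain ⟨⟩ := sigma_eq_of_mem_openCell hq hqτ
      exact hpB.2 (Or.inr hp)

theorem IsElementaryCollapse.subset (hr : IsElementaryCollapse M r σ τ) : B ⊆ A := by
  rw [hr.eq_diff]
  exact sdiff_subset

theorem IsElementaryCollapse.isCellular (hr : IsElementaryCollapse M r σ τ) (hA : IsCellular C A) :
    IsCellular C B := by
  have := hr.eq_diff
  subst this
  exact diff_isCellular hA hr.closed

theorem IsElementaryCollapse.setImage_closedCell_subset (hr : IsElementaryCollapse M r σ τ) :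
    setImage r (closedCell (d + 1) τ) ⊆ cellFrontier (d + 1) τ \ openCell d σ := by
  rintro _ ⟨p, hp, rfl⟩
  refine ⟨hr.collapses p hp, fun h => ?_⟩
  exact (hr.eq_diff.subset (r p).2).2 (Or.inl h)

variable [T2Space E]

theorem IsFacet.openCell_subset {d : ℕ} {σ : cell C d} {τ : cell C (d + 1)} (h : IsFacet σ τ) :
    openCell d σ ⊆ cellFrontier (d + 1) τ :=
  (RelCWComplex.openCell_subset_closedCell _ _).trans h.subset_cellFrontier

/-- What an elementary collapse leaves of the closed upper cell. -/
theorem closedCell_inter_diff {A : Set E} {d : ℕ} {σ : cell C d} {τ : cell C (d + 1)}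
    (hτA : closedCell (d + 1) τ ⊆ A) :
    closedCell (d + 1) τ ∩ (A \ (openCell d σ ∪ openCell (d + 1) τ)) =
      cellFrontier (d + 1) τ \ openCell d σ := by
  ext p
  constructor
  · rintro ⟨hp, -, hp'⟩
    rw [← RelCWComplex.cellFrontier_union_openCell_eq_closedCell] at hp
    exact ⟨hp.resolve_right fun h => hp' (Or.inr h), fun h => hp' (Or.inl h)⟩
  · rintro ⟨hp, hp'⟩
    have hpτ := RelCWComplex.cellFrontier_subset_closedCell _ τ hp
    refine ⟨hpτ, hτA hpτ, ?_⟩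
    rintro (h | h)
    · exact hp' h
    · exact (disjoint_openCell_cellFrontier τ τ le_rfl).notMem_of_mem_left h hp

theorem closedCell_inter_frontier_diff {d : ℕ} {σ : cell C d} {τ : cell C (d + 1)}
    (h : IsFacet σ τ) :
    closedCell d σ ∩ (cellFrontier (d + 1) τ \ openCell d σ) = cellFrontier d σ := by
  ext p
  constructor
  · rintro ⟨hp, -, hp'⟩
    rw [← RelCWComplex.cellFrontier_union_openCell_eq_closedCell] at hp
    exact hp.resolve_right hp'
  · intro hp
    have hpσ := RelCWComplex.cellFrontier_subset_closedCell _ σ hp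
    exact ⟨hpσ, h.subset_cellFrontier hpσ, fun h' =>
      (disjoint_openCell_cellFrontier σ σ le_rfl).notMem_of_mem_left h' hp⟩

theorem IsElementaryCollapse.closedCell_subset (hr : IsElementaryCollapse M r σ τ)
    (hA : IsCellular C A) : closedCell (d + 1) τ ⊆ A :=
  openCell_subset_closed hA.isClosed hr.upper_subset

theorem IsElementaryCollapse.closedCell_inter (hr : IsElementaryCollapse M r σ τ)
    (hA : IsCellular C A) : closedCell (d + 1) τ ∩ B = cellFrontier (d + 1) τ \ openCell d σ := by
  rw [hr.eq_diff]
  exact closedCell_inter_diff (hr.closedCell_subset hA)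

/-- The retraction of an elementary collapse maps the free face onto the rest of the boundary of
the upper cell. If it missed a point `p` there, then in the coordinates of the sphere minus `p` it
would be a self-map of Euclidean space that is the identity outside a ball and that misses a
value. -/
theorem IsElementaryCollapse.setImage_lower (hreg : IsRegular C)
    (hr : IsElementaryCollapse M r σ τ) (hA : IsCellular C A) :
    setImage r (closedCell d σ) = cellFrontier (d + 1) τ \ openCell d σ := by
  have hfac := M.facet hr.matched
  refine Subset.antisymm ((setImage_mono r hfac).trans hr.setImage_closedCell_subset) ?_
  intro p hp
  by_contra hpim
  have hτA := hr.closedCell_subset hA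
  have hFA : cellFrontier (d + 1) τ ⊆ A :=
    (RelCWComplex.cellFrontier_subset_closedCell _ τ).trans hτA
  have hKB : cellFrontier (d + 1) τ \ openCell d σ ⊆ B := by
    rw [← hr.closedCell_inter hA]; exact inter_subset_right
  have hpσ : p ∉ closedCell d σ := fun h => hpim ⟨⟨p, hFA hp.1⟩, h, hr.fixes _ (hKB hp)⟩
  obtain ⟨e⟩ := hreg.exists_homeomorph_cellFrontier_diff τ hp.1
  -- the retraction, restricted to the sphere without `p`
  have hmaps : ∀ s : (cellFrontier (d + 1) τ \ {p} : Set E),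
      (r ⟨s, hFA s.2.1⟩ : E) ∈ cellFrontier (d + 1) τ \ {p} := by
    intro s
    refine ⟨hr.collapses _ (RelCWComplex.cellFrontier_subset_closedCell _ τ s.2.1), fun hs => ?_⟩
    by_cases hsσ : (s : E) ∈ openCell d σ
    · exact hpim ⟨_, RelCWComplex.openCell_subset_closedCell _ _ hsσ, hs⟩
    · rw [hr.fixes _ (hKB ⟨s.2.1, hsσ⟩)] at hs
      exact s.2.2 hs
  let F : EuclideanSpace ℝ (Fin d) → EuclideanSpace ℝ (Fin d) := fun v =>
    e ⟨r ⟨e.symm v, hFA (e.symm v).2.1⟩, hmaps (e.symm v)⟩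
  have hF : Continuous F := by
    refine e.continuous.comp (Continuous.subtype_mk ?_ _)
    exact continuous_subtype_val.comp (r.continuous.comp (Continuous.subtype_mk (by fun_prop) _))
  have hFid : ∀ v, (e.symm v : E) ∉ closedCell d σ → F v = v := by
    intro v hv
    have : (r ⟨e.symm v, hFA (e.symm v).2.1⟩ : E) = e.symm v :=
      hr.fixes _ (hKB ⟨(e.symm v).2.1, fun h => hv (RelCWComplex.openCell_subset_closedCell _ _ h)⟩)
    simp only [F]
    rw [← e.apply_symm_apply v]
    congr 1
    exact Subtype.ext (by simpa using this)
  -- the free face is compact, so that it lies in a ball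
  have hcomp : IsCompact (Subtype.val ⁻¹' closedCell d σ : Set (cellFrontier (d + 1) τ \ {p} : Set E)) := by
    rw [Subtype.isCompact_iff, Subtype.image_preimage_coe, inter_eq_right.2]
    · exact RelCWComplex.isCompact_closedCell
    · exact fun q hq => ⟨hfac.subset_cellFrontier hq, fun h => hpσ (h ▸ hq)⟩
  obtain ⟨R, hR⟩ := (hcomp.image e.continuous).isBounded.exists_norm_le
  have hq : map d σ 0 ∈ cellFrontier (d + 1) τ \ {p} := by
    refine ⟨hfac.openCell_subset (RelCWComplex.map_zero_mem_openCell d σ), ?_⟩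
    rintro rfl
    exact hpσ (RelCWComplex.map_zero_mem_closedCell d σ)
  set v₀ := e ⟨_, hq⟩ with hv₀
  obtain ⟨v, hv⟩ := exists_eq_zero_of_eq_self_of_le_norm
    (F := fun v => F (v + v₀) - v₀) ((hF.comp (by fun_prop)).sub continuous_const)
    (R := R + ‖v₀‖ + 1) (by
      intro v hv
      rw [hFid, add_sub_cancel_right]
      intro hmem
      have h1 := hR _ ⟨_, hmem, e.apply_symm_apply _⟩
      have h2 : ‖v‖ ≤ ‖v + v₀‖ + ‖v₀‖ := by
        simpa using norm_sub_le (v + v₀) v₀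
      linarith)
  have h1 := e.injective (sub_eq_zero.1 hv)
  have h2 : (r ⟨e.symm (v + v₀), _⟩ : E) = map d σ 0 := congrArg Subtype.val h1
  have h3 := (r ⟨e.symm (v + v₀), hFA (e.symm (v + v₀)).2.1⟩).2
  rw [h2, hr.eq_diff] at h3
  exact h3.2 (Or.inl (RelCWComplex.map_zero_mem_openCell d σ))

/-- A continuous inverse of the characteristic map of a closed cell. -/
theorem IsRegular.exists_coordinates (hreg : IsRegular C) {d : ℕ} (x : cell C d) :
    ∃ κ : E → (Fin d → ℝ), ContinuousOn κ (closedCell d x) ∧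
      (∀ p ∈ closedCell d x, κ p ∈ closedBall 0 1 ∧ map d x (κ p) = p) ∧
      ∀ z ∈ closedBall 0 1, κ (map d x z) = z := by
  classical
  let e := hreg.closedCellHomeomorph x
  have hκ : ∀ p (hp : p ∈ closedCell d x),
      (if h : p ∈ closedCell d x then (e.symm ⟨p, h⟩ : Fin d → ℝ) else 0) = e.symm ⟨p, hp⟩ :=
    fun p hp => dif_pos hp
  refine ⟨fun p => if h : p ∈ closedCell d x then e.symm ⟨p, h⟩ else 0, ?_, ?_, ?_⟩
  · rw [continuousOn_iff_continuous_domRestrict]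
    have : (closedCell d x).domRestrict
        (fun p => if h : p ∈ closedCell d x then (e.symm ⟨p, h⟩ : Fin d → ℝ) else 0) =
        fun p => (e.symm p : Fin d → ℝ) := funext fun p => hκ p p.2
    rw [this]
    fun_prop
  · intro p hp
    simp only [hκ p hp]
    exact ⟨(e.symm ⟨p, hp⟩).2, congrArg Subtype.val (e.apply_symm_apply ⟨p, hp⟩)⟩
  · intro z hz
    simp only [hκ _ (mem_image_of_mem (map d x) hz)]
    exact congrArg Subtype.val (e.symm_apply_apply ⟨z, hz⟩)

/-- The boundary of `τ`, without the centre of its facet `σ`, retracts radially onto the part of the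
boundary outside the open cell `σ`. -/
theorem IsRegular.exists_radial_retraction (hreg : IsRegular C) {d : ℕ} {σ : cell C d}
    {τ : cell C (d + 1)} (hfac : IsFacet σ τ)
    (hK : IsClosed (cellFrontier (d + 1) τ \ openCell d σ)) :
    ∃ ρ : E → E, ContinuousOn ρ (cellFrontier (d + 1) τ \ {map d σ 0}) ∧
      (∀ p ∈ cellFrontier (d + 1) τ \ {map d σ 0}, ρ p ∈ cellFrontier (d + 1) τ \ openCell d σ) ∧
      ∀ p ∈ cellFrontier (d + 1) τ \ openCell d σ, ρ p = p := by
  classical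
  obtain ⟨κ, hκ, hκ1, hκ2⟩ := hreg.exists_coordinates σ
  have hκ0 : ∀ p ∈ closedCell d σ \ {map d σ 0}, κ p ≠ 0 := by
    rintro p ⟨hp, hp0⟩ h0
    apply hp0
    rw [mem_singleton_iff, ← h0, (hκ1 p hp).2]
  let f : E → E := fun p => map d σ (‖κ p‖⁻¹ • κ p)
  have hf : ContinuousOn f (closedCell d σ \ {map d σ 0}) := by
    have hκ' := hκ.mono (sdiff_subset (t := {map d σ 0}))
    refine (RelCWComplex.continuousOn (C := C) d σ).comp
      ((hκ'.norm.inv₀ fun p hp => norm_ne_zero_iff.2 (hκ0 p hp)).smul hκ') fun p hp => ?_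
    rw [mem_closedBall_zero_iff]
    exact (norm_inv_norm_smul (hκ0 p hp)).le
  have hfK : ∀ p ∈ closedCell d σ \ {map d σ 0}, f p ∈ cellFrontier d σ := fun p hp =>
    mem_image_of_mem _ (by rw [mem_sphere_zero_iff_norm, norm_inv_norm_smul (hκ0 p hp)])
  have hffix : ∀ p ∈ cellFrontier d σ, f p = p := by
    rintro _ ⟨z, hz, rfl⟩
    simp only [f]
    rw [hκ2 z (sphere_subset_closedBall hz), mem_sphere_zero_iff_norm.1 hz, inv_one, one_smul]
  have hinter := closedCell_inter_frontier_diff hfac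
  have hcov : cellFrontier (d + 1) τ \ {map d σ 0} =
      (cellFrontier (d + 1) τ \ {map d σ 0}) ∩
        (closedCell d σ ∪ (cellFrontier (d + 1) τ \ openCell d σ)) := by
    refine (inter_eq_left.2 fun p hp => ?_).symm
    by_cases h : p ∈ openCell d σ
    · exact Or.inl (RelCWComplex.openCell_subset_closedCell _ _ h)
    · exact Or.inr ⟨hp.1, h⟩
  refine ⟨(closedCell d σ).piecewise f id, ?_, ?_, ?_⟩
  · rw [continuousOn_iff_continuous_domRestrict, ← continuousOn_univ]
    have hu : (univ : Set (cellFrontier (d + 1) τ \ {map d σ 0} : Set E)) =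
        Subtype.val ⁻¹' closedCell d σ ∪
          Subtype.val ⁻¹' (cellFrontier (d + 1) τ \ openCell d σ) := by
      ext p
      have := hcov.subset p.2
      simpa using this.2
    rw [hu]
    have heq : (cellFrontier (d + 1) τ \ {map d σ 0}).domRestrict
        ((closedCell d σ).piecewise f id) =
        (Subtype.val ⁻¹' closedCell d σ).piecewise (fun p => f p) (fun p => (p : E)) := by
      ext p
      by_cases hp : (p : E) ∈ closedCell d σ <;> simp [piecewise, hp]
    rw [heq]
    refine continuousOn_piecewise_of_isClosed
      (RelCWComplex.isClosed_closedCell.preimage continuous_subtype_val)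
      (hK.preimage continuous_subtype_val) ?_ continuous_subtype_val.continuousOn ?_
    · exact hf.comp continuous_subtype_val.continuousOn fun p hp => ⟨hp, p.2.2⟩
    · rintro p ⟨hp, hp'⟩
      exact hffix p (hinter ▸ ⟨hp, hp'⟩)
  · intro p hp
    by_cases h : p ∈ closedCell d σ
    · rw [piecewise_eq_of_mem _ _ _ h]
      have := hfK p ⟨h, hp.2⟩
      rw [← hinter] at this
      exact this.2
    · rw [piecewise_eq_of_notMem _ _ _ h]
      exact ⟨hp.1, fun h' => h (RelCWComplex.openCell_subset_closedCell _ _ h')⟩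
  · intro p hp
    by_cases h : p ∈ closedCell d σ
    · rw [piecewise_eq_of_mem _ _ _ h]
      exact hffix p (hinter ▸ ⟨h, hp⟩)
    · rw [piecewise_eq_of_notMem _ _ _ h]
      rfl

/-- The closed cell `τ` retracts onto its boundary without the open facet `σ`: extend, by Tietze, the
inclusion of that part of the boundary into the boundary minus a point of `σ`, a copy of Euclidean
space, and compose with the radial retraction. -/
theorem IsRegular.exists_retraction_closedCell (hreg : IsRegular C) {d : ℕ} {σ : cell C d}
    {τ : cell C (d + 1)} (hfac : IsFacet σ τ)
    (hK : IsClosed (cellFrontier (d + 1) τ \ openCell d σ)) :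
    ∃ ρ : E → E, ContinuousOn ρ (closedCell (d + 1) τ) ∧
      (∀ p ∈ closedCell (d + 1) τ, ρ p ∈ cellFrontier (d + 1) τ \ openCell d σ) ∧
      ∀ p ∈ cellFrontier (d + 1) τ \ openCell d σ, ρ p = p := by
  classical
  obtain ⟨ρ, hρ, hρK, hρfix⟩ := hreg.exists_radial_retraction hfac hK
  have hq0 := RelCWComplex.map_zero_mem_openCell d σ
  obtain ⟨e⟩ := hreg.exists_homeomorph_cellFrontier_diff τ (hfac.openCell_subset hq0)
  have hKS : ∀ p ∈ cellFrontier (d + 1) τ \ openCell d σ,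
      p ∈ cellFrontier (d + 1) τ \ {map d σ 0} := fun p hp =>
    ⟨hp.1, fun h => hp.2 (h ▸ hq0)⟩
  have : CompactSpace (closedCell (d + 1) τ) :=
    isCompact_iff_compactSpace.1 RelCWComplex.isCompact_closedCell
  have : TietzeExtension (EuclideanSpace ℝ (Fin d)) := TietzeExtension.of_tvs ℝ
  let K' : Set (closedCell (d + 1) τ) :=
    Subtype.val ⁻¹' (cellFrontier (d + 1) τ \ openCell d σ)
  have hK' : IsClosed K' := hK.preimage continuous_subtype_val
  obtain ⟨G, hG⟩ := ContinuousMap.exists_extension hK'.isClosedEmbedding_subtypeVal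
    (⟨fun p => e ⟨p.1, hKS _ p.2⟩, by fun_prop⟩ : C(K', EuclideanSpace ℝ (Fin d)))
  have hGe : ∀ p : closedCell (d + 1) τ, ∀ hp : (p : E) ∈ cellFrontier (d + 1) τ \ openCell d σ,
      G p = e ⟨p, hKS _ hp⟩ := fun p hp => DFunLike.congr_fun hG ⟨p, hp⟩
  let g : closedCell (d + 1) τ → E := fun p => ρ (e.symm (G p))
  have hg : Continuous g :=
    hρ.comp_continuous (by fun_prop) fun p => (e.symm (G p)).2
  have hdif : ∀ p (hp : p ∈ closedCell (d + 1) τ),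
      (if h : p ∈ closedCell (d + 1) τ then g ⟨p, h⟩ else p) = g ⟨p, hp⟩ := fun p hp => dif_pos hp
  refine ⟨fun p => if h : p ∈ closedCell (d + 1) τ then g ⟨p, h⟩ else p, ?_, ?_, ?_⟩
  · rw [continuousOn_iff_continuous_domRestrict]
    exact hg.congr fun p => (hdif p p.2).symm
  · intro p hp
    simp only [hdif p hp]
    exact hρK _ (e.symm _).2
  · intro p hp
    have hpτ := RelCWComplex.cellFrontier_subset_closedCell _ τ hp.1
    simp only [hdif p hpτ, g]
    rw [hGe ⟨p, hpτ⟩ hp, e.symm_apply_apply]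
    exact hρfix p hp

/-- If removing a matched pair leaves a closed set, the elementary collapse has a retraction: the one
of the closed upper cell, extended by the identity. -/
theorem exists_isElementaryCollapse (hreg : IsRegular C) (M : MorseMatching C) {A : Set E}
    (hA : IsCellular C A) {d : ℕ} {σ : cell C d} {τ : cell C (d + 1)} (hM : M.pair d σ τ)
    (hσ : openCell d σ ⊆ A) (hτ : openCell (d + 1) τ ⊆ A)
    (hB : IsClosed (A \ (openCell d σ ∪ openCell (d + 1) τ))) :
    ∃ r : C(A, (A \ (openCell d σ ∪ openCell (d + 1) τ) : Set E)),
      IsElementaryCollapse M r σ τ := by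
  classical
  have hτA : closedCell (d + 1) τ ⊆ A := openCell_subset_closed hA.isClosed hτ
  have hfac := M.facet hM
  have hint := closedCell_inter_diff (σ := σ) hτA
  have hKB : cellFrontier (d + 1) τ \ openCell d σ ⊆
      A \ (openCell d σ ∪ openCell (d + 1) τ) := by
    rw [← hint]; exact inter_subset_right
  obtain ⟨ρ, hρ, hρK, hρfix⟩ := hreg.exists_retraction_closedCell hfac (by
    rw [← hint]; exact RelCWComplex.isClosed_closedCell.inter hB)
  have hcov : A = closedCell (d + 1) τ ∪ (A \ (openCell d σ ∪ openCell (d + 1) τ)) := by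
    refine Subset.antisymm (fun p hp => ?_) (union_subset hτA sdiff_subset)
    by_cases h : p ∈ openCell d σ ∪ openCell (d + 1) τ
    · exact Or.inl (h.elim (fun h => hfac (RelCWComplex.openCell_subset_closedCell _ _ h))
        fun h => RelCWComplex.openCell_subset_closedCell _ _ h)
    · exact Or.inr ⟨hp, h⟩
  have hcont : ContinuousOn ((closedCell (d + 1) τ).piecewise ρ id) A := by
    have := continuousOn_piecewise_of_isClosed (f := ρ) (g := id)
      (RelCWComplex.isClosed_closedCell (n := d + 1) (i := τ)) hB hρ continuousOn_id
      (fun p hp => hρfix p (hint ▸ hp))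
    rwa [← hcov] at this
  have hmaps : ∀ p ∈ A, (closedCell (d + 1) τ).piecewise ρ id p ∈
      A \ (openCell d σ ∪ openCell (d + 1) τ) := by
    intro p hp
    by_cases h : p ∈ closedCell (d + 1) τ
    · rw [piecewise_eq_of_mem _ _ _ h]
      exact hKB (hρK p h)
    · rw [piecewise_eq_of_notMem _ _ _ h]
      rw [hcov] at hp
      exact hp.resolve_left h
  refine ⟨⟨fun p => ⟨_, hmaps p p.2⟩,
    (continuousOn_iff_continuous_domRestrict.1 hcont).subtype_mk _⟩, hM, hσ, hτ, rfl, hB, ?_, ?_⟩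
  · intro p hp
    by_cases h : (p : E) ∈ closedCell (d + 1) τ
    · exact (piecewise_eq_of_mem _ _ _ h).trans (hρfix p (hint ▸ ⟨h, hp⟩))
    · exact piecewise_eq_of_notMem _ _ _ h
  · intro p hp
    change (closedCell (d + 1) τ).piecewise ρ id (p : E) ∈ cellFrontier (d + 1) τ
    rw [piecewise_eq_of_mem _ _ _ hp]
    exact (hρK p hp).1

/-- The retraction of an elementary collapse is homotopic to the identity by the straight-line
homotopy in the coordinates of the closed upper cell. -/
theorem IsElementaryCollapse.isStrongDeformationRetraction (hreg : IsRegular C)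
    (hr : IsElementaryCollapse M r σ τ) (hA : IsCellular C A) :
    IsStrongDeformationRetraction r := by
  classical
  refine ⟨hr.subset, ?_⟩
  have hτA := hr.closedCell_subset hA
  obtain ⟨κ, hκ, hκ1, hκ2⟩ := hreg.exists_coordinates τ
  have hrτ : ∀ p : A, (p : E) ∈ closedCell (d + 1) τ → (r p : E) ∈ closedCell (d + 1) τ :=
    fun p hp => RelCWComplex.cellFrontier_subset_closedCell _ τ (hr.collapses p hp)
  let T : Set (unitInterval × A) := {x | (x.2 : E) ∈ closedCell (d + 1) τ}
  have hT : IsClosed T := RelCWComplex.isClosed_closedCell.preimage (by fun_prop)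
  have hB : IsClosed {x : unitInterval × A | (x.2 : E) ∈ B} := hr.closed.preimage (by fun_prop)
  let z : unitInterval × A → (Fin (d + 1) → ℝ) := fun x =>
    (1 - (x.1 : ℝ)) • κ x.2 + (x.1 : ℝ) • κ (r x.2)
  have hz : ContinuousOn z T := by
    have h1 : ContinuousOn (fun x : unitInterval × A => κ x.2) T :=
      hκ.comp (by fun_prop) fun x hx => hx
    have h2 : ContinuousOn (fun x : unitInterval × A => κ (r x.2)) T :=
      hκ.comp (by fun_prop) fun x hx => hrτ x.2 hx
    have h3 : Continuous fun x : unitInterval × A => (x.1 : ℝ) := by fun_prop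
    exact ((continuous_const.sub h3).continuousOn.smul h1).add (h3.continuousOn.smul h2)
  have hzball : ∀ x ∈ T, z x ∈ closedBall 0 1 := by
    intro x hx
    refine (convex_closedBall _ _) (hκ1 _ hx).1 (hκ1 _ (hrτ x.2 hx)).1 ?_ x.1.2.1 (by ring)
    linarith [x.1.2.2]
  let F : unitInterval × A → E := T.piecewise (fun x => map (d + 1) τ (z x)) fun x => x.2
  have hfixB : ∀ x : unitInterval × A, (x.2 : E) ∈ B → F x = x.2 := by
    intro x hx
    by_cases h : x ∈ T
    · simp only [F, piecewise_eq_of_mem _ _ _ h, z]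
      rw [hr.fixes x.2 hx, ← add_smul, sub_add_cancel, one_smul, (hκ1 _ h).2]
    · exact piecewise_eq_of_notMem _ _ _ h
  have hF : Continuous F := by
    rw [← continuousOn_univ]
    have hu : (univ : Set (unitInterval × A)) = T ∪ {x | (x.2 : E) ∈ B} := by
      refine (eq_univ_of_forall fun x => ?_).symm
      by_cases h : (x.2 : E) ∈ openCell d σ ∪ openCell (d + 1) τ
      · exact Or.inl (h.elim
          (fun h => M.facet hr.matched (RelCWComplex.openCell_subset_closedCell _ _ h))
          fun h => RelCWComplex.openCell_subset_closedCell _ _ h)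
      · right
        rw [mem_ofPred_eq, hr.eq_diff]
        exact ⟨x.2.2, h⟩
    rw [hu]
    refine continuousOn_piecewise_of_isClosed hT hB
      ((RelCWComplex.continuousOn (C := C) (d + 1) τ).comp hz hzball) (by fun_prop) ?_
    rintro x ⟨hx, hxB⟩
    have := hfixB x hxB
    simp only [F] at this
    rwa [piecewise_eq_of_mem _ _ _ hx] at this
  have hFA : ∀ x, F x ∈ A := by
    intro x
    by_cases h : x ∈ T
    · simp only [F, piecewise_eq_of_mem _ _ _ h]
      exact hτA (mem_image_of_mem _ (hzball x h))
    · simp only [F, piecewise_eq_of_notMem _ _ _ h]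
      exact x.2.2
  refine ⟨⟨fun x => ⟨F x, hFA x⟩, hF.subtype_mk _⟩, fun p => Subtype.ext ?_, fun p => ?_,
    fun t p hp => Subtype.ext (hfixB (t, p) hp)⟩
  · change F (0, p) = p
    by_cases h : (p : E) ∈ closedCell (d + 1) τ
    · have hT0 : ((0, p) : unitInterval × A) ∈ T := h
      simp only [F, piecewise_eq_of_mem _ _ _ hT0, z]
      simp [(hκ1 _ h).2]
    · exact piecewise_eq_of_notMem _ _ _ h
  · change F (1, p) = r p
    by_cases h : (p : E) ∈ closedCell (d + 1) τ
    · have hT1 : ((1, p) : unitInterval × A) ∈ T := h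
      simp only [F, piecewise_eq_of_mem _ _ _ hT1, z]
      simp [(hκ1 _ (hrτ p h)).2]
    · have hpB : (p : E) ∈ B := by
        rw [hr.eq_diff]
        refine ⟨p.2, fun h' => h ?_⟩
        exact h'.elim
          (fun h => M.facet hr.matched (RelCWComplex.openCell_subset_closedCell _ _ h))
          fun h => RelCWComplex.openCell_subset_closedCell _ _ h
      rw [hr.fixes p hpB]
      exact piecewise_eq_of_notMem _ _ _ h

end Collapse

/-! ### Morse retractions -/

section MorseRetraction

universe u
variable {E : Type u} [TopologicalSpace E] {C : Set E}

theorem IsStrongDeformationRetraction.fixes {A B : Set E} {r : C(A, B)}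
    (h : IsStrongDeformationRetraction r) (p : A) (hp : (p : E) ∈ B) : (r p : E) = p := by
  obtain ⟨-, H, -, h1, h2⟩ := h
  rw [← h1 p, h2 1 p hp]

theorem isStrongDeformationRetraction_id (A : Set E) :
    IsStrongDeformationRetraction (ContinuousMap.id A) :=
  ⟨Subset.rfl, ⟨fun x => x.2, continuous_snd⟩, fun _ => rfl, fun _ => rfl, fun _ _ _ => rfl⟩

theorem IsStrongDeformationRetraction.comp {A A' B : Set E} {r : C(A, A')} {s : C(A', B)}
    (hs : IsStrongDeformationRetraction s) (hr : IsStrongDeformationRetraction r) :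
    IsStrongDeformationRetraction (s.comp r) := by
  have hrfix := hr.fixes
  obtain ⟨hA, H, hH0, hH1, hH⟩ := hr
  obtain ⟨hB, G, hG0, hG1, hG⟩ := hs
  let i : C(A', A) := ⟨fun p => ⟨p, hA p.2⟩, by fun_prop⟩
  let j : C(B, A) := ⟨fun p => ⟨p, hA (hB p.2)⟩, by fun_prop⟩
  let F₁ : ContinuousMap.HomotopyRel (ContinuousMap.id A) (i.comp r) {p | (p : E) ∈ B} :=
    { toContinuousMap := H
      map_zero_left := hH0
      map_one_left := fun p => Subtype.ext (hH1 p)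
      prop' := fun t p hp => hH t p (hB hp) }
  let F₂ : ContinuousMap.HomotopyRel (i.comp r) (j.comp (s.comp r)) {p | (p : E) ∈ B} :=
    { toFun := fun x => i (G (x.1, r x.2))
      continuous_toFun := by fun_prop
      map_zero_left := fun p => congrArg i (hG0 (r p))
      map_one_left := fun p => Subtype.ext (hG1 (r p))
      prop' := fun t p hp => congrArg i (hG t (r p) (by
        have hp' : (p : E) ∈ B := hp
        rwa [hrfix p (hB hp')])) }
  let F := F₁.trans F₂
  refine ⟨hB.trans hA, F.toContinuousMap, F.map_zero_left, fun p => ?_, fun t p hp => ?_⟩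
  · exact congrArg Subtype.val (F.map_one_left p)
  · exact F.eq_fst t hp

/-- A strong deformation retraction moves points inside their connected component. -/
theorem IsStrongDeformationRetraction.mem_connectedComponentIn {A B : Set E} {r : C(A, B)}
    (h : IsStrongDeformationRetraction r) (p : A) :
    (r p : E) ∈ connectedComponentIn A p := by
  obtain ⟨-, H, h0, h1, -⟩ := h
  have hpre : IsPreconnected (range fun t : unitInterval => (H (t, p) : E)) :=
    isPreconnected_range (by fun_prop)
  have hsub : range (fun t : unitInterval => (H (t, p) : E)) ⊆ A := by
    rintro _ ⟨t, rfl⟩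
    exact (H (t, p)).2
  have hp : (p : E) ∈ range fun t : unitInterval => (H (t, p) : E) := ⟨0, by simp [h0]⟩
  exact hpre.subset_connectedComponentIn hp hsub ⟨1, h1 p⟩

variable [CWComplex C] {M : MorseMatching C} {A B : Set E} {r : C(A, B)}

section Elementary

variable {d : ℕ} {σ : cell C d} {τ : cell C (d + 1)}

theorem IsElementaryCollapse.subset_of_not_subset [T2Space E] (hr : IsElementaryCollapse M r σ τ)
    {K : Set E} (hK : IsCellular C K) (hKA : K ⊆ A) (hσ : ¬ openCell d σ ⊆ K) : K ⊆ B := by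
  intro p hp
  rw [hr.eq_diff]
  refine ⟨hKA hp, ?_⟩
  rintro (h | h)
  · exact hσ (hK.openCell_subset σ h hp)
  · exact hσ ((RelCWComplex.openCell_subset_closedCell _ _).trans
      ((M.facet hr.matched).trans (hK.closedCell_subset h hp)))

theorem IsElementaryCollapse.openCell_subset_iff (hr : IsElementaryCollapse M r σ τ) {k : ℕ}
    (x : cell C k) : openCell k x ⊆ B ↔ openCell k x ⊆ A ∧
      (⟨k, x⟩ : Σ k, cell C k) ≠ ⟨d, σ⟩ ∧ (⟨k, x⟩ : Σ k, cell C k) ≠ ⟨d + 1, τ⟩ := by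
  have h0 := RelCWComplex.map_zero_mem_openCell k x
  rw [hr.eq_diff]
  constructor
  · intro h
    refine ⟨h.trans sdiff_subset, ?_, ?_⟩
    · rintro ⟨⟩
      exact (h h0).2 (Or.inl h0)
    · rintro ⟨⟩
      exact (h h0).2 (Or.inr h0)
  · rintro ⟨h, h1, h2⟩ p hp
    refine ⟨h hp, ?_⟩
    rintro (h' | h')
    · exact h1 (sigma_eq_of_mem_openCell hp h')
    · exact h2 (sigma_eq_of_mem_openCell hp h')

theorem IsElementaryCollapse.mem_of_notMem (hr : IsElementaryCollapse M r σ τ) {p : E}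
    (hp : p ∈ A) (hpB : p ∉ B) : p ∈ openCell d σ ∪ openCell (d + 1) τ := by
  by_contra h
  exact hpB (hr.eq_diff ▸ ⟨hp, h⟩)

theorem IsElementaryCollapse.mem_closedCell_of_notMem (hr : IsElementaryCollapse M r σ τ) {p : E}
    (hp : p ∈ A) (hpB : p ∉ B) : p ∈ closedCell (d + 1) τ :=
  (hr.mem_of_notMem hp hpB).elim
    (fun h => M.facet hr.matched (RelCWComplex.openCell_subset_closedCell _ _ h))
    fun h => RelCWComplex.openCell_subset_closedCell _ _ h

variable [T2Space E]

theorem IsElementaryCollapse.frontier_diff_subset (hr : IsElementaryCollapse M r σ τ)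
    (hA : IsCellular C A) : cellFrontier (d + 1) τ \ openCell d σ ⊆ B := by
  rw [← hr.closedCell_inter hA]
  exact inter_subset_right

theorem IsElementaryCollapse.map_mem_skeleton (hr : IsElementaryCollapse M r σ τ) {k : ℕ} {p : A}
    (hp : (p : E) ∈ skeleton C k) : (r p : E) ∈ skeleton C k := by
  by_cases hpB : (p : E) ∈ B
  · rwa [hr.fixes p hpB]
  · have hdk : d ≤ k := by
      by_contra! hlt
      rcases hr.mem_of_notMem p.2 hpB with h | h
      · exact (RelCWComplex.disjoint_skeleton_openCell
          (by exact_mod_cast hlt)).notMem_of_mem_left hp h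
      · exact (RelCWComplex.disjoint_skeleton_openCell
          (by exact_mod_cast hlt.trans (Nat.lt_succ_self d))).notMem_of_mem_left hp h
    exact RelCWComplex.skeleton_mono (by exact_mod_cast hdk)
      (RelCWComplex.cellFrontier_subset_skeleton d τ
        (hr.collapses p (hr.mem_closedCell_of_notMem p.2 hpB)))

/-- An elementary collapse replaces the two removed cells by the rest of the boundary of the upper
one. -/
theorem IsElementaryCollapse.setImage_eq (hreg : IsRegular C) (hr : IsElementaryCollapse M r σ τ)
    (hA : IsCellular C A) {K : Set E} (hK : IsCellular C K) (hKA : K ⊆ A)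
    (hσ : openCell d σ ⊆ K) :
    setImage r K = (K ∩ B) ∪ (cellFrontier (d + 1) τ \ openCell d σ) := by
  apply Subset.antisymm
  · rintro _ ⟨p, hp, rfl⟩
    by_cases hpB : (p : E) ∈ B
    · rw [hr.fixes p hpB]
      exact Or.inl ⟨hp, hpB⟩
    · exact Or.inr (hr.setImage_closedCell_subset
        ⟨p, hr.mem_closedCell_of_notMem p.2 hpB, rfl⟩)
  · refine union_subset (fun p hp => ⟨⟨p, hKA hp.1⟩, hp.1, hr.fixes _ hp.2⟩) ?_
    rw [← hr.setImage_lower hreg hA]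
    exact setImage_mono r (openCell_subset_closed hK.isClosed hσ)

variable [RelCWComplex.Finite C]

theorem IsElementaryCollapse.isCellular_frontier_diff (hreg : IsRegular C)
    (hr : IsElementaryCollapse M r σ τ) (hA : IsCellular C A) :
    IsCellular C (cellFrontier (d + 1) τ \ openCell d σ) := by
  rw [← hr.closedCell_inter hA]
  exact (hreg.isCellular_closedCell τ).inter (hr.isCellular hA)

theorem IsElementaryCollapse.isCellular_setImage (hreg : IsRegular C)
    (hr : IsElementaryCollapse M r σ τ) (hA : IsCellular C A) {K : Set E} (hK : IsCellular C K)
    (hKA : K ⊆ A) : IsCellular C (setImage r K) := by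
  by_cases hσ : openCell d σ ⊆ K
  · rw [hr.setImage_eq hreg hA hK hKA hσ]
    exact (hK.inter (hr.isCellular hA)).union (hr.isCellular_frontier_diff hreg hA)
  · rwa [setImage_of_fixes r hr.subset hr.fixes (hr.subset_of_not_subset hK hKA hσ)]

end Elementary

theorem IsMorseRetraction.isCellular (hr : IsMorseRetraction M r) (hA : IsCellular C A) :
    IsCellular C B := by
  induction hr with
  | refl A => exact hA
  | step σ τ r s hr hs ih => exact ih (hr.isCellular hA)

variable [T2Space E]

theorem IsMorseRetraction.isStrongDeformationRetraction (hreg : IsRegular C)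
    (hr : IsMorseRetraction M r) (hA : IsCellular C A) : IsStrongDeformationRetraction r := by
  induction hr with
  | refl A => exact isStrongDeformationRetraction_id A
  | step σ τ r s hr hs ih =>
    exact (ih (hr.isCellular hA)).comp (hr.isStrongDeformationRetraction hreg hA)

theorem IsMorseRetraction.map_mem_skeleton (hr : IsMorseRetraction M r) {k : ℕ} {p : A}
    (hp : (p : E) ∈ skeleton C k) : (r p : E) ∈ skeleton C k := by
  induction hr with
  | refl A => exact hp
  | step σ τ r s hr hs ih => exact ih (hr.map_mem_skeleton hp)

/-- A Morse retraction that removes the matched cells `σ` and `τ` has the same image on the closed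
cell `σ`, on the closed cell `τ`, and on the boundary of `τ` outside `σ`: all these cells are fixed
until `σ` and `τ` are collapsed, which maps both closed cells onto the rest of the boundary. -/
theorem IsMorseRetraction.setImage_eq_of_pair (hreg : IsRegular C) (hr : IsMorseRetraction M r)
    (hA : IsCellular C A) {d : ℕ} {σ : cell C d} {τ : cell C (d + 1)} (hM : M.pair d σ τ)
    (hσA : openCell d σ ⊆ A) (hτA : openCell (d + 1) τ ⊆ A) (hσB : ¬ openCell d σ ⊆ B) :
    setImage r (closedCell d σ) = setImage r (cellFrontier (d + 1) τ \ openCell d σ) ∧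
      setImage r (closedCell (d + 1) τ) =
        setImage r (cellFrontier (d + 1) τ \ openCell d σ) := by
  induction hr with
  | refl A => exact absurd hσA hσB
  | @step A A' B d' σ' τ' r s hr hs ih =>
    have hcl := openCell_subset_closed hA.isClosed hτA
    simp only [setImage_comp]
    by_cases heq : (⟨d, σ⟩ : Σ d, cell C d) = ⟨d', σ'⟩
    · obtain ⟨⟩ := heq
      obtain rfl := M.upper_unique hM hr.matched
      have h1 := hr.setImage_lower hreg hA
      have h2 : setImage r (cellFrontier (d + 1) τ \ openCell d σ) =
          cellFrontier (d + 1) τ \ openCell d σ :=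
        setImage_of_fixes r hr.subset hr.fixes (hr.frontier_diff_subset hA)
      have h3 : setImage r (closedCell (d + 1) τ) = cellFrontier (d + 1) τ \ openCell d σ :=
        Subset.antisymm hr.setImage_closedCell_subset
          (h1 ▸ setImage_mono r (M.facet hM))
      rw [h1, h2, h3]
      exact ⟨rfl, rfl⟩
    · have hσA' : openCell d σ ⊆ A' := (hr.openCell_subset_iff σ).2 ⟨hσA, heq, by
        rintro ⟨⟩
        exact M.not_both hr.matched hM⟩
      have hτA' : openCell (d + 1) τ ⊆ A' := (hr.openCell_subset_iff τ).2 ⟨hτA, by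
        rintro ⟨⟩
        exact M.not_both hM hr.matched, by
        rintro ⟨⟩
        exact heq (by rw [M.lower_unique hM hr.matched])⟩
      have hcl' := openCell_subset_closed hr.closed hτA'
      have hfix : ∀ K ⊆ A', setImage r K = K := fun K hK =>
        setImage_of_fixes r hr.subset hr.fixes hK
      rw [hfix _ hcl', hfix _ (openCell_subset_closed hr.closed hσA'),
        hfix _ ((sdiff_subset.trans (RelCWComplex.cellFrontier_subset_closedCell _ τ)).trans hcl')]
      exact ih (hr.isCellular hA) hσA' hτA' hσB

variable [RelCWComplex.Finite C]

theorem IsMorseRetraction.isCellular_setImage (hreg : IsRegular C) (hr : IsMorseRetraction M r)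
    (hA : IsCellular C A) {K : Set E} (hK : IsCellular C K) (hKA : K ⊆ A) :
    IsCellular C (setImage r K) := by
  induction hr generalizing K with
  | refl A =>
    rwa [setImage_of_fixes _ Subset.rfl (fun _ _ => rfl) hKA]
  | step σ τ r s hr hs ih =>
    rw [setImage_comp]
    exact ih (hr.isCellular hA) (hr.isCellular_setImage hreg hA hK hKA) (setImage_subset r K)

end MorseRetraction

/-! ### Existence of Morse retractions -/

section Existence

universe u
variable {E : Type u} [TopologicalSpace E] {C : Set E} [CWComplex C] {M : MorseMatching C}

/-- The lower cells of matched pairs in a set. -/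
def lowerCells (M : MorseMatching C) (A : Set E) : Set (Σ d, cell C d) :=
  {x | (∃ τ, M.pair x.1 x.2 τ) ∧ openCell x.1 x.2 ⊆ A}

/-- The assumptions on the stages of a sequence of collapses onto the critical subcomplex: such a
stage is a subcomplex that contains the critical cells and the two cells of a matched pair
together. -/
structure IsStage (M : MorseMatching C) (A : Set E) : Prop where
  isCellular : IsCellular C A
  critical : ∀ {d : ℕ} (x : cell C d), M.IsCritical x → openCell d x ⊆ A
  pair : ∀ {d : ℕ} {σ : cell C d} {τ : cell C (d + 1)}, M.pair d σ τ →
    (openCell d σ ⊆ A ↔ openCell (d + 1) τ ⊆ A)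

/-- A lower cell that no other lower cell reaches is a face of no cell but its partner: a further
cofacet would not be critical, and then it, or its partner, would reach the lower cell. -/
theorem IsStage.eq_of_isFacet {A : Set E} (hA : IsStage M A)
    (hcrit : ∀ {d : ℕ} {σ : cell C d} {y : cell C (d + 1)}, M.IsCritical y → IsFacet σ y →
      M.IsCritical σ)
    {d : ℕ} {σ : cell C d} {τ : cell C (d + 1)} (hM : M.pair d σ τ)
    (hmin : ∀ y ∈ lowerCells M A, ¬ Relation.TransGen (MorseStep M.pair) y ⟨d, σ⟩)
    {y : cell C (d + 1)} (hσy : IsFacet σ y) (hy : openCell (d + 1) y ⊆ A) : y = τ := by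
  by_contra hne
  have hstep : MorseStep M.pair ⟨d + 1, y⟩ ⟨d, σ⟩ :=
    MorseStep.down σ y hσy fun h => hne (M.upper_unique h hM)
  have hyc : ¬ M.IsCritical y := fun h => (hcrit h hσy).1 ⟨τ, hM⟩
  by_cases hlow : ∃ z, M.pair (d + 1) y z
  · exact hmin ⟨d + 1, y⟩ ⟨hlow, hy⟩ (Relation.TransGen.single hstep)
  · have hup : M.IsUpper y := by
      by_contra h
      exact hyc ⟨hlow, h⟩
    obtain ⟨σ', hσ'⟩ := hup
    exact hmin ⟨d, σ'⟩ ⟨⟨y, hσ'⟩, (hA.pair hσ').2 hy⟩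
      ((Relation.TransGen.single (MorseStep.up σ' y hσ')).tail hstep)

theorem isStage_complex [T2Space E] (M : MorseMatching C) : IsStage M C where
  isCellular := isCellular_complex C
  critical x _ := RelCWComplex.openCell_subset_complex _ x
  pair _ := iff_of_true (RelCWComplex.openCell_subset_complex _ _)
    (RelCWComplex.openCell_subset_complex _ _)

variable [RelCWComplex.Finite C]

/-- As the Morse digraph is acyclic, a set of cells has a member that no other member reaches. -/
theorem MorseMatching.exists_source (M : MorseMatching C) {s : Set (Σ d, cell C d)}
    (hs : s.Nonempty) : ∃ x ∈ s, ∀ y ∈ s, ¬ Relation.TransGen (MorseStep M.pair) y x := by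
  have := finite_sigma_cell C
  have : IsTrans _ (Relation.TransGen (MorseStep M.pair)) := ⟨fun _ _ _ h₁ h₂ => h₁.trans h₂⟩
  have : Std.Irrefl (Relation.TransGen (MorseStep M.pair)) := ⟨fun a h => M.acyclic a h⟩
  exact (Finite.wellFounded_of_trans_of_irrefl
    (Relation.TransGen (MorseStep M.pair))).has_min s hs

variable [T2Space E]

/-- Every stage retracts onto the critical subcomplex `Y`. Induct on the number of lower cells: a
lower cell `σ` that no other lower cell reaches in the Morse digraph is a facet of its partner `τ`
only, and then `τ` is a facet of nothing, so that the pair can be collapsed. -/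
theorem exists_isMorseRetraction (hreg : IsRegular C)
    {sgn : ∀ d : ℕ, cell C d → cell C (d + 1) → ℤ} (hsgn : IsIncidence sgn)
    (Y : RelCWComplex.Subcomplex C) (hY : ∀ (d : ℕ) (x : cell C d), x ∈ Y.I d ↔ M.IsCritical x)
    {A : Set E} (hA : IsStage M A) :
    ∃ r : C(A, (Y : Set E)), IsMorseRetraction M r := by
  have hfin := finite_sigma_cell C
  induction hn : (lowerCells M A).ncard using Nat.strong_induction_on generalizing A with
  | _ n ih =>
    rcases (lowerCells M A).eq_empty_or_nonempty with hemp | hne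
    · have hAY : A = (Y : Set E) := by
        apply Subset.antisymm
        · intro p hp
          obtain ⟨d, x, hx⟩ := exists_mem_openCell (hA.isCellular.subset hp)
          have hxA := hA.isCellular.openCell_subset x hx hp
          refine (mem_subcomplex_iff Y x).1 ((hY d x).2 ⟨fun hlow => ?_, fun hup => ?_⟩) hx
          · exact (hemp ▸ (show (⟨d, x⟩ : Σ d, cell C d) ∈ lowerCells M A from ⟨hlow, hxA⟩) :
              (⟨d, x⟩ : Σ d, cell C d) ∈ (∅ : Set _))
          · cases d with
            | zero => exact hup
            | succ d =>
              obtain ⟨σ, hσ⟩ := hup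
              exact (hemp ▸ (show (⟨d, σ⟩ : Σ d, cell C d) ∈ lowerCells M A from
                ⟨⟨x, hσ⟩, (hA.pair hσ).2 hxA⟩) : (⟨d, σ⟩ : Σ d, cell C d) ∈ (∅ : Set _))
        · intro p hp
          obtain ⟨d, x, hx⟩ := exists_mem_openCell (Y.subset_complex hp)
          refine hA.critical x ((hY d x).1 ?_) hx
          exact (mem_subcomplex_iff Y x).2 ((isCellular_subcomplex Y).openCell_subset x hx hp)
      subst hAY
      exact ⟨ContinuousMap.id _, IsMorseRetraction.refl _⟩
    · obtain ⟨⟨d, σ⟩, ⟨⟨τ, hM⟩, hσA⟩, hmin⟩ := M.exists_source hne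
      have hτA : openCell (d + 1) τ ⊆ A := (hA.pair hM).1 hσA
      have hσ1 := fun y : cell C (d + 1) => hA.eq_of_isFacet (isCritical_of_isFacet hY) hM hmin (y := y)
      -- the diamond with vertices `σ`, `τ` and a cofacet of `τ` has a fourth vertex
      have hτ1 : ∀ y : cell C (d + 2), IsFacet τ y → ¬ openCell (d + 2) y ⊆ A := by
        intro y hτy hyA
        have hsum := hsgn.diamond d σ y
        rw [Finset.sum_eq_single_of_mem τ (Finset.mem_univ _)] at hsum
        · exact (mul_ne_zero ((hsgn.ne_zero_iff d σ τ).2 (M.facet hM))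
            ((hsgn.ne_zero_iff _ τ y).2 hτy)) hsum
        · intro ρ _ hρ
          by_contra hne
          have h1 := (hsgn.ne_zero_iff d σ ρ).1 (left_ne_zero_of_mul hne)
          have h2 := (hsgn.ne_zero_iff _ ρ y).1 (right_ne_zero_of_mul hne)
          exact hρ (hσ1 ρ h1 ((RelCWComplex.openCell_subset_closedCell _ _).trans
            (h2.trans (openCell_subset_closed hA.isCellular.isClosed hyA))))
      have hτ2 : ∀ {k : ℕ} (c : cell C k), openCell k c ⊆ A →
          (⟨k, c⟩ : Σ k, cell C k) ≠ ⟨d + 1, τ⟩ → Disjoint (closedCell k c) (openCell (d + 1) τ) := by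
        intro k c hc hne
        rw [disjoint_left]
        intro p hpc hpτ
        obtain ⟨y, hy, hyc⟩ := hreg.exists_cofacet_subset hpτ hpc hne
        exact hτ1 y hy ((RelCWComplex.openCell_subset_closedCell _ _).trans
          (hyc.trans (openCell_subset_closed hA.isCellular.isClosed hc)))
      have hσ2 : ∀ {k : ℕ} (c : cell C k), openCell k c ⊆ A →
          (⟨k, c⟩ : Σ k, cell C k) ≠ ⟨d, σ⟩ → (⟨k, c⟩ : Σ k, cell C k) ≠ ⟨d + 1, τ⟩ →
          Disjoint (closedCell k c) (openCell d σ) := by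
        intro k c hc hne hne'
        rw [disjoint_left]
        intro p hpc hpσ
        obtain ⟨y, hy, hyc⟩ := hreg.exists_cofacet_subset hpσ hpc hne
        have hyA := (RelCWComplex.openCell_subset_closedCell _ _).trans
          (hyc.trans (openCell_subset_closed hA.isCellular.isClosed hc))
        obtain rfl := hσ1 y hy hyA
        have h0 := RelCWComplex.map_zero_mem_openCell (d + 1) y
        exact (hτ2 c hc hne').notMem_of_mem_left
          (hyc (RelCWComplex.openCell_subset_closedCell _ _ h0)) h0
      have hB : IsClosed (A \ (openCell d σ ∪ openCell (d + 1) τ)) := by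
        have : A \ (openCell d σ ∪ openCell (d + 1) τ) =
            ⋃ c ∈ {c : Σ k, cell C k | openCell c.1 c.2 ⊆ A ∧ c ≠ ⟨d, σ⟩ ∧ c ≠ ⟨d + 1, τ⟩},
              closedCell c.1 c.2 := by
          apply Subset.antisymm
          · rintro p ⟨hp, hp'⟩
            obtain ⟨k, x, hx⟩ := exists_mem_openCell (hA.isCellular.subset hp)
            refine mem_biUnion (x := ⟨k, x⟩) ⟨hA.isCellular.openCell_subset x hx hp, ?_, ?_⟩
              (RelCWComplex.openCell_subset_closedCell _ _ hx)
            · rintro ⟨⟩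
              exact hp' (Or.inl hx)
            · rintro ⟨⟩
              exact hp' (Or.inr hx)
          · refine iUnion₂_subset fun c hc p hp => ?_
            obtain ⟨hcA, h1, h2⟩ := hc
            refine ⟨openCell_subset_closed hA.isCellular.isClosed hcA hp, ?_⟩
            rintro (h | h)
            · exact (hσ2 c.2 hcA h1 h2).notMem_of_mem_left hp h
            · exact (hτ2 c.2 hcA h2).notMem_of_mem_left hp h
        rw [this]
        exact (toFinite _).isClosed_biUnion fun _ _ => RelCWComplex.isClosed_closedCell
      obtain ⟨r, hr⟩ := exists_isElementaryCollapse hreg M hA.isCellular hM hσA hτA hB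
      have hstage : IsStage M (A \ (openCell d σ ∪ openCell (d + 1) τ)) := by
        refine ⟨hr.isCellular hA.isCellular, fun x hx => ?_, fun {k σ' τ'} hM' => ?_⟩
        · refine (hr.openCell_subset_iff x).2 ⟨hA.critical x hx, ?_, ?_⟩
          · rintro ⟨⟩
            exact hx.1 ⟨τ, hM⟩
          · rintro ⟨⟩
            exact hx.2 ⟨σ, hM⟩
        · rw [hr.openCell_subset_iff, hr.openCell_subset_iff, hA.pair hM']
          refine and_congr_right fun _ => ⟨fun h => ⟨?_, ?_⟩, fun h => ⟨?_, ?_⟩⟩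
          · rintro ⟨⟩
            exact M.not_both hM' hM
          · rintro ⟨⟩
            exact h.1 (by rw [M.lower_unique hM' hM])
          · rintro ⟨⟩
            exact h.2 (by rw [M.upper_unique hM' hM])
          · rintro ⟨⟩
            exact M.not_both hM hM'
      have hlt : (lowerCells M (A \ (openCell d σ ∪ openCell (d + 1) τ))).ncard < n := by
        rw [← hn]
        refine ncard_lt_ncard ⟨fun x hx => ⟨hx.1, hx.2.trans sdiff_subset⟩, fun hsub => ?_⟩
          (toFinite _)
        have : (⟨d, σ⟩ : Σ d, cell C d) ∈ lowerCells M A := ⟨⟨τ, hM⟩, hσA⟩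
        exact ((hr.openCell_subset_iff σ).1 (hsub this).2).2.1 rfl
      obtain ⟨s, hs⟩ := ih _ hlt hstage rfl
      exact ⟨s.comp r, IsMorseRetraction.step σ τ r s hr hs⟩

end Existence

/-! ### The algebraic Morse complex -/

section AlgebraicMorse

universe u v
variable {E : Type u} [TopologicalSpace E] {C : Set E} [CWComplex C]
variable {n : ℕ} {R : Type v} [CommRing R] {M : MorseMatching C}

theorem eq_smul_single_toFace {d : ℕ} (x : cell C d) (a : MvPolynomial (Fin n) R) :
    (Finsupp.single (toFace x) a : FreeMod C n R (d + 1)) = a • Finsupp.single (toFace x) 1 := by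
  rw [Finsupp.smul_single, smul_eq_mul, mul_one]

theorem morseProj_single (i : ℕ) (b : {b : Face C i // M.IsCriticalFace b})
    (a : MvPolynomial (Fin n) R) :
    morseProj R M i (Finsupp.single b.1 a) = Finsupp.single b a := by
  classical
  ext1 y
  change Finsupp.single b.1 a y.1 = Finsupp.single b a y
  simp [Finsupp.single_apply, Subtype.ext_iff]

theorem morseIncl_single (i : ℕ) (b : {b : Face C i // M.IsCriticalFace b})
    (a : MvPolynomial (Fin n) R) :
    morseIncl R M i (Finsupp.single b a) = Finsupp.single b.1 a :=
  Finsupp.mapDomain_single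

theorem morseProj_morseIncl (i : ℕ) (z : MorseMod R M n i) :
    morseProj R M i (morseIncl R M i z) = z := by
  induction z using Finsupp.induction_linear with
  | zero => simp
  | add f g hf hg => rw [map_add, map_add, hf, hg]
  | single b a => rw [morseIncl_single, morseProj_single]

variable [RelCWComplex.Finite C]
variable {l : cell C 0 → (Fin n →₀ ℕ)} {sgn : ∀ d : ℕ, cell C d → cell C (d + 1) → ℤ}

theorem IsIncidence.eq_zero (hsgn : IsIncidence sgn) {d : ℕ} {σ : cell C d} {τ : cell C (d + 1)}
    (h : ¬ IsFacet σ τ) : sgn d σ τ = 0 := by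
  by_contra h0
  exact h ((hsgn.ne_zero_iff d σ τ).1 h0)

theorem entry_eq_zero (hsgn : IsIncidence sgn) {d : ℕ} {σ : cell C d} {τ : cell C (d + 1)}
    (h : ¬ IsFacet σ τ) : entry R l sgn σ τ = 0 := by
  simp [entry, hsgn.eq_zero h]

theorem entry_ne_zero [Nontrivial R] (hsgn : IsIncidence sgn) {d : ℕ} {σ : cell C d}
    {τ : cell C (d + 1)} (h : IsFacet σ τ) : entry R l sgn σ τ ≠ 0 := by
  have h0 := (hsgn.ne_zero_iff d σ τ).2 h
  rw [entry, Ne, MvPolynomial.monomial_eq_zero]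
  rcases hsgn.values d σ τ with h1 | h1 | h1
  · simp [h1]
  · exact absurd h1 h0
  · simp [h1]

theorem diff_single (i : ℕ) (a : Face C (i + 1)) :
    diff R l sgn i (Finsupp.single a 1) = boundary R l sgn i a := by
  rw [diff, Finsupp.linearCombination_single, one_smul]

theorem diff_single_succ (d : ℕ) (τ : cell C (d + 1)) :
    diff R l sgn (d + 1) (Finsupp.single (toFace τ) 1) =
      ∑ σ : cell C d, entry R l sgn σ τ • Finsupp.single (toFace σ) 1 := by
  rw [diff_single]
  simp only [Finsupp.smul_single, smul_eq_mul, mul_one]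
  rfl

theorem diff_single_apply {d : ℕ} (τ : cell C (d + 1)) (a : MvPolynomial (Fin n) R)
    (σ : cell C d) : diff R l sgn (d + 1) (Finsupp.single (toFace τ) a) (toFace σ) =
      a * entry R l sgn σ τ := by
  classical
  rw [eq_smul_single_toFace, map_smul, diff_single_succ, Finsupp.smul_apply,
    Finsupp.finsetSum_apply, Finset.sum_eq_single_of_mem σ (Finset.mem_univ _)]
  · rw [Finsupp.smul_apply, Finsupp.single_eq_same, smul_eq_mul, smul_eq_mul, mul_one]
  · intro ρ _ hρ
    rw [Finsupp.smul_apply, Finsupp.single_eq_of_ne (by exact hρ.symm), smul_zero]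

theorem morsePhi_single (d : ℕ) (x : cell C d) :
    morsePhi R l sgn M (d + 1) (Finsupp.single (toFace x) 1) = morsePhiGen R l sgn M d x :=
  (Finsupp.linearCombination_single (MvPolynomial (Fin n) R) (1 : MvPolynomial (Fin n) R)
    (x : cell C d)).trans (one_smul _ _)

theorem morsePhiGen_of_not_lower {d : ℕ} {x : cell C d} (h : ¬ ∃ k, M.pair d x k) :
    morsePhiGen R l sgn M d x = 0 := by
  rw [morsePhiGen, WellFounded.fix_eq, dif_neg h]

open Classical in
theorem morsePhiGen_of_pair (hsgn : IsIncidence sgn) {d : ℕ} {j : cell C d} {k : cell C (d + 1)}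
    (h : M.pair d j k) : morsePhiGen R l sgn M d j =
      Finsupp.single (toFace k) (Ring.inverse (entry R l sgn j k)) -
        ∑ m ∈ Finset.univ.erase j, (entry R l sgn m k * Ring.inverse (entry R l sgn j k)) •
          morsePhiGen R l sgn M d m := by
  have hex : ∃ k, M.pair d j k := ⟨k, h⟩
  obtain rfl : hex.choose = k := M.upper_unique hex.choose_spec h
  rw [morsePhiGen, WellFounded.fix_eq, dif_pos hex]
  congr 1
  rw [← Finset.add_sum_erase _ _ (Finset.mem_univ j), dif_neg (fun h' => h'.2 rfl), zero_add]
  refine Finset.sum_congr rfl fun m hm => ?_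
  have hmj := Finset.ne_of_mem_erase hm
  by_cases hf : IsFacet m hex.choose
  · rw [dif_pos ⟨hf, hmj⟩]
  · rw [dif_neg fun h' => hf h'.1, entry_eq_zero hsgn hf, zero_mul, zero_smul]

/-- On the upper cells of the matching, the homotopy inverts the differential. -/
theorem morsePhi_diff_single_of_pair (hsgn : IsIncidence sgn) (hM : IsAlgebraicMatching R l sgn M)
    {d : ℕ} {j : cell C d} {k : cell C (d + 1)} (h : M.pair d j k) :
    morsePhi R l sgn M (d + 1) (diff R l sgn (d + 1) (Finsupp.single (toFace k) 1)) =
      Finsupp.single (toFace k) 1 := by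
  classical
  rw [diff_single_succ, map_sum]
  simp only [map_smul, morsePhi_single]
  rw [← Finset.add_sum_erase _ _ (Finset.mem_univ j), morsePhiGen_of_pair hsgn h, smul_sub,
    Finsupp.smul_single, smul_eq_mul, Ring.mul_inverse_cancel _ (hM d j k h), Finset.smul_sum]
  have : ∀ m : cell C d, entry R l sgn j k • (entry R l sgn m k * Ring.inverse (entry R l sgn j k)) •
      morsePhiGen R l sgn M d m = entry R l sgn m k • morsePhiGen R l sgn M d m := by
    intro m
    rw [smul_smul, mul_left_comm, Ring.mul_inverse_cancel _ (hM d j k h), mul_one]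
  simp only [this, sub_add_cancel]

/-- The homotopy takes values in the span of the upper generators. -/
theorem morsePhi_apply_of_isCriticalFace (hsgn : IsIncidence sgn) (i : ℕ) (z : FreeMod C n R i)
    (y : Face C (i + 1)) (hy : M.IsCriticalFace y) : morsePhi R l sgn M i z y = 0 := by
  classical
  cases i with
  | zero => rfl
  | succ d =>
    have hgen : ∀ x : cell C d, morsePhiGen R l sgn M d x y = 0 := by
      intro x
      induction x using (M.prec_wellFounded d).induction with
      | _ x ih =>
        by_cases hx : ∃ k, M.pair d x k
        · obtain ⟨k, hk⟩ := hx
          have hyk : toFace k ≠ y := by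
            rintro rfl
            exact hy.2 ⟨x, hk⟩
          rw [morsePhiGen_of_pair hsgn hk, Finsupp.sub_apply, Finsupp.single_eq_of_ne hyk.symm,
            zero_sub, neg_eq_zero, Finsupp.finsetSum_apply]
          refine Finset.sum_eq_zero fun m hm => ?_
          by_cases hf : IsFacet m k
          · rw [Finsupp.smul_apply, ih m ⟨k, hk, hf, Finset.ne_of_mem_erase hm⟩, smul_zero]
          · rw [entry_eq_zero hsgn hf, zero_mul, zero_smul, Finsupp.zero_apply]
        · rw [morsePhiGen_of_not_lower hx, Finsupp.zero_apply]
    induction z using Finsupp.induction_linear with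
    | zero => simp
    | add f g hf hg => rw [map_add, Finsupp.add_apply, hf, hg, add_zero]
    | single x a =>
      obtain ⟨x, rfl⟩ : ∃ x' : cell C d, toFace x' = x := ⟨x, rfl⟩
      rw [eq_smul_single_toFace, map_smul, morsePhi_single, Finsupp.smul_apply, hgen, smul_zero]

theorem morseProj_comp_morsePhi (hsgn : IsIncidence sgn) (i : ℕ) (z : FreeMod C n R i) :
    morseProj R M (i + 1) (morsePhi R l sgn M i z) = 0 := by
  ext y
  exact congrArg _ (morsePhi_apply_of_isCriticalFace hsgn i z y.1 y.2)

theorem morsePi_succ_apply (i : ℕ) (z : FreeMod C n R (i + 1)) :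
    morsePi R l sgn M (i + 1) z = z - (diff R l sgn (i + 1) (morsePhi R l sgn M (i + 1) z) +
      morsePhi R l sgn M i (diff R l sgn i z)) := rfl

theorem morsePi_zero_apply (z : FreeMod C n R 0) : morsePi R l sgn M 0 z = z := by
  simp [morsePi, morsePhi]

/-- The map `π` is a chain map. -/
theorem morsePi_diff (hd : ∀ i z, diff R l sgn i (diff R l sgn (i + 1) z) = 0) (i : ℕ)
    (z : FreeMod C n R (i + 1)) :
    morsePi R l sgn M i (diff R l sgn i z) = diff R l sgn i (morsePi R l sgn M (i + 1) z) := by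
  rw [morsePi_succ_apply, map_sub, map_add, hd, zero_add]
  cases i with
  | zero => rw [morsePi_zero_apply]; simp [morsePhi]
  | succ i => rw [morsePi_succ_apply, hd, map_zero, add_zero]

/-- The map `π` kills the upper generators. -/
theorem morsePi_single_of_pair (hsgn : IsIncidence sgn) (hM : IsAlgebraicMatching R l sgn M)
    {d : ℕ} {j : cell C d} {k : cell C (d + 1)} (h : M.pair d j k) :
    morsePi R l sgn M (d + 2) (Finsupp.single (toFace k) 1) = 0 := by
  rw [morsePi_succ_apply, morsePhi_diff_single_of_pair hsgn hM h, morsePhi_single,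
    morsePhiGen_of_not_lower, map_zero, zero_add, sub_self]
  rintro ⟨τ, hτ⟩
  exact M.not_both h hτ

open Classical in
/-- On a lower cell `j`, the map `π` is determined by its values on the cells that follow `j` in the
matching: `π` kills the generator of the partner of `j` and hence its boundary. -/
theorem entry_smul_morsePi_single (hd : ∀ i z, diff R l sgn i (diff R l sgn (i + 1) z) = 0)
    (hsgn : IsIncidence sgn) (hM : IsAlgebraicMatching R l sgn M)
    {d : ℕ} {j : cell C d} {k : cell C (d + 1)} (h : M.pair d j k) :
    entry R l sgn j k • morsePi R l sgn M (d + 1) (Finsupp.single (toFace j) 1) =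
      - ∑ m ∈ Finset.univ.erase j,
        entry R l sgn m k • morsePi R l sgn M (d + 1) (Finsupp.single (toFace m) 1) := by
  have h0 := morsePi_diff (M := M) hd (d + 1) (Finsupp.single (toFace k) 1)
  rw [morsePi_single_of_pair hsgn hM h, map_zero, diff_single_succ, map_sum,
    ← Finset.add_sum_erase _ _ (Finset.mem_univ j)] at h0
  simp only [map_smul] at h0
  exact eq_neg_of_add_eq_zero_left h0

theorem morsePhi_single_of_isCriticalFace (i : ℕ) (b : Face C i) (hb : M.IsCriticalFace b)
    (a : MvPolynomial (Fin n) R) : morsePhi R l sgn M i (Finsupp.single b a) = 0 := by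
  cases i with
  | zero => rfl
  | succ d =>
    obtain ⟨b, rfl⟩ : ∃ b' : cell C d, toFace b' = b := ⟨b, rfl⟩
    rw [eq_smul_single_toFace, map_smul, morsePhi_single]
    exact (congrArg (a • ·) (morsePhiGen_of_not_lower hb.1)).trans (smul_zero a)

theorem morsePhi_morseIncl (i : ℕ) (z : MorseMod R M n i) :
    morsePhi R l sgn M i (morseIncl R M i z) = 0 := by
  induction z using Finsupp.induction_linear with
  | zero => simp
  | add f g hf hg => rw [map_add, map_add, hf, hg, add_zero]
  | single b a => rw [morseIncl_single, morsePhi_single_of_isCriticalFace i b.1 b.2]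

/-- The Morse chain map is left inverse to the inclusion of the critical generators. -/
theorem morseMap_morseIncl (hsgn : IsIncidence sgn) (i : ℕ) (z : MorseMod R M n i) :
    morseMap R l sgn M i (morseIncl R M i z) = z := by
  change morseProj R M i (morsePi R l sgn M i _) = z
  cases i with
  | zero => rw [morsePi_zero_apply, morseProj_morseIncl]
  | succ i =>
    rw [morsePi_succ_apply, morsePhi_morseIncl, map_zero, zero_add, map_sub,
      morseProj_comp_morsePhi hsgn, sub_zero, morseProj_morseIncl]

/-- The map `π` factors through the critical generators. -/
theorem morsePi_morseIncl_morseMap (hd : ∀ i z, diff R l sgn i (diff R l sgn (i + 1) z) = 0)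
    (hsgn : IsIncidence sgn) (hM : IsAlgebraicMatching R l sgn M) (i : ℕ) (z : FreeMod C n R i) :
    morsePi R l sgn M i (morseIncl R M i (morseMap R l sgn M i z)) = morsePi R l sgn M i z := by
  classical
  let T : FreeMod C n R i →ₗ[MvPolynomial (Fin n) R] FreeMod C n R i :=
    (morsePi R l sgn M i).comp ((morseIncl R M i).comp (morseProj R M i))
  have hcrit : ∀ (b : Face C i) (hb : M.IsCriticalFace b) (a : MvPolynomial (Fin n) R),
      T (morsePi R l sgn M i (Finsupp.single b a)) = morsePi R l sgn M i (Finsupp.single b a) := by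
    intro b hb a
    have := morseMap_morseIncl (M := M) (l := l) hsgn i (Finsupp.single ⟨b, hb⟩ a)
    rw [morseIncl_single] at this
    change morsePi R l sgn M i (morseIncl R M i (morseMap R l sgn M i (Finsupp.single b a))) = _
    rw [this, morseIncl_single]
  change T (morsePi R l sgn M i z) = morsePi R l sgn M i z
  induction z using Finsupp.induction_linear with
  | zero => simp
  | add f g hf hg => simp only [map_add, hf, hg]
  | single x a =>
    cases i with
    | zero => exact hcrit x trivial a
    | succ d =>
      suffices h : ∀ x : cell C d, T (morsePi R l sgn M (d + 1) (Finsupp.single (toFace x) 1)) =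
          morsePi R l sgn M (d + 1) (Finsupp.single (toFace x) 1) by
        obtain ⟨x, rfl⟩ : ∃ x' : cell C d, toFace x' = x := ⟨x, rfl⟩
        rw [eq_smul_single_toFace, map_smul, map_smul, h]
      intro x
      induction x using (M.prec_wellFounded d).induction with
      | _ x ih =>
        by_cases hlow : ∃ k, M.pair d x k
        · obtain ⟨k, hk⟩ := hlow
          have hu := hM d x k hk
          rw [← hu.smul_left_cancel, ← map_smul, entry_smul_morsePi_single hd hsgn hM hk, map_neg,
            map_sum]
          congr 1
          refine Finset.sum_congr rfl fun m hm => ?_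
          by_cases hf : IsFacet m k
          · rw [map_smul, ih m ⟨k, hk, hf, Finset.ne_of_mem_erase hm⟩]
          · rw [entry_eq_zero hsgn hf, zero_smul, map_zero]
        · by_cases hup : M.IsUpper x
          · cases d with
            | zero => exact hup.elim
            | succ d =>
              obtain ⟨j, hj⟩ := hup
              rw [morsePi_single_of_pair hsgn hM hj, map_zero]
          · exact hcrit (toFace x) ⟨hlow, hup⟩ 1

theorem morseDiff_apply (hd : ∀ i z, diff R l sgn i (diff R l sgn (i + 1) z) = 0) (i : ℕ)
    (z : MorseMod R M n (i + 1)) : morseDiff R l sgn M i z =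
      morseProj R M i (diff R l sgn i (morsePi R l sgn M (i + 1) (morseIncl R M (i + 1) z))) := by
  rw [morsePi_succ_apply, map_sub, map_add, hd, zero_add]
  rfl

/-- The Morse chain map is a chain map to the Morse complex. -/
theorem morseMap_diff (hd : ∀ i z, diff R l sgn i (diff R l sgn (i + 1) z) = 0)
    (hsgn : IsIncidence sgn) (hM : IsAlgebraicMatching R l sgn M) (i : ℕ)
    (z : FreeMod C n R (i + 1)) :
    morseMap R l sgn M i (diff R l sgn i z) =
      morseDiff R l sgn M i (morseMap R l sgn M (i + 1) z) := by
  rw [morseDiff_apply hd, morsePi_morseIncl_morseMap hd hsgn hM, ← morsePi_diff hd]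
  rfl

theorem morseMap_single_of_isCritical (hsgn : IsIncidence sgn) {d : ℕ} {x : cell C d}
    (hx : M.IsCritical x) : morseMap R l sgn M (d + 1) (Finsupp.single (toFace x) 1) =
      Finsupp.single ⟨toFace x, hx⟩ 1 := by
  rw [← morseMap_morseIncl (l := l) hsgn (d + 1) (Finsupp.single ⟨toFace x, hx⟩ 1),
    morseIncl_single]

theorem morseMap_single_of_pair (hsgn : IsIncidence sgn) (hM : IsAlgebraicMatching R l sgn M)
    {d : ℕ} {j : cell C d} {k : cell C (d + 1)} (h : M.pair d j k) :
    morseMap R l sgn M (d + 2) (Finsupp.single (toFace k) 1) = 0 := by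
  change morseProj R M _ (morsePi R l sgn M (d + 2) _) = 0
  rw [morsePi_single_of_pair hsgn hM h, map_zero]

open Classical in
theorem entry_mul_morseMap_single (hd : ∀ i z, diff R l sgn i (diff R l sgn (i + 1) z) = 0)
    (hsgn : IsIncidence sgn) (hM : IsAlgebraicMatching R l sgn M)
    {d : ℕ} {j : cell C d} {k : cell C (d + 1)} (h : M.pair d j k)
    (y : {b : Face C (d + 1) // M.IsCriticalFace b}) :
    entry R l sgn j k * morseMap R l sgn M (d + 1) (Finsupp.single (toFace j) 1) y =
      - ∑ m ∈ Finset.univ.erase j,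
        entry R l sgn m k * morseMap R l sgn M (d + 1) (Finsupp.single (toFace m) 1) y := by
  have := DFunLike.congr_fun (entry_smul_morsePi_single hd hsgn hM h) y.1
  rw [Finsupp.neg_apply, Finsupp.finsetSum_apply] at this
  exact this

/-- If a critical generator occurs in the image of the generator of a lower cell, it also occurs
in the image of another facet of the partner of that cell. -/
theorem exists_morseMap_single_ne_zero
    (hd : ∀ i z, diff R l sgn i (diff R l sgn (i + 1) z) = 0)
    (hsgn : IsIncidence sgn) (hM : IsAlgebraicMatching R l sgn M)
    {d : ℕ} {j : cell C d} {k : cell C (d + 1)} (h : M.pair d j k)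
    {y : {b : Face C (d + 1) // M.IsCriticalFace b}}
    (hy : morseMap R l sgn M (d + 1) (Finsupp.single (toFace j) 1) y ≠ 0) :
    ∃ m : cell C d, IsFacet m k ∧ m ≠ j ∧
      morseMap R l sgn M (d + 1) (Finsupp.single (toFace m) 1) y ≠ 0 := by
  classical
  have h0 : entry R l sgn j k * morseMap R l sgn M (d + 1) (Finsupp.single (toFace j) 1) y ≠ 0 :=
    fun h0 => hy ((hM d j k h).mul_right_eq_zero.1 h0)
  rw [entry_mul_morseMap_single hd hsgn hM h, neg_ne_zero] at h0
  obtain ⟨m, hm, hne⟩ := Finset.exists_ne_zero_of_sum_ne_zero h0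
  refine ⟨m, ?_, Finset.ne_of_mem_erase hm, right_ne_zero_of_mul hne⟩
  by_contra hf
  exact hne (by rw [entry_eq_zero hsgn hf, zero_mul])

/-- If the critical cells form a subcomplex, the span of the critical generators is a
subcomplex. -/
theorem morseIncl_morseProj_diff
    (hcrit : ∀ {d : ℕ} {σ : cell C d} {y : cell C (d + 1)}, M.IsCritical y →
      IsFacet σ y → M.IsCritical σ)
    (hsgn : IsIncidence sgn) (i : ℕ) (z : MorseMod R M n (i + 1)) :
    morseIncl R M i (morseProj R M i (diff R l sgn i (morseIncl R M (i + 1) z))) =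
      diff R l sgn i (morseIncl R M (i + 1) z) := by
  induction z using Finsupp.induction_linear with
  | zero => simp
  | add f g hf hg => simp only [map_add, hf, hg]
  | single b a =>
    cases i with
    | zero =>
      ext y
      rw [morseIncl_single]
      generalize diff R l sgn 0 (Finsupp.single b.1 a) = w
      induction w using Finsupp.induction_linear with
      | zero => simp
      | add f g hf hg => simp only [map_add, Finsupp.add_apply, MvPolynomial.coeff_add, hf, hg]
      | single c a =>
        rw [morseProj_single 0 ⟨c, trivial⟩ a, morseIncl_single]
    | succ d =>
      obtain ⟨τ, hτ⟩ := b
      obtain ⟨τ, rfl⟩ : ∃ τ' : cell C (d + 1), toFace τ' = τ := ⟨τ, rfl⟩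
      rw [morseIncl_single, eq_smul_single_toFace]
      simp only [map_smul]
      rw [diff_single_succ]
      simp only [map_sum, map_smul]
      refine congrArg (a • ·) (Finset.sum_congr rfl fun σ _ => ?_)
      by_cases hσ : IsFacet σ τ
      · rw [morseProj_single (d + 1) ⟨toFace σ, hcrit hτ hσ⟩ 1, morseIncl_single]
      · rw [entry_eq_zero hsgn hσ, zero_smul, zero_smul]

theorem morseDiff_eq
    (hcrit : ∀ {d : ℕ} {σ : cell C d} {y : cell C (d + 1)}, M.IsCritical y →
      IsFacet σ y → M.IsCritical σ)
    (hsgn : IsIncidence sgn) (i : ℕ) (z : MorseMod R M n (i + 1)) :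
    morseDiff R l sgn M i z = morseProj R M i (diff R l sgn i (morseIncl R M (i + 1) z)) := by
  change morseProj R M i (diff R l sgn i (morseIncl R M (i + 1) z) -
    diff R l sgn i (morsePhi R l sgn M i (diff R l sgn i (morseIncl R M (i + 1) z)))) = _
  rw [← morseIncl_morseProj_diff hcrit hsgn, morsePhi_morseIncl, map_zero, sub_zero]

theorem morseIncl_morseDiff
    (hcrit : ∀ {d : ℕ} {σ : cell C d} {y : cell C (d + 1)}, M.IsCritical y →
      IsFacet σ y → M.IsCritical σ)
    (hsgn : IsIncidence sgn) (i : ℕ) (z : MorseMod R M n (i + 1)) :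
    morseIncl R M i (morseDiff R l sgn M i z) = diff R l sgn i (morseIncl R M (i + 1) z) := by
  rw [morseDiff_eq hcrit hsgn, morseIncl_morseProj_diff hcrit hsgn]

/-- The Morse complex of an exact complex is exact, since it is a retract of that complex. -/
theorem exact_morseDiff
    (hcrit : ∀ {d : ℕ} {σ : cell C d} {y : cell C (d + 1)}, M.IsCritical y →
      IsFacet σ y → M.IsCritical σ)
    (hsgn : IsIncidence sgn) (hM : IsAlgebraicMatching R l sgn M)
    (hex : ∀ i, Function.Exact (diff R l sgn (i + 1)) (diff R l sgn i)) (i : ℕ) :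
    Function.Exact (morseDiff R l sgn M (i + 1)) (morseDiff R l sgn M i) := by
  have hd : ∀ i z, diff R l sgn i (diff R l sgn (i + 1) z) = 0 := fun i z =>
    (hex i).apply_apply_eq_zero z
  intro z
  constructor
  · intro hz
    have h0 : diff R l sgn i (morseIncl R M (i + 1) z) = 0 := by
      rw [← morseIncl_morseDiff hcrit hsgn, hz, map_zero]
    obtain ⟨w, hw⟩ := (hex i _).1 h0
    refine ⟨morseMap R l sgn M (i + 2) w, ?_⟩
    rw [← morseMap_diff hd hsgn hM, hw, morseMap_morseIncl hsgn]
  · rintro ⟨w, rfl⟩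
    rw [morseDiff_eq hcrit hsgn, morseIncl_morseDiff hcrit hsgn, hd, map_zero]

end AlgebraicMorse

/-! ### Labels of cellular sets -/

section SetLabel

universe u v
variable {E : Type u} [TopologicalSpace E] {C : Set E} [CWComplex C]

theorem vertex_subset_iff (v : cell C 0) {K : Set E} : closedCell 0 v ⊆ K ↔ map 0 v 0 ∈ K := by
  rw [RelCWComplex.closedCell_zero_eq_singleton, singleton_subset_iff,
    Subsingleton.elim ![] (0 : Fin 0 → ℝ)]

variable [RelCWComplex.Finite C] {n : ℕ} {l : cell C 0 → (Fin n →₀ ℕ)}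

open Classical in
/-- The least common multiple of the labels of the vertices in a set. -/
noncomputable def setLabel (l : cell C 0 → (Fin n →₀ ℕ)) (K : Set E) : Fin n →₀ ℕ :=
  (Finset.univ.filter fun v : cell C 0 => closedCell 0 v ⊆ K).sup l

theorem label_le_setLabel {K : Set E} {v : cell C 0} (h : closedCell 0 v ⊆ K) :
    l v ≤ setLabel l K := by
  classical
  exact Finset.le_sup (f := l) (Finset.mem_filter.2 ⟨Finset.mem_univ v, h⟩)

theorem setLabel_le {K : Set E} {a : Fin n →₀ ℕ} (h : ∀ v : cell C 0, closedCell 0 v ⊆ K → l v ≤ a) :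
    setLabel l K ≤ a := by
  classical
  exact Finset.sup_le fun v hv => h v (Finset.mem_filter.1 hv).2

theorem setLabel_mono {K L : Set E} (h : K ⊆ L) : setLabel l K ≤ setLabel l L :=
  setLabel_le fun _ hv => label_le_setLabel (hv.trans h)

theorem faceLabel_vertex (v : cell C 0) : faceLabel l v = l v := by
  refine le_antisymm (setLabel_le fun w hw => ?_) (label_le_setLabel Subset.rfl)
  rw [vertex_subset_iff, RelCWComplex.closedCell_zero_eq_singleton,
    ← RelCWComplex.openCell_zero_eq_singleton] at hw
  obtain ⟨⟩ := sigma_eq_of_mem_openCell (RelCWComplex.map_zero_mem_openCell 0 w) hw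
  rfl

variable {R : Type v} [CommRing R] {sgn : ∀ d : ℕ, cell C d → cell C (d + 1) → ℤ}
variable {M : MorseMatching C}

/-- A monomial that is a unit is constant, as its constant coefficient is a unit. -/
theorem eq_zero_of_isUnit_monomial [Nontrivial R] {a : Fin n →₀ ℕ} {c : R}
    (h : IsUnit (MvPolynomial.monomial a c)) : a = 0 := by
  by_contra ha
  have := h.map (MvPolynomial.constantCoeff (R := R) (σ := Fin n))
  rw [MvPolynomial.constantCoeff_monomial, if_neg ha] at this
  exact not_isUnit_zero this

/-- Matched cells have the same label; only this inequality is not automatic. -/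
theorem IsAlgebraicMatching.faceLabel_le [Nontrivial R] (hM : IsAlgebraicMatching R l sgn M) {d : ℕ}
    {σ : cell C d} {τ : cell C (d + 1)} (h : M.pair d σ τ) : faceLabel l τ ≤ faceLabel l σ :=
  tsub_eq_zero_iff_le.1 (eq_zero_of_isUnit_monomial (hM d σ τ h))

variable [T2Space E] {A B : Set E} {r : C(A, B)}

/-- An elementary collapse does not increase labels: new vertices in the image of a set belong to the
upper cell, whose label is that of the free face. -/
theorem IsElementaryCollapse.setLabel_setImage_le [Nontrivial R] (hreg : IsRegular C)
    (hM : IsAlgebraicMatching R l sgn M) {d : ℕ} {σ : cell C d} {τ : cell C (d + 1)}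
    (hr : IsElementaryCollapse M r σ τ) (hA : IsCellular C A) {K : Set E} (hK : IsCellular C K)
    (hKA : K ⊆ A) : setLabel l (setImage r K) ≤ setLabel l K := by
  by_cases hσ : openCell d σ ⊆ K
  · rw [hr.setImage_eq hreg hA hK hKA hσ]
    refine setLabel_le fun v hv => ?_
    rw [vertex_subset_iff] at hv
    rcases hv with hv | hv
    · exact label_le_setLabel ((vertex_subset_iff v).2 hv.1)
    · have hvτ : closedCell 0 v ⊆ closedCell (d + 1) τ :=
        (vertex_subset_iff v).2 (RelCWComplex.cellFrontier_subset_closedCell _ τ hv.1)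
      exact (label_le_setLabel hvτ).trans ((hM.faceLabel_le hr.matched).trans
        (setLabel_mono (openCell_subset_closed hK.isClosed hσ)))
  · rw [setImage_of_fixes r hr.subset hr.fixes (hr.subset_of_not_subset hK hKA hσ)]

/-- If the vertices of each edge that is matched with a vertex have the same label, an elementary
collapse replaces a vertex by one with the same label. -/
theorem IsElementaryCollapse.le_setLabel_setImage (hreg : IsRegular C)
    (hl : ∀ (v : cell C 0) (e : cell C 1), M.pair 0 v e → ∀ w : cell C 0, IsFacet w e → l w = l v)
    {d : ℕ} {σ : cell C d} {τ : cell C (d + 1)} (hr : IsElementaryCollapse M r σ τ)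
    (hA : IsCellular C A) {K : Set E} (hKA : K ⊆ A) :
    setLabel l K ≤ setLabel l (setImage r K) := by
  refine setLabel_le fun v hv => ?_
  have hvK := (vertex_subset_iff v).1 hv
  by_cases hvB : map 0 v 0 ∈ B
  · exact label_le_setLabel ((vertex_subset_iff v).2 ⟨⟨_, hKA hvK⟩, hvK, hr.fixes _ hvB⟩)
  · rcases hr.mem_of_notMem (hKA hvK) hvB with h | h
    · obtain ⟨⟩ := sigma_eq_of_mem_openCell (RelCWComplex.map_zero_mem_openCell 0 v) h
      have hlow := hr.setImage_lower hreg hA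
      obtain ⟨w, hw⟩ := hreg.exists_vertex_subset (hr.isCellular_frontier_diff hreg hA)
        (hlow ▸ ⟨_, ⟨_, hKA hvK⟩, RelCWComplex.map_zero_mem_closedCell 0 v, rfl⟩)
      rw [← hl v τ hr.matched w
        (hw.trans (sdiff_subset.trans (RelCWComplex.cellFrontier_subset_closedCell _ τ)))]
      exact label_le_setLabel (hw.trans (hlow ▸ setImage_mono r hv))
    · cases sigma_eq_of_mem_openCell (RelCWComplex.map_zero_mem_openCell 0 v) h

theorem IsMorseRetraction.setLabel_setImage_le [Nontrivial R] (hreg : IsRegular C)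
    (hM : IsAlgebraicMatching R l sgn M) (hr : IsMorseRetraction M r) (hA : IsCellular C A)
    {K : Set E} (hK : IsCellular C K) (hKA : K ⊆ A) : setLabel l (setImage r K) ≤ setLabel l K := by
  induction hr generalizing K with
  | refl A => rw [setImage_of_fixes _ Subset.rfl (fun _ _ => rfl) hKA]
  | step σ τ r s hr hs ih =>
    rw [setImage_comp]
    exact (ih (hr.isCellular hA) (hr.isCellular_setImage hreg hA hK hKA)
      (setImage_subset r K)).trans (hr.setLabel_setImage_le hreg hM hA hK hKA)

theorem IsMorseRetraction.le_setLabel_setImage (hreg : IsRegular C)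
    (hl : ∀ (v : cell C 0) (e : cell C 1), M.pair 0 v e → ∀ w : cell C 0, IsFacet w e → l w = l v)
    (hr : IsMorseRetraction M r) (hA : IsCellular C A) {K : Set E} (hKA : K ⊆ A) :
    setLabel l K ≤ setLabel l (setImage r K) := by
  induction hr generalizing K with
  | refl A => rw [setImage_of_fixes _ Subset.rfl (fun _ _ => rfl) hKA]
  | step σ τ r s hr hs ih =>
    rw [setImage_comp]
    exact (hr.le_setLabel_setImage hreg hl hA hKA).trans
      (ih (hr.isCellular hA) (setImage_subset r K))

end SetLabel

/-! ### Connected components and retractions -/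

section Components

universe u
variable {E : Type u} [TopologicalSpace E]

/-- The components of a deformation retract are the traces of the components of the space. -/
theorem IsStrongDeformationRetraction.connectedComponentIn_eq {A B : Set E} {r : C(A, B)}
    (hr : IsStrongDeformationRetraction r) {p : E} (hp : p ∈ B) :
    connectedComponentIn B p = connectedComponentIn A p ∩ B := by
  have hpA := hr.1 hp
  refine Subset.antisymm (subset_inter (connectedComponentIn_mono p hr.1)
    (connectedComponentIn_subset B p)) ?_
  rintro q ⟨hq, hqB⟩
  have hpre : IsPreconnected ((fun x : A => (r x : E)) '' connectedComponent ⟨p, hpA⟩) :=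
    isPreconnected_connectedComponent.image _ (by fun_prop)
  rw [connectedComponentIn_eq_image hpA] at hq
  obtain ⟨q, hq, rfl⟩ := hq
  refine hpre.subset_connectedComponentIn ⟨_, mem_connectedComponent, hr.fixes _ hp⟩ ?_
    ⟨q, hq, hr.fixes q hqB⟩
  rintro _ ⟨x, -, rfl⟩
  exact (r x).2

variable {C : Set E}

theorem EmptyFace.eq_connectedComponentIn {K : EmptyFace C} {p : E} (hK : p ∈ K.1) :
    K.1 = connectedComponentIn C p := by
  rcases K.2 with ⟨-, h⟩ | ⟨q, -, h⟩
  · rw [h] at hK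
    exact absurd hK (notMem_empty p)
  · rw [h] at hK ⊢
    exact _root_.connectedComponentIn_eq hK

theorem EmptyFace.eq_of_mem {K L : EmptyFace C} {p : E} (hK : p ∈ K.1) (hL : p ∈ L.1) : K = L :=
  Subtype.ext ((EmptyFace.eq_connectedComponentIn hK).trans
    (EmptyFace.eq_connectedComponentIn hL).symm)

theorem EmptyFace.eq_of_isEmpty (h : C = ∅) (K L : EmptyFace C) : K = L := by
  have h0 : ∀ K : EmptyFace C, K.1 = ∅ := by
    rintro ⟨K, ⟨-, rfl⟩ | ⟨q, hq, rfl⟩⟩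
    · rfl
    · rw [h] at hq
      exact hq.elim
  exact Subtype.ext ((h0 K).trans (h0 L).symm)

theorem emptyFaceAt_eq_of_mem {K : EmptyFace C} {p : E} (hp : p ∈ C) (hK : p ∈ K.1) :
    emptyFaceAt p hp = K :=
  EmptyFace.eq_of_mem (mem_connectedComponentIn hp) hK

variable {D : Set E} {r : C(C, D)}

/-- The empty face of the retract in the component of a given empty face. -/
def EmptyFace.restrict (hr : IsStrongDeformationRetraction r) (K : EmptyFace C) : EmptyFace D :=
  ⟨K.1 ∩ D, by
    obtain ⟨K, ⟨h, rfl⟩ | ⟨p, hp, rfl⟩⟩ := K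
    · exact Or.inl ⟨subset_empty_iff.1 (hr.1.trans h.subset), empty_inter _⟩
    · refine Or.inr ⟨r ⟨p, hp⟩, (r ⟨p, hp⟩).2, ?_⟩
      rw [hr.connectedComponentIn_eq (r ⟨p, hp⟩).2,
        ← _root_.connectedComponentIn_eq (hr.mem_connectedComponentIn ⟨p, hp⟩)]⟩

theorem EmptyFace.eq_emptyFaceAt_or (K : EmptyFace C) :
    C = ∅ ∨ ∃ (p : E) (hp : p ∈ C), K = emptyFaceAt p hp := by
  obtain ⟨K, ⟨h, rfl⟩ | ⟨p, hp, rfl⟩⟩ := K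
  exacts [Or.inl h, Or.inr ⟨p, hp, rfl⟩]

/-- An empty face of the retract comes from the only component that contains it. -/
theorem EmptyFace.restrict_eq_of_subset (hr : IsStrongDeformationRetraction r) {K : EmptyFace C}
    {L : EmptyFace D} (h : L.1 ⊆ K.1) : K.restrict hr = L := by
  rcases L.eq_emptyFaceAt_or with hD | ⟨p, hp, rfl⟩
  · exact EmptyFace.eq_of_isEmpty hD _ _
  · have hp' := mem_connectedComponentIn hp
    exact EmptyFace.eq_of_mem (p := p) ⟨h hp', hp⟩ hp'

theorem EmptyFace.bijective_restrict (hr : IsStrongDeformationRetraction r) :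
    Function.Bijective (EmptyFace.restrict hr) := by
  constructor
  · intro K L h
    rcases K.eq_emptyFaceAt_or with hC | ⟨p, hp, rfl⟩
    · exact EmptyFace.eq_of_isEmpty hC _ _
    · have hp' := hr.mem_connectedComponentIn ⟨p, hp⟩
      refine EmptyFace.eq_of_mem (p := (r ⟨p, hp⟩ : E)) hp' ?_
      have h2 : (r ⟨p, hp⟩ : E) ∈ (L.restrict hr).1 := h ▸ ⟨hp', (r ⟨p, hp⟩).2⟩
      exact h2.1
  · intro L
    rcases L.eq_emptyFaceAt_or with hD | ⟨p, hp, rfl⟩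
    · have hC : C = ∅ := by
        by_contra hne
        obtain ⟨p, hp⟩ := nonempty_iff_ne_empty.2 hne
        exact (hD ▸ (r ⟨p, hp⟩).2 : (r ⟨p, hp⟩ : E) ∈ (∅ : Set E))
      exact ⟨⟨∅, Or.inl ⟨hC, rfl⟩⟩, EmptyFace.eq_of_isEmpty hD _ _⟩
    · exact ⟨emptyFaceAt p (hr.1 hp),
        EmptyFace.restrict_eq_of_subset hr (connectedComponentIn_mono p hr.1)⟩

end Components

/-! ### Restriction of a cellular resolution to a subcomplex -/

section Subcomplex

universe u v
variable {E : Type u} [TopologicalSpace E] [T2Space E] {C : Set E} [CWComplex C]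
variable {Y : RelCWComplex.Subcomplex C}

theorem cellIncl_injective (d : ℕ) : Function.Injective (cellIncl Y (d := d)) :=
  Subtype.val_injective

theorem exists_cellIncl_eq_of_subset {d : ℕ} {x : cell C d} (h : closedCell d x ⊆ Y) :
    ∃ x' : cell (Y : Set E) d, cellIncl Y x' = x :=
  ⟨⟨x, (mem_subcomplex_iff Y x).2 ((RelCWComplex.openCell_subset_closedCell _ _).trans h)⟩, rfl⟩

theorem closedCell_subset_subcomplex {d : ℕ} (x : cell (Y : Set E) d) :
    closedCell d (cellIncl Y x) ⊆ Y :=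
  RelCWComplex.closedCell_subset_complex (C := (Y : Set E)) d x

theorem exists_cellIncl_eq_of_isFacet {d : ℕ} {x : cell C d} {y : cell (Y : Set E) (d + 1)}
    (h : IsFacet x (cellIncl Y y)) : ∃ x' : cell (Y : Set E) d, cellIncl Y x' = x :=
  exists_cellIncl_eq_of_subset (h.trans (closedCell_subset_subcomplex y))

theorem IsRegular.subcomplex (h : IsRegular C) : IsRegular (Y : Set E) :=
  fun d x => h d (cellIncl Y x)

theorem IsMorseRetraction.isCellularMap {M : MorseMatching C} {r : C(C, (Y : Set E))}
    (hr : IsMorseRetraction M r) :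
    IsCellularMap r := by
  intro d p hp
  have h := hr.map_mem_skeleton hp
  obtain ⟨k, y, hy⟩ := exists_mem_openCell (C := (Y : Set E)) (r p).2
  have hkd : k ≤ d := by
    by_contra! hlt
    exact (RelCWComplex.disjoint_skeleton_openCell (C := C) (j := cellIncl Y y)
      (by exact_mod_cast hlt)).notMem_of_mem_left h hy
  exact RelCWComplex.skeleton_mono (by exact_mod_cast hkd)
    (RelCWComplex.openCell_subset_skeleton k y hy)

variable [RelCWComplex.Finite C] {n : ℕ} {l : cell C 0 → (Fin n →₀ ℕ)}
variable {sgn : ∀ d : ℕ, cell C d → cell C (d + 1) → ℤ}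

theorem setLabel_restrictLabel {K : Set E} (hK : K ⊆ Y) :
    setLabel (restrictLabel Y l) K = setLabel l K := by
  refine le_antisymm (setLabel_le fun v hv => label_le_setLabel (v := cellIncl Y v) hv)
    (setLabel_le fun v hv => ?_)
  obtain ⟨v, rfl⟩ := exists_cellIncl_eq_of_subset (hv.trans hK)
  exact label_le_setLabel (l := restrictLabel Y l) hv

theorem faceLabel_restrictLabel {d : ℕ} (x : cell (Y : Set E) d) :
    faceLabel (restrictLabel Y l) x = faceLabel l (cellIncl Y x) :=
  setLabel_restrictLabel (closedCell_subset_subcomplex x)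

theorem entry_restrict {R : Type v} [CommRing R] {d : ℕ} (x : cell (Y : Set E) d)
    (y : cell (Y : Set E) (d + 1)) : entry R (restrictLabel Y l) (restrictSign Y sgn) x y =
      entry R l sgn (cellIncl Y x) (cellIncl Y y) := by
  rw [entry, entry, faceLabel_restrictLabel, faceLabel_restrictLabel]
  rfl

theorem IsIncidence.restrictSign (hsgn : IsIncidence sgn) : IsIncidence (restrictSign Y sgn) where
  values d σ τ := hsgn.values d _ _
  ne_zero_iff d σ τ := hsgn.ne_zero_iff d _ _
  edge e := by
    rw [← hsgn.edge (cellIncl Y e)]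
    refine Fintype.sum_of_injective (cellIncl Y) (cellIncl_injective 0) _ _ (fun v hv => ?_)
      fun _ => rfl
    exact hsgn.eq_zero fun h => hv (exists_cellIncl_eq_of_isFacet h)
  diamond d ρ τ := by
    rw [← hsgn.diamond d (cellIncl Y ρ) (cellIncl Y τ)]
    refine Fintype.sum_of_injective (cellIncl Y) (cellIncl_injective (d + 1)) _ _ (fun σ hσ => ?_)
      fun _ => rfl
    rw [hsgn.eq_zero fun h => hσ (exists_cellIncl_eq_of_isFacet h), mul_zero]

theorem imageLabel_eq_setLabel {r : C(C, (Y : Set E))} {d : ℕ} (x : cell C d) :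
    imageLabel (restrictLabel Y l) r x = setLabel l (setImage r (closedCell d x)) := by
  rw [imageLabel]
  apply le_antisymm
  · refine Finset.sup_le fun t ht => ?_
    rw [Set.Finite.mem_toFinset] at ht
    rw [faceLabel_restrictLabel]
    exact setLabel_mono ht
  · refine setLabel_le fun v hv => ?_
    obtain ⟨v, rfl⟩ := exists_cellIncl_eq_of_subset (hv.trans (setImage_subset _ _))
    have hmem : (⟨0, v⟩ : Σ k, cell (Y : Set E) k) ∈ imageCells r x := hv
    have h := Finset.le_sup
      (f := fun t : Σ k, cell (Y : Set E) k => faceLabel (restrictLabel Y l) t.2)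
      ((Set.Finite.mem_toFinset (@Set.toFinite _ (imageCells r x)
        (haveI := finite_sigma_cell (Y : Set E); inferInstance))).2 hmem)
    refine le_trans ?_ h
    exact (faceLabel_restrictLabel (l := l) v).symm ▸ (faceLabel_vertex (l := l) _).ge

end Subcomplex

/-! ### The Morse complex is the cellular complex of the critical subcomplex -/

section Isomorphism

universe u v
variable {E : Type u} [TopologicalSpace E] [T2Space E] {C : Set E} [CWComplex C]
variable {Y : RelCWComplex.Subcomplex C} {M : MorseMatching C} {n : ℕ} {R : Type v} [CommRing R]

/-- The critical faces are the faces of the critical subcomplex `Y`. An empty face of `C` is sent to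
the part of its component that lies in `Y`, which is a component of `Y` since `Y` is a deformation
retract. -/
noncomputable def criticalFaceEquiv (hY : ∀ (d : ℕ) (x : cell C d), x ∈ Y.I d ↔ M.IsCritical x)
    {r : C(C, (Y : Set E))} (hr : IsStrongDeformationRetraction r) :
    ∀ i, {b : Face C i // M.IsCriticalFace b} ≃ Face (Y : Set E) i
  | 0 => (Equiv.subtypeUnivEquiv fun _ => trivial).trans
      (Equiv.ofBijective _ (EmptyFace.bijective_restrict hr))
  | d + 1 => Equiv.subtypeEquivRight fun x => (hY d x).symm

/-- The isomorphism from the Morse complex to the cellular complex of the critical subcomplex, in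
homological degree `i`. -/
noncomputable def morseIso (R : Type v) [CommRing R] (n : ℕ)
    (hY : ∀ (d : ℕ) (x : cell C d), x ∈ Y.I d ↔ M.IsCritical x)
    {r : C(C, (Y : Set E))} (hr : IsStrongDeformationRetraction r) (i : ℕ) :
    MorseMod R M n i ≃ₗ[MvPolynomial (Fin n) R] FreeMod (Y : Set E) n R i :=
  Finsupp.domLCongr (criticalFaceEquiv hY hr i)

variable {hY : ∀ (d : ℕ) (x : cell C d), x ∈ Y.I d ↔ M.IsCritical x}
  {r : C(C, (Y : Set E))} {hr : IsStrongDeformationRetraction r}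

theorem morseIso_single (i : ℕ) (b : {b : Face C i // M.IsCriticalFace b})
    (a : MvPolynomial (Fin n) R) : morseIso R n hY hr i (Finsupp.single b a) =
      Finsupp.single (criticalFaceEquiv hY hr i b) a :=
  Finsupp.domLCongr_single _ _ _

theorem setImage_closedCell_of_isCritical
    (hY : ∀ (d : ℕ) (x : cell C d), x ∈ Y.I d ↔ M.IsCritical x)
    (hr : IsStrongDeformationRetraction r) {d : ℕ} {x : cell C d} (hx : M.IsCritical x) :
    setImage r (closedCell d x) = closedCell d x :=
  setImage_of_fixes r hr.1 hr.fixes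
    (openCell_subset_closed Y.closed ((openCell_subset_iff_isCritical hY x).2 hx))

theorem isCriticalFace_cellIncl (hY : ∀ (d : ℕ) (x : cell C d), x ∈ Y.I d ↔ M.IsCritical x) {d : ℕ}
    (y : cell (Y : Set E) d) : M.IsCriticalFace (toFace (cellIncl Y y)) :=
  (hY d _).1 (Subtype.prop (p := fun c => c ∈ Y.I d) y)

theorem morseIso_apply_toFace {d : ℕ} (z : MorseMod R M n (d + 1)) (y : cell (Y : Set E) d) :
    morseIso R n hY hr (d + 1) z (toFace y) =
      z ⟨toFace (cellIncl Y y), isCriticalFace_cellIncl hY y⟩ := rfl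

theorem criticalFaceEquiv_eq_of_sameFace (i : ℕ) {a : Face (Y : Set E) i}
    {b : {b : Face C i // M.IsCriticalFace b}} (h : SameFace Y a b.1) :
    criticalFaceEquiv hY hr i b = a := by
  cases i with
  | zero => exact EmptyFace.restrict_eq_of_subset hr h
  | succ d => exact Subtype.ext h.symm

variable [RelCWComplex.Finite C] {l : cell C 0 → (Fin n →₀ ℕ)}
variable {sgn : ∀ d : ℕ, cell C d → cell C (d + 1) → ℤ}

theorem morseIso_morseDiff (hsgn : IsIncidence sgn) (i : ℕ) (z : MorseMod R M n (i + 1)) :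
    morseIso R n hY hr i (morseDiff R l sgn M i z) =
      diff R (restrictLabel Y l) (restrictSign Y sgn) i (morseIso R n hY hr (i + 1) z) := by
  rw [morseDiff_eq (isCritical_of_isFacet hY) hsgn]
  induction z using Finsupp.induction_linear with
  | zero => simp
  | add f g hf hg => simp only [map_add, hf, hg]
  | single b a =>
    rw [morseIncl_single, morseIso_single]
    obtain ⟨y, rfl⟩ := (criticalFaceEquiv hY hr (i + 1)).symm.surjective b
    rw [Equiv.apply_symm_apply]
    cases i with
    | zero =>
      obtain ⟨y, rfl⟩ : ∃ y' : cell (Y : Set E) 0, toFace y' = y := ⟨y, rfl⟩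
      change morseIso R n hY hr 0 (morseProj R M 0 (diff R l sgn 0
        (Finsupp.single (toFace (cellIncl Y y)) a))) = _
      rw [eq_smul_single_toFace (cellIncl Y y) a, eq_smul_single_toFace y a, map_smul, map_smul, map_smul, map_smul,
        diff_single, diff_single]
      refine congrArg (a • ·) ?_
      change morseIso R n hY hr 0 (morseProj R M 0 (Finsupp.single (emptyFaceOf (cellIncl Y y))
        (MvPolynomial.monomial (faceLabel l (cellIncl Y y)) 1))) =
          Finsupp.single (emptyFaceOf y)
            (MvPolynomial.monomial (faceLabel (restrictLabel Y l) y) 1)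
      rw [morseProj_single 0 ⟨emptyFaceOf (cellIncl Y y), trivial⟩, morseIso_single,
        faceLabel_restrictLabel]
      congr 1
      refine EmptyFace.restrict_eq_of_subset hr ?_
      exact connectedComponentIn_mono _ hr.1
    | succ d =>
      obtain ⟨y, rfl⟩ : ∃ y' : cell (Y : Set E) (d + 1), toFace y' = y := ⟨y, rfl⟩
      ext1 w
      obtain ⟨w, rfl⟩ : ∃ w' : cell (Y : Set E) d, toFace w' = w := ⟨w, rfl⟩
      rw [diff_single_apply, morseIso_apply_toFace, entry_restrict]
      exact diff_single_apply (cellIncl Y y) a (cellIncl Y w)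

end Isomorphism

/-! ### Morse maps are morphisms of cellular resolutions -/

section Morphism

universe u v
variable {E : Type u} [TopologicalSpace E] [T2Space E] {C : Set E} [CWComplex C]
  {M : MorseMatching C} {Y : RelCWComplex.Subcomplex C} {r : C(C, (Y : Set E))}

/-- The images of the two closed cells of a matched pair. -/
theorem IsMorseRetraction.setImage_pair (hreg : IsRegular C)
    (hY : ∀ (d : ℕ) (x : cell C d), x ∈ Y.I d ↔ M.IsCritical x) (hr : IsMorseRetraction M r)
    {d : ℕ} {σ : cell C d} {τ : cell C (d + 1)} (h : M.pair d σ τ) :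
    setImage r (closedCell d σ) = setImage r (cellFrontier (d + 1) τ \ openCell d σ) ∧
      setImage r (closedCell (d + 1) τ) = setImage r (cellFrontier (d + 1) τ \ openCell d σ) :=
  hr.setImage_eq_of_pair hreg (isCellular_complex C) h (RelCWComplex.openCell_subset_complex d σ)
    (RelCWComplex.openCell_subset_complex (d + 1) τ)
    fun h' => ((openCell_subset_iff_isCritical hY σ).1 h').1 ⟨τ, h⟩

variable [RelCWComplex.Finite C] {n : ℕ} {R : Type v} [CommRing R]
  {l : cell C 0 → (Fin n →₀ ℕ)} {sgn : ∀ d : ℕ, cell C d → cell C (d + 1) → ℤ}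

/-- A critical generator that occurs in the image of the generator of a cell `x` belongs to a cell
in the image of `x`. By induction along the matching: the chain map expresses the generator of a
lower cell by those of the other facets of its partner, onto whose union the retraction pushes
that cell. -/
theorem IsMorseRetraction.closedCell_subset_of_morseMap_ne_zero (hreg : IsRegular C)
    (hd : ∀ i z, diff R l sgn i (diff R l sgn (i + 1) z) = 0)
    (hsgn : IsIncidence sgn) (hM : IsAlgebraicMatching R l sgn M)
    (hY : ∀ (d : ℕ) (x : cell C d), x ∈ Y.I d ↔ M.IsCritical x) (hr : IsMorseRetraction M r)
    {d : ℕ} {x y : cell C d} (hy : M.IsCritical y)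
    (hne : morseMap R l sgn M (d + 1) (Finsupp.single (toFace x) 1) ⟨toFace y, hy⟩ ≠ 0) :
    closedCell d y ⊆ setImage r (closedCell d x) := by
  induction x using (M.prec_wellFounded d).induction with
  | _ x ih =>
    by_cases hlow : ∃ k, M.pair d x k
    · obtain ⟨k, hk⟩ := hlow
      obtain ⟨m, hmk, hmx, hm⟩ := exists_morseMap_single_ne_zero hd hsgn hM hk hne
      rw [(hr.setImage_pair hreg hY hk).1]
      exact (ih m ⟨k, hk, hmk, hmx⟩ hm).trans (setImage_mono r
        (subset_sdiff.2 ⟨hmk.subset_cellFrontier, (disjoint_openCell_closedCell hmx.symm).symm⟩))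
    · by_cases hup : M.IsUpper x
      · cases d with
        | zero => exact hup.elim
        | succ d =>
          obtain ⟨j, hj⟩ := hup
          rw [morseMap_single_of_pair hsgn hM hj] at hne
          exact absurd rfl hne
      · have hx : M.IsCritical x := ⟨hlow, hup⟩
        rw [morseMap_single_of_isCritical hsgn hx] at hne
        have hxy : x = y := by
          by_contra hxy
          exact hne (Finsupp.single_eq_of_ne fun h => hxy (congrArg Subtype.val h).symm)
        rw [← hxy, setImage_closedCell_of_isCritical hY
          (hr.isStrongDeformationRetraction hreg (isCellular_complex C)) hx]

/-- For a matching with a single edge, the chain map has no further vanishing coefficients: the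
generator of the lower cell is sent to a combination of the generators of all other facets of the
upper cell, with nonzero coefficients. -/
theorem IsMorseRetraction.morseMap_ne_zero_of_closedCell_subset [Nontrivial R] (hreg : IsRegular C)
    (hd : ∀ i z, diff R l sgn i (diff R l sgn (i + 1) z) = 0)
    (hsgn : IsIncidence sgn) (hM : IsAlgebraicMatching R l sgn M)
    (hY : ∀ (d : ℕ) (x : cell C d), x ∈ Y.I d ↔ M.IsCritical x) (hr : IsMorseRetraction M r)
    (huniq : ∃! p : Σ d, cell C d × cell C (d + 1), M.pair p.1 p.2.1 p.2.2)
    {d : ℕ} {x y : cell C d} (hy : M.IsCritical y)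
    (hsub : closedCell d y ⊆ setImage r (closedCell d x)) :
    morseMap R l sgn M (d + 1) (Finsupp.single (toFace x) 1) ⟨toFace y, hy⟩ ≠ 0 := by
  classical
  have hsdr := hr.isStrongDeformationRetraction hreg (isCellular_complex C)
  have huniq' : ∀ {d k : ℕ} {σ : cell C d} {τ : cell C (d + 1)} {σ' : cell C k}
      {τ' : cell C (k + 1)}, M.pair d σ τ → M.pair k σ' τ' →
      (⟨d, σ, τ⟩ : Σ d, cell C d × cell C (d + 1)) = ⟨k, σ', τ'⟩ :=
    fun h h' => huniq.unique h h'
  -- the other facets of the upper cell are critical, hence fixed by the retraction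
  have hfix : ∀ {d : ℕ} {σ : cell C d} {τ : cell C (d + 1)}, M.pair d σ τ →
      setImage r (cellFrontier (d + 1) τ \ openCell d σ) = cellFrontier (d + 1) τ \ openCell d σ := by
    intro d σ τ h
    refine setImage_of_fixes r hsdr.1 hsdr.fixes ?_
    rintro p ⟨hp, hpσ⟩
    have hpC := RelCWComplex.closedCell_subset_complex _ τ
      (RelCWComplex.cellFrontier_subset_closedCell _ τ hp)
    obtain ⟨k, z, hz⟩ := exists_mem_openCell hpC
    refine (openCell_subset_iff_isCritical hY z).2 ⟨?_, fun hup => ?_⟩ hz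
    · rintro ⟨k', hk'⟩
      obtain ⟨⟩ := huniq' h hk'
      exact hpσ hz
    · cases k with
      | zero => exact hup.elim
      | succ k =>
        obtain ⟨j, hj⟩ := hup
        obtain ⟨⟩ := huniq' h hj
        exact (disjoint_openCell_cellFrontier τ τ le_rfl).notMem_of_mem_left hz hp
  by_cases hlow : ∃ k, M.pair d x k
  · obtain ⟨k, hk⟩ := hlow
    rw [(hr.setImage_pair hreg hY hk).1, hfix hk] at hsub
    have hyk : IsFacet y k :=
      hsub.trans (sdiff_subset.trans (RelCWComplex.cellFrontier_subset_closedCell _ k))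
    have hyx : y ≠ x := by
      rintro rfl
      exact hy.1 ⟨k, hk⟩
    have hcrit : ∀ m : cell C d, m ≠ x → M.IsCritical m := by
      refine fun m hm => ⟨?_, fun hup => ?_⟩
      · rintro ⟨k', hk'⟩
        obtain ⟨⟩ := huniq' hk hk'
        exact hm rfl
      · cases d with
        | zero => exact hup
        | succ d =>
          obtain ⟨j, hj⟩ := hup
          exact absurd (congrArg Sigma.fst (huniq' hk hj)) (Nat.succ_ne_self d)
    have hsum := entry_mul_morseMap_single hd hsgn hM hk ⟨toFace y, hy⟩
    rw [Finset.sum_eq_single_of_mem y (Finset.mem_erase.2 ⟨hyx, Finset.mem_univ _⟩),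
      morseMap_single_of_isCritical hsgn hy, Finsupp.single_eq_same, mul_one] at hsum
    · intro h0
      rw [h0, mul_zero, eq_comm, neg_eq_zero] at hsum
      exact entry_ne_zero hsgn hyk hsum
    · intro m hm hmy
      rw [morseMap_single_of_isCritical hsgn (hcrit m (Finset.ne_of_mem_erase hm)),
        Finsupp.single_eq_of_ne fun h => hmy (congrArg Subtype.val h).symm, mul_zero]
  · by_cases hup : M.IsUpper x
    · cases d with
      | zero => exact hup.elim
      | succ d =>
        obtain ⟨j, hj⟩ := hup
        rw [(hr.setImage_pair hreg hY hj).2, hfix hj] at hsub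
        have h0 := RelCWComplex.map_zero_mem_openCell (d + 1) y
        exact absurd (hsub (RelCWComplex.openCell_subset_closedCell _ _ h0)).1
          ((disjoint_openCell_cellFrontier y x le_rfl).notMem_of_mem_left h0)
    · have hx : M.IsCritical x := ⟨hlow, hup⟩
      rw [setImage_closedCell_of_isCritical hY hsdr hx] at hsub
      have hyx : y = x := by
        by_contra hne
        have h0 := RelCWComplex.map_zero_mem_openCell d y
        exact (disjoint_openCell_closedCell hne).notMem_of_mem_left h0
          (hsub (RelCWComplex.openCell_subset_closedCell _ _ h0))
      subst hyx
      rw [morseMap_single_of_isCritical hsgn hx, Finsupp.single_eq_same]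
      exact one_ne_zero

/-- In degree `0` the chain map only moves a component to its trace on `Y`, so it agrees with the
retraction on the label of a cell if the image of the cell has the same label. The isomorphism may
have been built from a different retraction `s`. -/
theorem labelAgrees_of_setLabel_eq {hY : ∀ (d : ℕ) (x : cell C d), x ∈ Y.I d ↔ M.IsCritical x}
    {s : C(C, (Y : Set E))} {hs : IsStrongDeformationRetraction s}
    (hr : IsStrongDeformationRetraction r) {d : ℕ} {x : cell C d}
    (h : setLabel l (setImage r (closedCell d x)) = faceLabel l x) :
    LabelAgrees R l (restrictLabel Y l)
      ((morseIso R n hY hs 0).toLinearMap.comp (morseMap R l sgn M 0)) r x := by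
  rw [LabelAgrees, imageLabel_eq_setLabel, h]
  change morseIso R n hY hs 0 (morseProj R M 0 (morsePi R l sgn M 0 _)) = _
  rw [morsePi_zero_apply, morseProj_single 0 ⟨emptyFaceOf x, trivial⟩, morseIso_single]
  congr 1
  refine EmptyFace.restrict_eq_of_subset hs ?_
  change connectedComponentIn (Y : Set E) _ ⊆ connectedComponentIn C _
  rw [_root_.connectedComponentIn_eq (hr.mem_connectedComponentIn ⟨map d x 0, center_mem x⟩)]
  exact connectedComponentIn_mono _ hr.1

/-- A Morse retraction preserves minimal labels: the image of a cell has a vertex, whose label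
divides the label of the cell. -/
theorem IsMorseRetraction.setLabel_setImage_of_hasMinimalLabel [Nontrivial R] (hreg : IsRegular C)
    (hM : IsAlgebraicMatching R l sgn M) (hr : IsMorseRetraction M r) {d : ℕ} {x : cell C d}
    (hx : HasMinimalLabel l x) : setLabel l (setImage r (closedCell d x)) = faceLabel l x := by
  have hC := isCellular_complex C
  have hK := hreg.isCellular_closedCell x
  have hsdr := hr.isStrongDeformationRetraction hreg hC
  have hle := hr.setLabel_setImage_le (l := l) hreg hM hC hK hK.subset
  refine le_antisymm hle ?_
  have h0 := RelCWComplex.map_zero_mem_closedCell d x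
  obtain ⟨v, hv⟩ := hreg.exists_vertex_subset (hr.isCellular_setImage hreg hC hK hK.subset)
    ⟨_, ⟨map d x 0, center_mem x⟩, h0, rfl⟩
  have hlv := label_le_setLabel (l := l) hv
  refine le_trans (hx v ?_ (hlv.trans hle)).ge hlv
  obtain ⟨p, hp, hpv⟩ := (vertex_subset_iff v).1 hv
  refine emptyFaceAt_eq_of_mem _ ?_
  have h1 : (p : E) ∈ connectedComponentIn C (map d x 0) := by
    have hpre : IsPreconnected (closedCell d x) :=
      ((convex_closedBall (0 : Fin d → ℝ) 1).isPreconnected.image _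
        (RelCWComplex.continuousOn d x))
    exact hpre.subset_connectedComponentIn h0 hK.subset hp
  change map 0 v 0 ∈ connectedComponentIn C (map d x 0)
  rw [_root_.connectedComponentIn_eq h1, ← hpv]
  exact hsdr.mem_connectedComponentIn p

end Morphism

end CellRes

open CellRes Topology Topology.RelCWComplex in
theorem mainTheorem3 {R : Type*} [CommRing R] [Nontrivial R] {n : ℕ}
    {E : Type*} [TopologicalSpace E] [T2Space E]
    (C : Set E) [CWComplex C] [RelCWComplex.Finite C]
    (l : cell C 0 → (Fin n →₀ ℕ)) (sgn : ∀ d : ℕ, cell C d → cell C (d + 1) → ℤ)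
    (hF : IsCellularResolution R l sgn)
    (M : MorseMatching C) (hM : IsAlgebraicMatching R l sgn M)
    (Y : RelCWComplex.Subcomplex C) (hY : ∀ (d : ℕ) (x : cell C d), x ∈ Y.I d ↔ M.IsCritical x) :
    (∃ r : C(C, (Y : Set E)), IsMorseRetraction M r) ∧
    ∃ Φ : ∀ i, MorseMod R M n i ≃ₗ[MvPolynomial (Fin n) R] FreeMod (Y : Set E) n R i,
      (∀ (i : ℕ) (a : Face (Y : Set E) i) (b : {b : Face C i // M.IsCriticalFace b}),
        SameFace Y a b.1 → Φ i (Finsupp.single b 1) = Finsupp.single a 1) ∧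
      (∀ (i : ℕ) (z : MorseMod R M n (i + 1)),
        Φ i (morseDiff R l sgn M i z) =
          diff R (restrictLabel Y l) (restrictSign Y sgn) i (Φ (i + 1) z)) ∧
      ∀ r : C(C, (Y : Set E)), IsMorseRetraction M r →
        IsStrongDeformationRetraction r ∧
        IsMorphism R l sgn (restrictLabel Y l) (restrictSign Y sgn)
          (fun i => (Φ i).toLinearMap.comp (morseMap R l sgn M i)) r ∧
        ((∀ (v : cell C 0) (e : cell C 1), M.pair 0 v e →
            ∀ w : cell C 0, IsFacet w e → l w = l v) →
          ∀ (d : ℕ) (x : cell C d),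
            LabelAgrees R l (restrictLabel Y l)
              ((Φ 0).toLinearMap.comp (morseMap R l sgn M 0)) r x) ∧
        ((∃! p : Σ d, cell C d × cell C (d + 1), M.pair p.1 p.2.1 p.2.2) →
          ∀ (d : ℕ) (x : cell C d) (y : cell (Y : Set E) d),
            Φ (d + 1) (morseMap R l sgn M (d + 1) (Finsupp.single (toFace x) 1)) (toFace y) ≠ 0 ↔
              ⟨d, y⟩ ∈ imageCells r x) := by
  have hreg := hF.regular
  have hsgn := hF.incidence
  have hd : ∀ i z, CellRes.diff R l sgn i (CellRes.diff R l sgn (i + 1) z) = 0 := fun i z =>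
    (hF.exact i).apply_apply_eq_zero z
  have hC := isCellular_complex C
  -- one retraction `s` serves to identify the components of `C` with those of `Y`
  obtain ⟨s, hs⟩ := exists_isMorseRetraction hreg hsgn Y hY (isStage_complex M)
  have hs' := hs.isStrongDeformationRetraction hreg hC
  have hΦ := morseIso_morseDiff (R := R) (l := l) (hY := hY) (hr := hs') hsgn
  have hcell : ∀ {r : C(C, (Y : Set E))}, IsMorseRetraction M r → ∀ (d : ℕ) (x : cell C d)
      (y : cell (Y : Set E) d), morseIso R n hY hs' (d + 1)
        (morseMap R l sgn M (d + 1) (Finsupp.single (toFace x) 1)) (toFace y) ≠ 0 →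
      ⟨d, y⟩ ∈ imageCells r x := fun hr _ _ y h =>
    hr.closedCell_subset_of_morseMap_ne_zero hreg hd hsgn hM hY (isCriticalFace_cellIncl hY y) h
  refine ⟨⟨s, hs⟩, morseIso R n hY hs', fun i a b hab => ?_, hΦ, fun r hr => ?_⟩
  · rw [morseIso_single, criticalFaceEquiv_eq_of_sameFace i hab]
  have hr' := hr.isStrongDeformationRetraction hreg hC
  refine ⟨hr', ⟨hF, ⟨hreg.subcomplex, hsgn.restrictSign, fun i => ?_⟩, fun i => ?_,
    hr.isCellularMap, ⟨fun d x => ?_, hcell hr, fun d x hx => ?_⟩⟩, fun hl d x => ?_,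
    fun huniq d x y => ⟨hcell hr d x y, fun h => ?_⟩⟩
  · exact (Function.Exact.iff_of_ladder_linearEquiv (e₁ := morseIso R n hY hs' (i + 2))
      (e₂ := morseIso R n hY hs' (i + 1)) (e₃ := morseIso R n hY hs' i)
      (LinearMap.ext fun z => (hΦ (i + 1) z).symm) (LinearMap.ext fun z => (hΦ i z).symm)).2
      (exact_morseDiff (isCritical_of_isFacet hY) hsgn hM hF.exact i)
  · refine LinearMap.ext fun z => ?_
    exact (congrArg _ (morseMap_diff hd hsgn hM i z)).trans (hΦ i _)
  · have hK := hreg.isCellular_closedCell x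
    have hcel := hr.isCellular_setImage hreg hC hK hK.subset
    refine Set.Subset.antisymm (fun p hp => ?_) (Set.iUnion₂_subset fun t ht => ht)
    obtain ⟨k, y, hy⟩ := exists_mem_openCell (C := (Y : Set E)) (setImage_subset r _ hp)
    exact Set.mem_biUnion (x := ⟨k, y⟩)
      (hcel.closedCell_subset (x := cellIncl Y y) hy hp) (openCell_subset_closedCell k y hy)
  · exact labelAgrees_of_setLabel_eq hr' (hr.setLabel_setImage_of_hasMinimalLabel hreg hM hx)
  · have hK := hreg.isCellular_closedCell x
    exact labelAgrees_of_setLabel_eq hr' (le_antisymm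
      (hr.setLabel_setImage_le hreg hM hC hK hK.subset)
      (hr.le_setLabel_setImage hreg hl hC hK.subset))
  · exact hr.morseMap_ne_zero_of_closedCell_subset hreg hd hsgn hM hY huniq
      (isCriticalFace_cellIncl hY y) h
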